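/- All graphs are finite, simple and undirected. A graph is 2-connected if it has at least three vertices, is connected, and remains connected after the deletion of any one vertex. A graph is outer-1-planar if it can be drawn in the plane so that all vertices lie on the outer face and each edge is crossed at most once; equivalently, its vertices can be placed at distinct points of a circle and its edges drawn as simple arcs inside the closed disk bounded by it (passing through no vertices but their ends) such that each edge has at most one point, other than common ends, in common with all the other edges together. We use the following configurations in a graph $G$. In each of them the vertices other than $x,y$ are pairwise distinct, and their degree in $G$ equals the number of listed edges at them; $x$ and $y$ are different from these vertices, but may coincide with each other (unless the listed edges exclude this) and may have further neighbours. - $G_1$: edges $uv, ux, vy$ (so $u$, $v$ are adjacent vertices of degree $2$). - $G_2$: edges $uv, uw, vw, vx, wy$. - $G_3$: edges $ux, uy, vx, vy$ (here $x\ne y$). - $G_4$: the path $x\,u_1u_0\,w\,v_0v_1\,y$ and the chords $u_1v_0$, $u_0v_1$. - $G_5$: the path $x\,u_2u_1u_0v_0v_1v_2\,y$ and the chords $u_2v_0$, $u_0v_2$. - $G_6$: the path $x\,u_2u_1u_0\,w\,v_0v_1\,y$ and the chords $u_2v_0$, $u_0v_1$. - $G_7$: the path $x\,u_2u_1u_0\,w\,v_0v_1v_2\,y$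 and the chords $u_2v_0$, $u_0v_2$. - $G_8$: the path $x\,u_2u_1u_0v_0v_1\,y$ and the chords $u_2v_0$, $u_0v_1$. - $H_t$ ($t\ge 1$): the path $x\,u_tu_{t-1}\cdots u_1u_0v_0v_1\cdots v_{t-1}v_t\,y$, the chords $u_1v_0$, $u_0v_1$, and the edges $u_iv_i$ for $2\le i\le t$. (When $x=y$, the "path" is the closed walk with these edges.) **Theorem.** Let $G$ be a 2-connected outer-1-planar graph with maximum degree at most $3$. If $G$ is not isomorphic to $K_4$, then $G$ contains one of the configurations $G_1,\dots,G_8$, or $H_t$ for some $t\ge 1$. Moreover, for every occurrence of the respective configuration in $G$: (a) if $G$ contains $G_2$ and $x\ne y$, then the graph derived from $G$ by deleting $u$ and identifying $v$ with $w$ is outer-1-planar; (b) if $G$ contains $G_4$ and $x\ne y$, then the graph derived from $G$ by deleting $u_0,v_0,w$ and identifying $u_1$ with $v_1$ is outer-1-planar; (c) if $G$ contains $G_8$ and $x\ne y$, then the graph derived from $G$ by deleting $u_0,u_1,v_0$ and identifying $u_2$ with $v_1$ is outer-1-planar; (d) if $G$ contains $H_t$ and $x\ne y$, then the graph derived from $G$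 by deleting $u_0,\dots,u_t,v_0,\dots,v_t$ and adding the edge $xy$ (if it does not exist) is outer-1-planar. (In the identifications, loops are discarded.) -/

import Mathlib

universe u

namespace SimpleGraph

variable {V : Type u}

/-- A graph is 2-connected if it has at least three vertices, is connected, and stays connected
after the deletion of any single vertex. -/
structure IsTwoConnected [Fintype V] (G : SimpleGraph V) : Prop where
  three_le_card : 3 ≤ Fintype.card V
  connected : G.Connected
  connected_delete : ∀ v : V, (G.induce {v}ᶜ).Connected

/-- `S` is a simple (Jordan) arc of the plane with end points `a` and `b`. -/
def IsSimpleArc (S : Set ℂ) (a b : ℂ) : Prop :=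
  ∃ γ : _root_.Path a b, Function.Injective γ ∧ Set.range γ = S

/-- An outer-1-planar drawing of `G`: the vertices are distinct points of the unit circle of the
plane, the edges are simple arcs inside the closed unit disk (so that all vertices lie on the outer
face) that contain no vertices but their ends, and each edge is crossed at most once, that is, it
has at most one point, other than a common end, in common with all the other edges together. -/
structure OuterOneDrawing (G : SimpleGraph V) where
  pos : V → Circle
  pos_injective : Function.Injective pos
  arc : Sym2 V → Set ℂ
  arc_isSimpleArc : ∀ a b : V, G.Adj a b → IsSimpleArc (arc s(a, b)) (pos a) (pos b)
  arc_subset : ∀ e ∈ G.edgeSet, arc e ⊆ Metric.closedBall 0 1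
  arc_vertex : ∀ e ∈ G.edgeSet, ∀ v : V, (pos v : ℂ) ∈ arc e → v ∈ e
  crossed_at_most_once : ∀ e ∈ G.edgeSet,
    {c : Sym2 V × ℂ | c.1 ∈ G.edgeSet ∧ c.1 ≠ e ∧ c.2 ∈ arc e ∧ c.2 ∈ arc c.1 ∧
      ∀ v : V, (pos v : ℂ) ≠ c.2}.Subsingleton

/-- A graph is outer-1-planar if it has an outer-1-planar drawing. -/
def IsOuterOnePlanar (G : SimpleGraph V) : Prop := Nonempty G.OuterOneDrawing

/-- The graph obtained from `G` by deleting the vertices in `D` and identifying `q` with `p`; the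
identified vertex is called `p`. (Loops and multiple edges are discarded; meant for `p, q ∉ D`.) -/
def deleteIdentify (G : SimpleGraph V) (D : Set V) (p q : V) :
    SimpleGraph {z : V // z ∉ D ∧ z ≠ q} where
  Adj a b := a ≠ b ∧
    (G.Adj a b ∨ ((a : V) = p ∧ G.Adj q b) ∨ ((b : V) = p ∧ G.Adj a q))
  symm := ⟨by
    rintro a b ⟨hab, h | h | h⟩
    · exact ⟨hab.symm, Or.inl h.symm⟩
    · exact ⟨hab.symm, Or.inr (Or.inr ⟨h.1, h.2.symm⟩)⟩
    · exact ⟨hab.symm, Or.inr (Or.inl ⟨h.1, h.2.symm⟩)⟩⟩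
  loopless := ⟨fun _ h => h.1 rfl⟩

/-- The graph obtained from `G` by deleting the vertices in `D` and adding the edge `xy`, if it does
not exist (meant for distinct `x, y ∉ D`). -/
def deleteAddEdge (G : SimpleGraph V) (D : Set V) (x y : V) : SimpleGraph (Dᶜ : Set V) :=
  (G ⊔ SimpleGraph.edge x y).induce Dᶜ

/-! The configurations. In each of them all vertices but `x` and `y` are solid: they are distinct
and their degree in `G` is the number of edges drawn at them. The vertices `x` and `y` are hollow:
they differ from the solid vertices, but they may coincide with each other unless the drawn edges
forbid it, and they may have further neighbours. -/

/-- `G₁`: two adjacent vertices `u`, `v` of degree two, with further neighbours `x`, `y`. -/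
structure IsG1 (G : SimpleGraph V) [G.LocallyFinite] (u v x y : V) : Prop where
  solid : [u, v].Nodup
  hollow : x ∉ [u, v] ∧ y ∉ [u, v]
  degree_two : G.degree u = 2 ∧ G.degree v = 2
  edges : G.Adj u v ∧ G.Adj u x ∧ G.Adj v y

/-- `G₂`: a triangle `u v w` with `u` of degree two and `v`, `w` of degree three, with further
neighbours `x`, `y` of `v`, `w`. -/
structure IsG2 (G : SimpleGraph V) [G.LocallyFinite] (u v w x y : V) : Prop where
  solid : [u, v, w].Nodup
  hollow : x ∉ [u, v, w] ∧ y ∉ [u, v, w]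
  degree_two : G.degree u = 2
  degree_three : G.degree v = 3 ∧ G.degree w = 3
  edges : G.Adj u v ∧ G.Adj u w ∧ G.Adj v w ∧ G.Adj v x ∧ G.Adj w y

/-- `G₃`: a 4-cycle `x u y v` with `u`, `v` of degree two. -/
structure IsG3 (G : SimpleGraph V) [G.LocallyFinite] (u v x y : V) : Prop where
  solid : [u, v].Nodup
  hollow : x ∉ [u, v] ∧ y ∉ [u, v] ∧ x ≠ y
  degree_two : G.degree u = 2 ∧ G.degree v = 2
  edges : G.Adj u x ∧ G.Adj u y ∧ G.Adj v x ∧ G.Adj v y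

/-- `G₄`: the path `x u₁ u₀ w v₀ v₁ y` with the chords `u₁v₀`, `u₀v₁`. -/
structure IsG4 (G : SimpleGraph V) [G.LocallyFinite] (u₀ u₁ v₀ v₁ w x y : V) : Prop where
  solid : [u₀, u₁, v₀, v₁, w].Nodup
  hollow : x ∉ [u₀, u₁, v₀, v₁, w] ∧ y ∉ [u₀, u₁, v₀, v₁, w]
  degree_two : G.degree w = 2
  degree_three : G.degree u₀ = 3 ∧ G.degree u₁ = 3 ∧ G.degree v₀ = 3 ∧ G.degree v₁ = 3
  path : G.Adj x u₁ ∧ G.Adj u₁ u₀ ∧ G.Adj u₀ w ∧ G.Adj w v₀ ∧ G.Adj v₀ v₁ ∧ G.Adj v₁ y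
  chords : G.Adj u₁ v₀ ∧ G.Adj u₀ v₁

/-- `G₅`: the path `x u₂ u₁ u₀ v₀ v₁ v₂ y` with the chords `u₂v₀`, `u₀v₂`. -/
structure IsG5 (G : SimpleGraph V) [G.LocallyFinite] (u₀ u₁ u₂ v₀ v₁ v₂ x y : V) : Prop where
  solid : [u₀, u₁, u₂, v₀, v₁, v₂].Nodup
  hollow : x ∉ [u₀, u₁, u₂, v₀, v₁, v₂] ∧ y ∉ [u₀, u₁, u₂, v₀, v₁, v₂]
  degree_two : G.degree u₁ = 2 ∧ G.degree v₁ = 2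
  degree_three : G.degree u₀ = 3 ∧ G.degree u₂ = 3 ∧ G.degree v₀ = 3 ∧ G.degree v₂ = 3
  path : G.Adj x u₂ ∧ G.Adj u₂ u₁ ∧ G.Adj u₁ u₀ ∧ G.Adj u₀ v₀ ∧ G.Adj v₀ v₁ ∧ G.Adj v₁ v₂ ∧
    G.Adj v₂ y
  chords : G.Adj u₂ v₀ ∧ G.Adj u₀ v₂

/-- `G₆`: the path `x u₂ u₁ u₀ w v₀ v₁ y` with the chords `u₂v₀`, `u₀v₁`. -/
structure IsG6 (G : SimpleGraph V) [G.LocallyFinite] (u₀ u₁ u₂ v₀ v₁ w x y : V) : Prop where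
  solid : [u₀, u₁, u₂, v₀, v₁, w].Nodup
  hollow : x ∉ [u₀, u₁, u₂, v₀, v₁, w] ∧ y ∉ [u₀, u₁, u₂, v₀, v₁, w]
  degree_two : G.degree u₁ = 2 ∧ G.degree w = 2
  degree_three : G.degree u₀ = 3 ∧ G.degree u₂ = 3 ∧ G.degree v₀ = 3 ∧ G.degree v₁ = 3
  path : G.Adj x u₂ ∧ G.Adj u₂ u₁ ∧ G.Adj u₁ u₀ ∧ G.Adj u₀ w ∧ G.Adj w v₀ ∧ G.Adj v₀ v₁ ∧
    G.Adj v₁ y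
  chords : G.Adj u₂ v₀ ∧ G.Adj u₀ v₁

/-- `G₇`: the path `x u₂ u₁ u₀ w v₀ v₁ v₂ y` with the chords `u₂v₀`, `u₀v₂`. -/
structure IsG7 (G : SimpleGraph V) [G.LocallyFinite] (u₀ u₁ u₂ v₀ v₁ v₂ w x y : V) : Prop where
  solid : [u₀, u₁, u₂, v₀, v₁, v₂, w].Nodup
  hollow : x ∉ [u₀, u₁, u₂, v₀, v₁, v₂, w] ∧ y ∉ [u₀, u₁, u₂, v₀, v₁, v₂, w]
  degree_two : G.degree u₁ = 2 ∧ G.degree v₁ = 2 ∧ G.degree w = 2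
  degree_three : G.degree u₀ = 3 ∧ G.degree u₂ = 3 ∧ G.degree v₀ = 3 ∧ G.degree v₂ = 3
  path : G.Adj x u₂ ∧ G.Adj u₂ u₁ ∧ G.Adj u₁ u₀ ∧ G.Adj u₀ w ∧ G.Adj w v₀ ∧ G.Adj v₀ v₁ ∧
    G.Adj v₁ v₂ ∧ G.Adj v₂ y
  chords : G.Adj u₂ v₀ ∧ G.Adj u₀ v₂

/-- `G₈`: the path `x u₂ u₁ u₀ v₀ v₁ y` with the chords `u₂v₀`, `u₀v₁`. -/
structure IsG8 (G : SimpleGraph V) [G.LocallyFinite] (u₀ u₁ u₂ v₀ v₁ x y : V) : Prop where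
  solid : [u₀, u₁, u₂, v₀, v₁].Nodup
  hollow : x ∉ [u₀, u₁, u₂, v₀, v₁] ∧ y ∉ [u₀, u₁, u₂, v₀, v₁]
  degree_two : G.degree u₁ = 2
  degree_three : G.degree u₀ = 3 ∧ G.degree u₂ = 3 ∧ G.degree v₀ = 3 ∧ G.degree v₁ = 3
  path : G.Adj x u₂ ∧ G.Adj u₂ u₁ ∧ G.Adj u₁ u₀ ∧ G.Adj u₀ v₀ ∧ G.Adj v₀ v₁ ∧ G.Adj v₁ y
  chords : G.Adj u₂ v₀ ∧ G.Adj u₀ v₁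

/-- The solid vertices `u₀, …, u_t, v₀, …, v_t` of `H_t`. -/
def solidH (t : ℕ) (u v : ℕ → V) : Set V := {z | ∃ i ≤ t, z = u i ∨ z = v i}

/-- `H_t` (`t ≥ 1`): the path `x u_t … u₁ u₀ v₀ v₁ … v_t y` with the two crossing chords `u₁v₀`,
`u₀v₁` and the rungs `u_iv_i` for `2 ≤ i ≤ t`. Only the values `u i`, `v i` with `i ≤ t` matter. -/
structure IsH (G : SimpleGraph V) [G.LocallyFinite] (t : ℕ) (u v : ℕ → V) (x y : V) : Prop where
  one_le : 1 ≤ t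
  solid : ∀ i ≤ t, ∀ j ≤ t, u i ≠ v j ∧ (i ≠ j → u i ≠ u j ∧ v i ≠ v j)
  hollow : x ∉ solidH t u v ∧ y ∉ solidH t u v
  degree_three : ∀ i ≤ t, G.degree (u i) = 3 ∧ G.degree (v i) = 3
  path : G.Adj (u 0) (v 0) ∧ (∀ i < t, G.Adj (u i) (u (i + 1)) ∧ G.Adj (v i) (v (i + 1))) ∧
    G.Adj (u t) x ∧ G.Adj (v t) y
  chords : G.Adj (u 1) (v 0) ∧ G.Adj (u 0) (v 1)
  rungs : ∀ i, 2 ≤ i → i ≤ t → G.Adj (u i) (v i)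

end SimpleGraph

/-! Only the cyclic order of the vertices on the circle matters. Arcs in the closed disk whose ends
alternate must meet, by a winding number argument (`exists_eq_of_interleaved`), while straight
chords of distinct edges meet outside the vertices only if their ends alternate. So
outer-1-planarity of a finite graph amounts to an integer labelling in which every edge alternates
with at most one other edge (`IsOuterOnePlanar.exists_linearDrawing`,
`IsLinearDrawing.isOuterOnePlanar`). The rest is combinatorics of linear orders.

In (a)-(c) the two vertices to be identified are joined by two edge-disjoint paths of solid
vertices. An edge of the remaining graph that separated them would be crossed by both paths, hence
twice. Since no edge separates them, an edge leaving one may as well leave the other, and the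
identification creates no crossing (`IsLinearDrawing.deleteIdentify`).

In (d) the same argument, carried up the ladder, shows that no remaining edge separates the ends l =
u_t and r = v_t. The remaining graph is therefore a piece drawn between l and r and attached by two
edges lx and yr only. If lx is uncrossed, the new edge xy can be drawn along xl, around the outside,
and along ry. That lx can be made uncrossed is `IsPieceDrawing.exists_uncrossed`, by induction on
the piece. If y precedes x, a reflection does it. Otherwise let pq cross lx; then x and q cut the
piece into three blocks, and reversing the first two frees lx. The only crossings this can create
are between edges from x into the middle block and edges from q into the last block. By the degree
bound and 2-connectedness there is at most one such pair, and the induction hypothesis, applied to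
the middle and the last block, makes both edges uncrossed beforehand.

For the existence of a configuration, consider an interval of the order whose interior sends no edge
outside the interval and has at least two vertices, with as few of them as possible
(`IsSpan.hasConfiguration_or`). Let i, j be its ends and k the last inner neighbour of i. If ik is
uncrossed, it cuts off intervals so short that `G₁` or `G₂` appears. Otherwise minimality forces the
edge crossing ik to end at j, and the two crossing edges cut the interval into three intervals with
at most one inner vertex each. Each of these is bare, a single edge, or a path through a vertex of
degree two. A bare one yields one of `G₁`, `G₂`, `G₃`; if none is bare, the pattern of edges and
paths decides between `G₄`, …, `G₈` and `H_1`, apart from closed cases that give `G₁`, `G₃` or K₄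
(`IsKite.hasConfiguration_or`). Ladders with t > 1 are not needed for existence. -/

/-! ### Arcs in the disk with alternating ends meet. -/

-- Half-angle formulas give 1 - e^{iθ} = 2 sin(θ/2) e^{i(θ-π)/2}, where the modulus is positive and
-- the exponent lies in the principal range.
open Complex Set in
theorem log_im_one_sub_exp {θ : ℝ} (h0 : 0 < θ) (h1 : θ < 2 * Real.pi) :
    (log (1 - exp (θ * I))).im = (θ - Real.pi) / 2 := by
  have hs : 0 < 2 * Real.sin (θ / 2) :=
    mul_pos two_pos (Real.sin_pos_of_pos_of_lt_pi (by linarith) (by linarith))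
  have e : 1 - exp (θ * I) = ((2 * Real.sin (θ / 2) : ℝ) : ℂ) *
      (Real.cos ((θ - Real.pi) / 2) + Real.sin ((θ - Real.pi) / 2) * I) := by
    have hc : Real.cos ((θ - Real.pi) / 2) = Real.sin (θ / 2) := by
      rw [show (θ - Real.pi) / 2 = θ / 2 - Real.pi / 2 by ring, Real.cos_sub_pi_div_two]
    have hn : Real.sin ((θ - Real.pi) / 2) = - Real.cos (θ / 2) := by
      rw [show (θ - Real.pi) / 2 = θ / 2 - Real.pi / 2 by ring, Real.sin_sub_pi_div_two]
    have h2 : Real.cos θ = 1 - 2 * Real.sin (θ / 2) ^ 2 := by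
      rw [show θ = 2 * (θ / 2) by ring, Real.cos_two_mul, Real.cos_sq']
      ring_nf
    have h3 : Real.sin θ = 2 * Real.sin (θ / 2) * Real.cos (θ / 2) := by
      rw [← Real.sin_two_mul]; ring_nf
    rw [hc, hn, exp_mul_I, ← ofReal_cos, ← ofReal_sin, h2, h3]
    push_cast
    ring
  rw [log_im, e, Complex.ofReal_cos, Complex.ofReal_sin,
    arg_mul_cos_add_sin_mul_I hs ⟨by linarith, by linarith⟩]

open Complex Set in
theorem log_im_one_sub_exp_neg {θ : ℝ} (h0 : 0 < θ) (h1 : θ < 2 * Real.pi) :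
    (log (1 - exp (-θ * I))).im = -((θ - Real.pi) / 2) := by
  have := log_im_one_sub_exp (θ := 2 * Real.pi - θ) (by linarith) (by linarith)
  have e : exp (((2 * Real.pi - θ : ℝ) : ℂ) * I) = exp (-θ * I) := by
    rw [← exp_periodic (-θ * I)]
    congr 1
    push_cast
    ring
  rw [e] at this
  rw [this]
  ring

-- While h/a stays in the right half plane, the principal logarithm of h/a is continuous and differs
-- from the lift g only by a logarithm of a. By uniqueness of lifts along the covering exp this
-- difference is constant.
open Complex Set in
theorem exp_lift_sub {g h : ℝ → ℂ} (hg : Continuous g) (hgh : ∀ t, exp (g t) = h t) {a : ℂ}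
    (ha : a ≠ 0) (hh : ∀ t, 0 < (h t / a).re) :
    g 1 - g 0 = log (h 1 / a) - log (h 0 / a) := by
  have hc : Continuous h := by
    have : h = fun t => exp (g t) := funext fun t => (hgh t).symm
    rw [this]; fun_prop
  have hD : Continuous fun t => g t - log (h t / a) :=
    hg.sub (Continuous.clog (hc.div_const a) fun t => Or.inl (hh t))
  have hexp : ∀ t, exp (g t - log (h t / a)) = a := by
    intro t
    have hne : h t / a ≠ 0 := fun e => by have := hh t; rw [e] at this; simp at this
    rw [exp_sub, exp_log hne, hgh]
    have : h t ≠ 0 := fun e => hne (by rw [e, zero_div])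
    field_simp
  have := isCoveringMap_exp.eq_of_comp_eq hD
    (continuous_const (y := g 0 - log (h 0 / a)))
    (by funext t; simp only [Function.comp]; ext1; simp only [hexp]) 0 rfl
  have h1 : g 1 - log (h 1 / a) = g 0 - log (h 0 / a) := congrFun this 1
  linear_combination h1

open Complex Set in
theorem re_one_sub_div_pos {a b : ℂ} (ha : ‖a‖ = 1) (hb : ‖b‖ ≤ 1) (hab : a ≠ b) :
    0 < ((a - b) / a).re := by
  have ha0 : a ≠ 0 := by rintro rfl; simp at ha
  rw [sub_div, div_self ha0]
  have hz : ‖b / a‖ ≤ 1 := by rw [norm_div, ha, div_one]; exact hb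
  have hne : b / a ≠ 1 := fun e => hab (by rw [div_eq_one_iff_eq ha0] at e; exact e.symm)
  have hre : (b / a).re ≤ 1 := (re_le_norm _).trans hz
  rcases hre.lt_or_eq with h | h
  · simp only [sub_re, one_re]; linarith
  · exfalso
    apply hne
    have h2 : normSq (b / a) ≤ 1 := by
      rw [normSq_eq_norm_sq]; exact pow_le_one₀ (norm_nonneg _) hz
    rw [normSq_apply, h] at h2
    have : (b / a).im = 0 := by nlinarith [mul_self_nonneg (b / a).im]
    exact Complex.ext (by simpa using h) (by simpa using this)

open Complex Set in
/-- Two paths in the closed unit disk whose end points alternate on the unit circle meet. -/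
theorem exists_eq_of_interleaved {α β γ δ : ℝ} (h1 : α < γ) (h2 : γ < β) (h3 : β < δ)
    (h4 : δ < α + 2 * Real.pi) (p : Path (exp (α * I)) (exp (β * I)))
    (q : Path (exp (γ * I)) (exp (δ * I))) (hp : ∀ t, ‖p t‖ ≤ 1) (hq : ∀ t, ‖q t‖ ≤ 1) :
    ∃ s t, p s = q t := by
  by_contra! hne
  have hpe : ∀ t, ‖p.extend t‖ ≤ 1 := fun t => by
    have : p.extend t ∈ range p := by rw [← p.extend_range]; exact mem_range_self t
    obtain ⟨s, hs⟩ := this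
    rw [← hs]; exact hp s
  have hqe : ∀ t, ‖q.extend t‖ ≤ 1 := fun t => by
    have : q.extend t ∈ range q := by rw [← q.extend_range]; exact mem_range_self t
    obtain ⟨s, hs⟩ := this
    rw [← hs]; exact hq s
  have hpq : ∀ s t, p.extend s ≠ q.extend t := fun s t e => by
    have h1 : p.extend s ∈ range p := by rw [← p.extend_range]; exact mem_range_self s
    have h2 : q.extend t ∈ range q := by rw [← q.extend_range]; exact mem_range_self t
    obtain ⟨s', hs⟩ := h1
    obtain ⟨t', ht⟩ := h2
    exact hne s' t' (by rw [hs, ht, e])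
  -- If the paths were disjoint, the difference p(s) - q(t) would have a continuous logarithm on the
  -- simply connected plane of parameters, so its argument could not change around the boundary of
  -- the unit square.
  let F : C(ℝ × ℝ, ℂ) := ⟨fun x => p.extend x.1 - q.extend x.2, by
    have := p.continuous_extend
    have := q.continuous_extend
    fun_prop⟩
  have hF : ∀ x, F x ≠ 0 := fun x e => hpq x.1 x.2 (sub_eq_zero.mp e)
  obtain ⟨G, ⟨-, hG⟩, -⟩ := isCoveringMapOn_exp.existsUnique_continuousMap_lifts F
    (a₀ := (0, 0)) (exp_log (hF (0, 0))) hF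
  have hG' : ∀ s t, exp (G (s, t)) = p.extend s - q.extend t := fun s t => congrFun hG (s, t)
  have hGc : Continuous G := G.continuous
  have nrm : ∀ x : ℝ, ‖exp (x * I)‖ = 1 := fun x => norm_exp_ofReal_mul_I x
  have nz : ∀ x : ℝ, exp (x * I) ≠ 0 := fun x => exp_ne_zero _
  -- On each side of the square one of the two points is fixed on the unit circle and the other
  -- stays in the disk, so the quotient by the fixed point (up to sign) remains in the right half
  -- plane and the principal branch gives the change of argument.
  have E1 := exp_lift_sub (g := fun t => G (0, t)) (a := exp (α * I)) (by fun_prop)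
    (fun t => hG' 0 t) (nz α) (fun t => by
      have := hpq 0 t
      rw [p.extend_zero] at this ⊢
      exact re_one_sub_div_pos (nrm α) (hqe t) this)
  have E2 := exp_lift_sub (g := fun t => G (1, t)) (a := exp (β * I)) (by fun_prop)
    (fun t => hG' 1 t) (nz β) (fun t => by
      have := hpq 1 t
      rw [p.extend_one] at this ⊢
      exact re_one_sub_div_pos (nrm β) (hqe t) this)
  have E3 := exp_lift_sub (g := fun s => G (s, 0)) (a := -exp (γ * I)) (by fun_prop)
    (fun s => hG' s 0) (neg_ne_zero.mpr (nz γ)) (fun s => by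
      have := hpq s 0
      rw [q.extend_zero] at this ⊢
      have := re_one_sub_div_pos (nrm γ) (hpe s) this.symm
      rwa [div_neg, ← neg_div, neg_sub])
  have E4 := exp_lift_sub (g := fun s => G (s, 1)) (a := -exp (δ * I)) (by fun_prop)
    (fun s => hG' s 1) (neg_ne_zero.mpr (nz δ)) (fun s => by
      have := hpq s 1
      rw [q.extend_one] at this ⊢
      have := re_one_sub_div_pos (nrm δ) (hpe s) this.symm
      rwa [div_neg, ← neg_div, neg_sub])
  simp only [p.extend_zero, q.extend_zero, p.extend_one, q.extend_one, div_neg, ← neg_div,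
    neg_sub] at E1 E2 E3 E4
  have dv : ∀ x y : ℝ, (exp (x * I) - exp (y * I)) / exp (x * I) = 1 - exp ((y - x : ℝ) * I) := by
    intro x y
    rw [sub_div, div_self (nz x), ← exp_sub]
    congr 2
    push_cast
    ring
  have pos : ∀ x y : ℝ, x < y → y < x + 2 * Real.pi →
      (log (1 - exp ((y - x : ℝ) * I))).im = (y - x - Real.pi) / 2 := fun x y h h' =>
    log_im_one_sub_exp (by linarith) (by linarith)
  have neg : ∀ x y : ℝ, x < y → y < x + 2 * Real.pi →
      (log (1 - exp ((x - y : ℝ) * I))).im = -((y - x - Real.pi) / 2) := fun x y h h' => by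
    rw [← log_im_one_sub_exp_neg (θ := y - x) (by linarith) (by linarith)]
    congr 4
    push_cast
    ring
  rw [dv, dv] at E1 E2 E3 E4
  have I1 := congrArg im E1
  have I2 := congrArg im E2
  have I3 := congrArg im E3
  have I4 := congrArg im E4
  simp only [sub_im] at I1 I2 I3 I4
  rw [pos α δ (by linarith) (by linarith), pos α γ (by linarith) (by linarith)] at I1
  rw [pos β δ (by linarith) (by linarith), neg γ β (by linarith) (by linarith)] at I2
  rw [pos γ β (by linarith) (by linarith), neg α γ (by linarith) (by linarith)] at I3
  rw [neg β δ (by linarith) (by linarith), neg α δ (by linarith) (by linarith)] at I4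
  -- From (0,0) to (1,1) the argument changes by (δ-γ)/2 + (β-α)/2 along one pair of sides, and by
  -- 2π less along the other pair.
  linarith [Real.pi_pos]

/-! ### From drawings to linear arrangements. -/

namespace SimpleGraph
variable {V : Type u}

/-- On a line, the pairs `a, b` and `c, d` alternate. -/
def Cross {α : Type*} [LT α] (a b c d : α) : Prop :=
  (a < c ∧ c < b ∧ b < d) ∨ (a < d ∧ d < b ∧ b < c) ∨ (b < c ∧ c < a ∧ a < d) ∨
  (b < d ∧ d < a ∧ a < c) ∨ (c < a ∧ a < d ∧ d < b) ∨ (d < a ∧ a < c ∧ c < b) ∨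
  (c < b ∧ b < d ∧ d < a) ∨ (d < b ∧ b < c ∧ c < a)

theorem Cross.symm {α : Type*} [LT α] {a b c d : α} (h : Cross a b c d) : Cross c d a b := by
  rcases h with h | h | h | h | h | h | h | h <;> simp [Cross, h]

theorem Cross.swap_left {α : Type*} [LT α] {a b c d : α} (h : Cross a b c d) : Cross b a c d := by
  rcases h with h | h | h | h | h | h | h | h <;> simp [Cross, h]

theorem Cross.swap_right {α : Type*} [LT α] {a b c d : α} (h : Cross a b c d) :
    Cross a b d c := by
  rcases h with h | h | h | h | h | h | h | h <;> simp [Cross, h]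

/-- A linear arrangement of the vertices in which each edge is crossed by at most one other edge. -/
structure IsLinearDrawing (G : SimpleGraph V) (f : V → ℤ) : Prop where
  injective : Function.Injective f
  cross_unique : ∀ {a b c d c' d' : V}, G.Adj a b → G.Adj c d → G.Adj c' d' →
    Cross (f a) (f b) (f c) (f d) → Cross (f a) (f b) (f c') (f d') → s(c, d) = s(c', d')

section ToLinear
open Complex

theorem circle_coe_eq_exp (z : Circle) : (z : ℂ) = exp ((arg z : ℝ) * I) := by
  have := norm_mul_exp_arg_mul_I (z : ℂ)
  rw [Circle.norm_coe] at this
  simpa using this.symm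

/-- Arcs in the closed disk with alternating ends on the unit circle meet. -/
theorem IsSimpleArc.inter_nonempty {S T : Set ℂ} {a b c d : Circle} (hS : IsSimpleArc S a b)
    (hT : IsSimpleArc T c d) (hS1 : S ⊆ Metric.closedBall 0 1) (hT1 : T ⊆ Metric.closedBall 0 1)
    (h1 : arg a < arg c) (h2 : arg c < arg b) (h3 : arg b < arg d) : (S ∩ T).Nonempty := by
  obtain ⟨p, -, rfl⟩ := hS
  obtain ⟨q, -, rfl⟩ := hT
  obtain ⟨s, t, h⟩ := exists_eq_of_interleaved h1 h2 h3
    (by linarith [arg_le_pi (d : ℂ), neg_pi_lt_arg (a : ℂ)])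
    (p.cast (circle_coe_eq_exp a).symm (circle_coe_eq_exp b).symm)
    (q.cast (circle_coe_eq_exp c).symm (circle_coe_eq_exp d).symm)
    (fun t => by simpa using hS1 (Set.mem_range_self t))
    (fun t => by simpa using hT1 (Set.mem_range_self t))
  exact ⟨p s, Set.mem_range_self s, t, h.symm⟩

theorem IsSimpleArc.symm {S : Set ℂ} {a b : ℂ} (h : IsSimpleArc S a b) : IsSimpleArc S b a := by
  obtain ⟨p, hp, rfl⟩ := h
  exact ⟨p.symm, fun x y hxy => unitInterval.symm_bijective.injective (hp hxy), p.symm_range⟩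

variable {G : SimpleGraph V}

theorem OuterOneDrawing.inter_nonempty (D : G.OuterOneDrawing) {a b c d : V} (hab : G.Adj a b)
    (hcd : G.Adj c d) (h : Cross (arg (D.pos a)) (arg (D.pos b)) (arg (D.pos c)) (arg (D.pos d))) :
    (D.arc s(a, b) ∩ D.arc s(c, d)).Nonempty := by
  have A := D.arc_isSimpleArc a b hab
  have C := D.arc_isSimpleArc c d hcd
  have A1 := D.arc_subset s(a, b) hab
  have C1 := D.arc_subset s(c, d) hcd
  rcases h with h | h | h | h | h | h | h | h <;> obtain ⟨h1, h2, h3⟩ := h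
  · exact A.inter_nonempty C A1 C1 h1 h2 h3
  · exact A.inter_nonempty C.symm A1 C1 h1 h2 h3
  · exact A.symm.inter_nonempty C A1 C1 h1 h2 h3
  · exact A.symm.inter_nonempty C.symm A1 C1 h1 h2 h3
  all_goals rw [Set.inter_comm]
  · exact C.inter_nonempty A C1 A1 h1 h2 h3
  · exact C.symm.inter_nonempty A C1 A1 h1 h2 h3
  · exact C.inter_nonempty A.symm C1 A1 h1 h2 h3
  · exact C.symm.inter_nonempty A.symm C1 A1 h1 h2 h3

theorem Cross.ne {α : Type*} [Preorder α] {a b c d : α} (h : Cross a b c d) :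
    a ≠ c ∧ a ≠ d ∧ b ≠ c ∧ b ≠ d := by
  unfold Cross at h
  refine ⟨?_, ?_, ?_, ?_⟩ <;> rintro rfl <;>
    rcases h with h | h | h | h | h | h | h | h <;> obtain ⟨h1, h2, h3⟩ := h <;>
    first
    | exact lt_irrefl _ h1
    | exact lt_irrefl _ h2
    | exact lt_irrefl _ h3
    | exact lt_irrefl _ (h1.trans h2)
    | exact lt_irrefl _ (h2.trans h3)
    | exact lt_irrefl _ (h1.trans (h2.trans h3))

/-- A common point of the arcs that is a vertex would be an end of both edges, but alternating pairs
share no end. So every alternation counts as a crossing in the sense of `crossed_at_most_once`. -/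
theorem OuterOneDrawing.mem_crossings (D : G.OuterOneDrawing) {a b c d : V} (hab : G.Adj a b)
    (hcd : G.Adj c d) (h : Cross (arg (D.pos a)) (arg (D.pos b)) (arg (D.pos c)) (arg (D.pos d))) :
    ∃ z, (s(c, d), z) ∈ {c : Sym2 V × ℂ | c.1 ∈ G.edgeSet ∧ c.1 ≠ s(a, b) ∧ c.2 ∈ D.arc s(a, b) ∧
      c.2 ∈ D.arc c.1 ∧ ∀ v : V, (D.pos v : ℂ) ≠ c.2} := by
  obtain ⟨z, hz1, hz2⟩ := D.inter_nonempty hab hcd h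
  obtain ⟨n1, n2, n3, n4⟩ := h.ne
  have n1 : a ≠ c := fun e => n1 (by rw [e])
  have n2 : a ≠ d := fun e => n2 (by rw [e])
  have n3 : b ≠ c := fun e => n3 (by rw [e])
  have n4 : b ≠ d := fun e => n4 (by rw [e])
  refine ⟨z, hcd, ?_, hz1, hz2, ?_⟩
  · simp only [ne_eq, Sym2.eq_iff]; tauto
  · rintro v rfl
    have h1 := D.arc_vertex _ hab v hz1
    have h2 := D.arc_vertex _ hcd v hz2
    simp only [Sym2.mem_iff] at h1 h2
    rcases h1 with rfl | rfl <;> tauto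

/-- The circle is cut open at -1 and the vertices are ordered by their argument. -/
theorem IsOuterOnePlanar.exists_linearDrawing [Fintype V] (h : G.IsOuterOnePlanar) :
    ∃ f, G.IsLinearDrawing f := by
  classical
  obtain ⟨D⟩ := h
  let F : V → ℝ := fun v => arg (D.pos v)
  have hF : Function.Injective F := fun v w e => by
    apply D.pos_injective
    apply Circle.ext
    have e' : arg (D.pos v) = arg (D.pos w) := e
    rw [circle_coe_eq_exp (D.pos v), e', ← circle_coe_eq_exp]
  -- The rank of the argument; alternation depends on the order alone.
  let f : V → ℤ := fun v => (Finset.univ.filter fun w => F w < F v).card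
  have hlt : ∀ v w, F v < F w → f v < f w := by
    intro v w h
    simp only [f, Nat.cast_lt]
    apply Finset.card_lt_card
    rw [Finset.ssubset_iff_of_subset]
    · exact ⟨v, by simpa using h, by simp⟩
    · intro z hz
      simp only [Finset.mem_filter, Finset.mem_univ, true_and] at hz ⊢
      exact hz.trans h
  have hiff : ∀ v w, f v < f w ↔ F v < F w := by
    intro v w
    refine ⟨fun h => ?_, hlt v w⟩
    rcases lt_trichotomy (F v) (F w) with h' | h' | h'
    · exact h'
    · rw [hF h'] at h; exact absurd h (lt_irrefl _)
    · exact absurd (hlt _ _ h') (not_lt.mpr h.le)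
  refine ⟨f, fun v w e => ?_, ?_⟩
  · rcases lt_trichotomy (F v) (F w) with h' | h' | h'
    · exact absurd (hlt _ _ h') (by rw [e]; exact lt_irrefl _)
    · exact hF h'
    · exact absurd (hlt _ _ h') (by rw [e]; exact lt_irrefl _)
  · intro a b c d c' d' hab hcd hcd' h1 h2
    simp only [Cross, hiff] at h1 h2
    obtain ⟨z, hz⟩ := D.mem_crossings hab hcd h1
    obtain ⟨z', hz'⟩ := D.mem_crossings hab hcd' h2
    exact congrArg Prod.fst (D.crossed_at_most_once _ hab hz hz')

end ToLinear

/-! ### From linear arrangements to drawings with straight chords. -/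

section OfLinear

/-- The rational parametrization of the unit circle. -/
noncomputable def circlePoint (t : ℝ) : Circle :=
  ⟨⟨(1 - t ^ 2) / (1 + t ^ 2), 2 * t / (1 + t ^ 2)⟩, by
    have h : (1 + t ^ 2) ≠ 0 := by positivity
    refine mem_sphere_zero_iff_norm.mpr ?_
    rw [← sq_eq_sq₀ (norm_nonneg _) zero_le_one, ← Complex.normSq_eq_norm_sq, Complex.normSq_apply]
    field_simp
    ring⟩

/-- An affine functional that vanishes on the chord from `circlePoint s` to `circlePoint t`. -/
noncomputable def chordForm (s t : ℝ) (z : ℂ) : ℝ :=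
  (1 - z.re) / 2 - (s + t) * z.im / 2 + s * t * (1 + z.re) / 2

/-- The sign at a point of the circle tells whether its parameter lies between s and t, which turns
questions about sides of a chord into questions about order. -/
theorem chordForm_circlePoint (s t r : ℝ) :
    chordForm s t (circlePoint r) = (r - s) * (r - t) / (1 + r ^ 2) := by
  have h : (1 + r ^ 2) ≠ 0 := by positivity
  simp only [chordForm, circlePoint]
  field_simp
  ring

theorem chordForm_combo (s t : ℝ) (z w : ℂ) (k : ℝ) :
    chordForm s t (AffineMap.lineMap z w k) = (1 - k) * chordForm s t z + k * chordForm s t w := by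
  simp only [chordForm, AffineMap.lineMap_apply_module, Complex.add_re, Complex.add_im,
    Complex.real_smul, Complex.re_ofReal_mul, Complex.im_ofReal_mul]
  ring

theorem circlePoint_injective : Function.Injective circlePoint := by
  intro s t h
  have h1 := chordForm_circlePoint s s t
  rw [← h, chordForm_circlePoint] at h1
  have h2 : (1 + t ^ 2) ≠ 0 := by positivity
  simp only [sub_self, zero_mul, zero_div] at h1
  have := (div_eq_zero_iff.mp h1.symm).resolve_right h2
  nlinarith [mul_self_eq_zero.mp this]

theorem chordForm_eq_zero_of_mem {s t : ℝ} {z : ℂ}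
    (hz : z ∈ segment ℝ (circlePoint s : ℂ) (circlePoint t)) : chordForm s t z = 0 := by
  rw [segment_eq_image_lineMap] at hz
  obtain ⟨k, -, rfl⟩ := hz
  simp [chordForm_combo, chordForm_circlePoint]

theorem isSimpleArc_segment {a b : ℂ} (h : a ≠ b) : IsSimpleArc (segment ℝ a b) a b := by
  refine ⟨⟨⟨fun t => AffineMap.lineMap a b (t : ℝ), by fun_prop⟩, by simp, by simp⟩, ?_, ?_⟩
  · intro s t e
    exact Subtype.ext (AffineMap.lineMap_injective ℝ h e)
  · rw [segment_eq_image_lineMap]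
    ext z
    constructor
    · rintro ⟨t, rfl⟩
      exact ⟨t, t.2, rfl⟩
    · rintro ⟨t, ht, rfl⟩
      exact ⟨⟨t, ht⟩, rfl⟩

/-- Chords of the circle that meet outside their ends have alternating ends. -/
theorem cross_of_mem_segments {a b c d : ℝ} {z : ℂ}
    (h1 : z ∈ segment ℝ (circlePoint a : ℂ) (circlePoint b))
    (h2 : z ∈ segment ℝ (circlePoint c : ℂ) (circlePoint d))
    (hc : (circlePoint c : ℂ) ≠ z) (hd : (circlePoint d : ℂ) ≠ z) :
    (c - a) * (c - b) * ((d - a) * (d - b)) < 0 ∨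
      (c - a) * (c - b) = 0 ∧ (d - a) * (d - b) = 0 := by
  have hz := chordForm_eq_zero_of_mem h1
  rw [segment_eq_image_lineMap] at h2
  obtain ⟨k, ⟨hk0, hk1⟩, rfl⟩ := h2
  have k0 : 0 < k := hk0.lt_of_ne (by rintro rfl; simp at hc)
  have k1 : k < 1 := hk1.lt_of_ne (by rintro rfl; simp at hd)
  rw [chordForm_combo, chordForm_circlePoint, chordForm_circlePoint] at hz
  have pc : (0 : ℝ) < 1 + c ^ 2 := by positivity
  have pd : (0 : ℝ) < 1 + d ^ 2 := by positivity
  set C := (c - a) * (c - b)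
  set E := (d - a) * (d - b)
  have p1 : 0 < (1 - k) / (1 + c ^ 2) := div_pos (by linarith) pc
  have p2 : 0 < k / (1 + d ^ 2) := div_pos k0 pd
  -- The form of the chord ab vanishes at an inner point of cd, so with positive weights its values
  -- at c and d cancel: they have opposite signs or are both zero.
  have hz' : (1 - k) / (1 + c ^ 2) * C + k / (1 + d ^ 2) * E = 0 := by
    rw [← hz]; ring
  generalize (1 - k) / (1 + c ^ 2) = m at *
  generalize k / (1 + d ^ 2) = n at *
  rcases lt_trichotomy C 0 with h | h | h
  · left
    have : 0 < E := by
      by_contra hE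
      nlinarith
    exact mul_neg_of_neg_of_pos h this
  · right
    refine ⟨h, ?_⟩
    rw [h, mul_zero, zero_add] at hz'
    exact (mul_eq_zero.mp hz').resolve_left p2.ne'
  · left
    have : E < 0 := by
      by_contra hE
      nlinarith
    exact mul_neg_of_pos_of_neg h this

theorem cross_of_mul_neg {a b c d : ℝ} (h : (c - a) * (c - b) * ((d - a) * (d - b)) < 0) :
    Cross a b c d := by
  have key : ∀ r : ℝ, 0 < (r - a) * (r - b) → (r < a ∧ r < b) ∨ (a < r ∧ b < r) := by
    intro r hr
    rcases pos_and_pos_or_neg_and_neg_of_mul_pos hr with ⟨h1, h2⟩ | ⟨h1, h2⟩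
    · right; constructor <;> linarith
    · left; constructor <;> linarith
  have key' : ∀ r : ℝ, (r - a) * (r - b) < 0 → (r < a ∧ b < r) ∨ (a < r ∧ r < b) := by
    intro r hr
    rcases mul_neg_iff.mp hr with ⟨h1, h2⟩ | ⟨h1, h2⟩
    · right; constructor <;> linarith
    · left; constructor <;> linarith
  unfold Cross
  rcases mul_neg_iff.mp h with ⟨h1, h2⟩ | ⟨h1, h2⟩
  · rcases key _ h1 with h1 | h1 <;> rcases key' _ h2 with h2 | h2 <;> simp [h1, h2]
  · rcases key' _ h1 with h1 | h1 <;> rcases key _ h2 with h2 | h2 <;> simp [h1, h2]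

/-- The form of the chord ab is affine along cd and nonzero at c, hence has at most one zero there.
-/
theorem segment_inter_subsingleton {a b c d : ℝ} (h : Cross a b c d) {z w : ℂ}
    (hz1 : z ∈ segment ℝ (circlePoint a : ℂ) (circlePoint b))
    (hz2 : z ∈ segment ℝ (circlePoint c : ℂ) (circlePoint d))
    (hw1 : w ∈ segment ℝ (circlePoint a : ℂ) (circlePoint b))
    (hw2 : w ∈ segment ℝ (circlePoint c : ℂ) (circlePoint d)) : z = w := by
  have hz := chordForm_eq_zero_of_mem hz1
  have hw := chordForm_eq_zero_of_mem hw1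
  rw [segment_eq_image_lineMap] at hz2 hw2
  obtain ⟨k, -, rfl⟩ := hz2
  obtain ⟨l, -, rfl⟩ := hw2
  rw [chordForm_combo] at hz hw
  have hne : chordForm a b (circlePoint c) ≠ 0 := by
    obtain ⟨n1, -, n3, -⟩ := h.ne
    rw [chordForm_circlePoint]
    have : (1 + c ^ 2) ≠ 0 := by positivity
    exact div_ne_zero (mul_ne_zero (sub_ne_zero.mpr n1.symm) (sub_ne_zero.mpr n3.symm)) this
  have : k = l := by
    by_contra hkl
    have e1 : (k - l) * (chordForm a b (circlePoint d) - chordForm a b (circlePoint c)) = 0 := by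
      linear_combination hz - hw
    have e2 := (mul_eq_zero.mp e1).resolve_left (sub_ne_zero.mpr hkl)
    apply hne
    linear_combination hz - k * e2
  rw [this]

theorem IsLinearDrawing.isOuterOnePlanar {G : SimpleGraph V} {f : V → ℤ}
    (h : G.IsLinearDrawing f) : G.IsOuterOnePlanar := by
  let P : V → Circle := fun v => circlePoint (f v)
  have hP : Function.Injective P := fun v w e =>
    h.injective (Int.cast_injective (circlePoint_injective e))
  have hPC : ∀ {v w}, v ≠ w → (P v : ℂ) ≠ P w := fun hvw e => hvw (hP (Circle.ext e))
  have hcast : ∀ a b c d : V, Cross (f a : ℝ) (f b) (f c) (f d) →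
      Cross (f a) (f b) (f c) (f d) := by
    intro a b c d h
    simpa only [Cross, Int.cast_lt] using h
  have crossing : ∀ {a b c d : V} {z : ℂ}, G.Adj a b → s(c, d) ≠ s(a, b) → c ≠ d →
      z ∈ segment ℝ (P a : ℂ) (P b) → z ∈ segment ℝ (P c : ℂ) (P d) →
      (∀ v, (P v : ℂ) ≠ z) → Cross (f a : ℝ) (f b) (f c) (f d) := by
    intro a b c d z hab hne hcd h1 h2 h3
    rcases cross_of_mem_segments h1 h2 (h3 c) (h3 d) with h' | ⟨h', h''⟩
    · exact cross_of_mul_neg h'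
    -- In the degenerate alternative c and d are both ends of ab, so the two edges coincide.
    · exfalso
      simp only [mul_eq_zero, sub_eq_zero, Int.cast_inj, h.injective.eq_iff] at h' h''
      apply hne
      rw [Sym2.eq_iff]
      rcases h' with rfl | rfl <;> rcases h'' with rfl | rfl <;> simp_all
  refine ⟨⟨P, hP, fun e => Sym2.lift ⟨fun a b => segment ℝ (P a : ℂ) (P b),
    fun a b => segment_symm _ _ _⟩ e, ?_, ?_, ?_, ?_⟩⟩
  · intro a b hab
    exact isSimpleArc_segment (hPC hab.ne)
  · intro e he
    induction e with | _ a b =>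
    apply (convex_closedBall (0 : ℂ) 1).segment_subset <;>
      exact mem_closedBall_zero_iff.mpr (Circle.norm_coe _).le
  · intro e he v hv
    induction e with | _ a b =>
    have := chordForm_eq_zero_of_mem hv
    rw [chordForm_circlePoint] at this
    have h2 : (1 + (f v : ℝ) ^ 2) ≠ 0 := by positivity
    have := (div_eq_zero_iff.mp this).resolve_right h2
    simp only [mul_eq_zero, sub_eq_zero, Int.cast_inj, h.injective.eq_iff] at this
    simpa using this
  · intro e he
    induction e with | _ a b =>
    rintro ⟨e1, z1⟩ ⟨he1, hne1, hz1, hz1', hv1⟩ ⟨e2, z2⟩ ⟨he2, hne2, hz2, hz2', hv2⟩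
    induction e1 with | _ c d =>
    induction e2 with | _ c' d' =>
    simp only [Sym2.lift_mk] at *
    have x1 := crossing he hne1 (G.ne_of_adj he1) hz1 hz1' hv1
    have x2 := crossing he hne2 (G.ne_of_adj he2) hz2 hz2' hv2
    have e := h.cross_unique he he1 he2 (hcast _ _ _ _ x1) (hcast _ _ _ _ x2)
    have hz : z1 = z2 := by
      apply segment_inter_subsingleton x1 hz1 hz1' hz2
      have := congrArg (Sym2.lift ⟨fun a b => segment ℝ (P a : ℂ) (P b),
        fun a b => segment_symm _ _ _⟩) e
      simp only [Sym2.lift_mk] at this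
      rw [← this] at hz2'
      exact hz2'
    rw [e, hz]

end OfLinear
end SimpleGraph

/-! ### Calculus of alternating pairs. -/

namespace SimpleGraph
variable {V : Type u}

theorem cross_iff_of_lt {a b c d : ℤ} (hab : a < b) (hcd : c < d) :
    Cross a b c d ↔ (a < c ∧ c < b ∧ b < d) ∨ (c < a ∧ a < d ∧ d < b) := by
  constructor
  · rintro (h | h | h | h | h | h | h | h) <;> omega
  · rintro (h | h) <;> simp [Cross, h]

/-- `x` lies strictly between `a` and `b`. -/
def Btw (a b x : ℤ) : Prop := (a < x ∧ x < b) ∨ (b < x ∧ x < a)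

theorem Btw.symm {a b x : ℤ} (h : Btw a b x) : Btw b a x := Or.symm h

theorem btw_comm {a b x : ℤ} : Btw a b x ↔ Btw b a x := ⟨Btw.symm, Btw.symm⟩

theorem btw_iff_of_lt {a b x : ℤ} (h : a < b) : Btw a b x ↔ a < x ∧ x < b := by
  unfold Btw; omega

theorem cross_comm_left {a b c d : ℤ} : Cross a b c d ↔ Cross b a c d :=
  ⟨Cross.swap_left, Cross.swap_left⟩

theorem cross_comm_right {a b c d : ℤ} : Cross a b c d ↔ Cross a b d c :=
  ⟨Cross.swap_right, Cross.swap_right⟩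

theorem not_cross_self_left {a c d : ℤ} : ¬ Cross a a c d := by
  rintro (h | h | h | h | h | h | h | h) <;> omega

theorem not_cross_self_right {a c d : ℤ} : ¬ Cross c d a a := by
  rintro (h | h | h | h | h | h | h | h) <;> omega

/-- Two pairs alternate iff exactly one element of the first lies between those of the second. -/
theorem cross_iff_btw {a b c d : ℤ} (h1 : a ≠ c) (h2 : a ≠ d) (h3 : b ≠ c) (h4 : b ≠ d) :
    Cross a b c d ↔ ¬ (Btw c d a ↔ Btw c d b) := by
  rcases lt_trichotomy c d with h | rfl | h
  · rw [btw_iff_of_lt h, btw_iff_of_lt h]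
    rcases lt_trichotomy a b with h' | rfl | h'
    · rw [cross_iff_of_lt h' h]; omega
    · simp [not_cross_self_left]
    · rw [cross_comm_left, cross_iff_of_lt h' h]; omega
  · simp only [not_cross_self_right, false_iff, not_not, Btw]; omega
  · rw [btw_comm, btw_iff_of_lt h, btw_comm, btw_iff_of_lt h, cross_comm_right]
    rcases lt_trichotomy a b with h' | rfl | h'
    · rw [cross_iff_of_lt h' h]; omega
    · simp [not_cross_self_left]
    · rw [cross_comm_left, cross_iff_of_lt h' h]; omega

/-- The pair cd separates a from b but not a from e, so it separates e from b. This is the rule for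
moving one end of an edge to another vertex. -/
theorem Cross.of_not_cross {a b c d e : ℤ} (h : Cross a b c d) (h' : ¬ Cross a e c d) (hc : e ≠ c)
    (hd : e ≠ d) : Cross e b c d := by
  obtain ⟨n1, n2, n3, n4⟩ := h.ne
  rw [cross_iff_btw n1 n2 n3 n4] at h
  rw [cross_iff_btw n1 n2 hc hd] at h'
  rw [cross_iff_btw hc hd n3 n4]
  tauto

/-- Each of the given edges is crossed by at most one other of them. -/
def CrossUnique (E : V → V → Prop) (f : V → ℤ) : Prop :=
  ∀ ⦃a b c d c' d' : V⦄, E a b → E c d → E c' d' →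
    Cross (f a) (f b) (f c) (f d) → Cross (f a) (f b) (f c') (f d') → s(c, d) = s(c', d')

theorem IsLinearDrawing.crossUnique {G : SimpleGraph V} {f : V → ℤ} (h : G.IsLinearDrawing f) :
    CrossUnique G.Adj f := fun _ _ _ _ _ _ h1 h2 h3 => h.cross_unique h1 h2 h3

/-- Transfer of `CrossUnique` along an injective, crossing-preserving map of edges. -/
theorem CrossUnique.transfer {W : Type*} {E : V → V → Prop} {F : W → W → Prop} {f : V → ℤ}
    {g : W → ℤ} (h : CrossUnique E f) (φ : W → W → V × V)
    (hE : ∀ a b, F a b → E (φ a b).1 (φ a b).2)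
    (hc : ∀ a b c d, F a b → F c d → Cross (g a) (g b) (g c) (g d) →
      Cross (f (φ a b).1) (f (φ a b).2) (f (φ c d).1) (f (φ c d).2))
    (hi : ∀ a b c d, F a b → F c d → s((φ a b).1, (φ a b).2) = s((φ c d).1, (φ c d).2) →
      s(a, b) = s(c, d)) : CrossUnique F g := by
  intro a b c d c' d' h1 h2 h3 h4 h5
  exact hi _ _ _ _ h2 h3 (h (hE _ _ h1) (hE _ _ h2) (hE _ _ h3) (hc _ _ _ _ h1 h2 h4)
    (hc _ _ _ _ h1 h3 h5))

/-! ### Identifying two vertices that no edge separates. -/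

section Contract
variable {G : SimpleGraph V} {f : V → ℤ}

open Classical in
/-- If a set `D ∪ {p, q}` of vertices is attached to the rest by two edges `px`, `qy` only and no
edge of the rest separates `p` from `q`, then it may be replaced by the single vertex `p`. -/
theorem IsLinearDrawing.deleteIdentify (hf : G.IsLinearDrawing f) {D : Set V} {p q x y : V}
    (hpD : p ∉ D) (hpq : p ≠ q) (hxy : x ≠ y) (hqy : G.Adj q y)
    (hyp : y ≠ p)
    (hb : ∀ s r, s = p ∨ s = q → r ∉ D → r ≠ p → r ≠ q → G.Adj s r →
      (s = p ∧ r = x) ∨ (s = q ∧ r = y))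
    (hsep : ∀ c d, G.Adj c d → c ∉ D → c ≠ p → c ≠ q → d ∉ D → d ≠ p → d ≠ q →
      ¬ Cross (f p) (f q) (f c) (f d)) :
    (G.deleteIdentify D p q).IsLinearDrawing (fun z => f z) := by
  have hyx := hxy.symm
  have hpy := hyp.symm
  suffices H : CrossUnique (G.deleteIdentify D p q).Adj (fun z => f z) from
    ⟨fun a b e => Subtype.ext (hf.injective e), fun h1 h2 h3 => H h1 h2 h3⟩
  have adj : ∀ a b : {z : V // z ∉ D ∧ z ≠ q}, (G.deleteIdentify D p q).Adj a b →
      ((a : V) ≠ p ∧ (b : V) ≠ p ∧ G.Adj a b) ∨ ((a : V) = p ∧ (b : V) = x ∧ G.Adj p x) ∨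
      ((a : V) = p ∧ (b : V) = y) ∨ ((b : V) = p ∧ (a : V) = x ∧ G.Adj x p) ∨
      ((b : V) = p ∧ (a : V) = y) := by
    rintro ⟨a, ha, haq⟩ ⟨b, hb', hbq⟩ ⟨hne, h⟩
    have hne : a ≠ b := fun e => hne (Subtype.ext e)
    simp only at h ⊢
    by_cases hap : a = p
    · subst hap
      rcases h with h | ⟨-, h⟩ | ⟨h, -⟩
      · rcases hb a b (Or.inl rfl) hb' hne.symm hbq h with ⟨-, rfl⟩ | ⟨h1, -⟩
        · exact Or.inr (Or.inl ⟨rfl, rfl, h⟩)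
        · exact absurd h1 hpq
      · rcases hb q b (Or.inr rfl) hb' hne.symm hbq h with ⟨h1, -⟩ | ⟨-, rfl⟩
        · exact absurd h1.symm hpq
        · exact Or.inr (Or.inr (Or.inl ⟨rfl, rfl⟩))
      · exact absurd h.symm hne
    · by_cases hbp : b = p
      · subst hbp
        rcases h with h | ⟨h, -⟩ | ⟨-, h⟩
        · rcases hb b a (Or.inl rfl) ha hne haq h.symm with ⟨-, rfl⟩ | ⟨h1, -⟩
          · exact Or.inr (Or.inr (Or.inr (Or.inl ⟨rfl, rfl, h⟩)))
          · exact absurd h1 hpq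
        · exact absurd h hne
        · rcases hb q a (Or.inr rfl) ha hne haq h.symm with ⟨h1, -⟩ | ⟨-, rfl⟩
          · exact absurd h1.symm hpq
          · exact Or.inr (Or.inr (Or.inr (Or.inr ⟨rfl, rfl⟩)))
      · rcases h with h | ⟨h, -⟩ | ⟨h, -⟩
        · exact Or.inl ⟨hap, hbp, h⟩
        · exact absurd h hap
        · exact absurd h hbp
  -- An edge of the rest that crosses pz also crosses qz, because it does not separate p from q.
  have key : ∀ c d : {z : V // z ∉ D ∧ z ≠ q}, G.Adj c d → (c : V) ≠ p → (d : V) ≠ p → ∀ z,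
      (Cross (f p) (f z) (f c) (f d) → Cross (f q) (f z) (f c) (f d)) := by
    intro c d h hc hd z hz
    exact hz.of_not_cross (hsep c d h c.2.1 hc c.2.2 d.2.1 hd d.2.2)
      (fun e => c.2.2 (hf.injective e.symm)) (fun e => d.2.2 (hf.injective e.symm))
  -- Every edge of the new graph stands for an edge of G at the same place, except that the new edge
  -- py stands for the old edge qy.
  refine hf.crossUnique.transfer (fun a b => (if (a : V) = p ∧ (b : V) = y then q else a,
    if (b : V) = p ∧ (a : V) = y then q else b)) ?_ ?_ ?_
  · intro a b h
    rcases adj a b h with ⟨h1, h2, h3⟩ | ⟨h1, h2, h3⟩ | ⟨h1, h2⟩ | ⟨h1, h2, h3⟩ | ⟨h1, h2⟩ <;>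
      simp_all [G.adj_comm]
  · intro a b c d h h' hx
    obtain ⟨n1, n2, n3, n4⟩ := hx.ne
    have n1 : (a : V) ≠ c := fun e => n1 (by rw [e])
    have n2 : (a : V) ≠ d := fun e => n2 (by rw [e])
    have n3 : (b : V) ≠ c := fun e => n3 (by rw [e])
    have n4 : (b : V) ≠ d := fun e => n4 (by rw [e])
    rcases adj a b h with ⟨h1, h2, h3⟩ | ⟨h1, h2, h3⟩ | ⟨h1, h2⟩ | ⟨h1, h2, h3⟩ | ⟨h1, h2⟩
    · rcases adj c d h' with ⟨k1, k2, k3⟩ | ⟨k1, k2, k3⟩ | ⟨k1, k2⟩ | ⟨k1, k2, k3⟩ | ⟨k1, k2⟩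
      · simpa [h1, h2, k1, k2] using hx
      · simpa [h1, h2, k1, k2, hxy, hyx, hyp, hpy] using hx
      · rw [k1] at hx
        simpa [h1, h2, k1, k2, hyp] using (key a b h3 h1 h2 d hx.symm).symm
      · simpa [h1, h2, k1, k2, hxy, hyx, hyp, hpy] using hx
      · rw [k1] at hx
        simpa [h1, h2, k1, k2, hyp] using (key a b h3 h1 h2 c hx.symm.swap_left).symm.swap_right
    · have k1 : (c : V) ≠ p := by rw [← h1]; exact n1.symm
      have k2 : (d : V) ≠ p := by rw [← h1]; exact n2.symm
      simpa [h1, h2, k1, k2, hxy, hyx, hyp, hpy] using hx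
    · have k1 : (c : V) ≠ p := by rw [← h1]; exact n1.symm
      have k2 : (d : V) ≠ p := by rw [← h1]; exact n2.symm
      have k3 : G.Adj c d := by
        rcases adj c d h' with ⟨-, -, k3⟩ | ⟨k, -⟩ | ⟨k, -⟩ | ⟨k, -⟩ | ⟨k, -⟩
        · exact k3
        all_goals contradiction
      rw [h1] at hx
      simpa [h1, h2, k1, k2, hyp] using key c d k3 k1 k2 b hx
    · have k1 : (c : V) ≠ p := by rw [← h1]; exact n3.symm
      have k2 : (d : V) ≠ p := by rw [← h1]; exact n4.symm
      simpa [h1, h2, k1, k2, hxy, hyx, hyp, hpy] using hx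
    · have k1 : (c : V) ≠ p := by rw [← h1]; exact n3.symm
      have k2 : (d : V) ≠ p := by rw [← h1]; exact n4.symm
      have k3 : G.Adj c d := by
        rcases adj c d h' with ⟨-, -, k3⟩ | ⟨k, -⟩ | ⟨k, -⟩ | ⟨k, -⟩ | ⟨k, -⟩
        · exact k3
        all_goals contradiction
      rw [h1] at hx
      simpa [h1, h2, k1, k2, hyp] using (key c d k3 k1 k2 a hx.swap_left).swap_left
  · intro a b c d h h' he
    -- Sending q back to p recovers the new edge from the old one, so distinct edges stand for
    -- distinct edges.
    have hψ : ∀ (a : {z : V // z ∉ D ∧ z ≠ q}) (P : Prop),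
        (if (if (a : V) = p ∧ P then q else (a : V)) = q then p else
          (if (a : V) = p ∧ P then q else (a : V))) = (a : V) := by
      intro a P
      by_cases hP : (a : V) = p ∧ P
      · simp [hP]
      · simp [hP, a.2.2]
    have e := congrArg (Sym2.map fun z => if z = q then p else z) he
    simp only [Sym2.map_mk] at e
    rw [hψ, hψ, hψ, hψ] at e
    simpa only [Sym2.eq_iff, Subtype.ext_iff] using e
end Contract
end SimpleGraph

/-! ### Degrees, and the reductions of `G₂`, `G₄` and `G₈`. -/

namespace SimpleGraph
variable {V : Type u} {G : SimpleGraph V} {f : V → ℤ}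

section Degree
variable [G.LocallyFinite]

theorem eq_or_eq_of_degree_eq_two {v a b z : V} (h : G.degree v = 2) (ha : G.Adj v a)
    (hb : G.Adj v b) (hab : a ≠ b) (hz : G.Adj v z) : z = a ∨ z = b := by
  classical
  have hs : ({a, b} : Finset V) ⊆ G.neighborFinset v := by
    intro w hw
    simp only [Finset.mem_insert, Finset.mem_singleton] at hw
    rw [mem_neighborFinset]
    rcases hw with rfl | rfl <;> assumption
  have := Finset.eq_of_subset_of_card_le hs (by
    rw [card_neighborFinset_eq_degree, h, Finset.card_pair hab])
  have hz' : z ∈ G.neighborFinset v := by rwa [mem_neighborFinset]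
  rw [← this] at hz'
  simpa using hz'

theorem eq_or_eq_or_eq_of_degree_le_three {v a b c z : V} (h : G.degree v ≤ 3) (ha : G.Adj v a)
    (hb : G.Adj v b) (hc : G.Adj v c) (hab : a ≠ b) (hac : a ≠ c) (hbc : b ≠ c)
    (hz : G.Adj v z) : z = a ∨ z = b ∨ z = c := by
  classical
  have hs : ({a, b, c} : Finset V) ⊆ G.neighborFinset v := by
    intro w hw
    simp only [Finset.mem_insert, Finset.mem_singleton] at hw
    rw [mem_neighborFinset]
    rcases hw with rfl | rfl | rfl <;> assumption
  have := Finset.eq_of_subset_of_card_le hs (by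
    rw [card_neighborFinset_eq_degree]
    refine h.trans (le_of_eq ?_)
    rw [Finset.card_insert_of_notMem (by simp [hab, hac]), Finset.card_pair hbc])
  have hz' : z ∈ G.neighborFinset v := by rwa [mem_neighborFinset]
  rw [← this] at hz'
  simpa using hz'

theorem degree_eq_two {v a b : V} (ha : G.Adj v a) (hb : G.Adj v b) (hab : a ≠ b)
    (h : ∀ z, G.Adj v z → z = a ∨ z = b) : G.degree v = 2 := by
  classical
  rw [← card_neighborFinset_eq_degree, ← Finset.card_pair hab]
  congr 1
  ext z
  simp only [mem_neighborFinset, Finset.mem_insert, Finset.mem_singleton]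
  exact ⟨h z, by rintro (rfl | rfl) <;> assumption⟩

theorem degree_eq_three {v a b c : V} (hd : G.degree v ≤ 3) (ha : G.Adj v a) (hb : G.Adj v b)
    (hc : G.Adj v c) (hab : a ≠ b) (hac : a ≠ c) (hbc : b ≠ c) : G.degree v = 3 := by
  classical
  refine le_antisymm hd ?_
  have hs : ({a, b, c} : Finset V) ⊆ G.neighborFinset v := by
    intro w hw
    simp only [Finset.mem_insert, Finset.mem_singleton] at hw
    rw [mem_neighborFinset]
    rcases hw with rfl | rfl | rfl <;> assumption
  rw [← card_neighborFinset_eq_degree]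
  refine le_trans (le_of_eq ?_) (Finset.card_le_card hs)
  rw [Finset.card_insert_of_notMem (by simp [hab, hac]), Finset.card_pair hbc]

end Degree

section Reduce

theorem IsLinearDrawing.cross_iff (hf : G.IsLinearDrawing f) {s t c d : V} (h1 : s ≠ c)
    (h2 : s ≠ d) (h3 : t ≠ c) (h4 : t ≠ d) :
    Cross (f s) (f t) (f c) (f d) ↔ ¬ (Btw (f c) (f d) (f s) ↔ Btw (f c) (f d) (f t)) :=
  cross_iff_btw (hf.injective.ne h1) (hf.injective.ne h2) (hf.injective.ne h3)
    (hf.injective.ne h4)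

/-- An edge separates the ends of at most one of two edges that are disjoint from it. -/
theorem IsLinearDrawing.btw_iff_or (hf : G.IsLinearDrawing f) {c d : V} (hcd : G.Adj c d)
    {s t s' t' : V} (h : G.Adj s t) (h' : G.Adj s' t') (hs : s ≠ c ∧ s ≠ d) (ht : t ≠ c ∧ t ≠ d)
    (hs' : s' ≠ c ∧ s' ≠ d) (ht' : t' ≠ c ∧ t' ≠ d) (hne : s ≠ s' ∧ s ≠ t' ∨ t ≠ s' ∧ t ≠ t') :
    (Btw (f c) (f d) (f s) ↔ Btw (f c) (f d) (f t)) ∨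
    (Btw (f c) (f d) (f s') ↔ Btw (f c) (f d) (f t')) := by
  by_contra hcon
  rw [not_or] at hcon
  have h1 := (hf.cross_iff hs.1 hs.2 ht.1 ht.2).mpr hcon.1
  have h2 := (hf.cross_iff hs'.1 hs'.2 ht'.1 ht'.2).mpr hcon.2
  have := hf.cross_unique hcd h h' h1.symm h2.symm
  rw [Sym2.eq_iff] at this
  tauto

variable [G.LocallyFinite]

/-- The edge vw and the path vuw are edge-disjoint. An edge disjoint from the triangle that
separated v from w would cross vw and also an edge of the path. -/
theorem IsG2.isOuterOnePlanar {u v w x y : V} (h : G.IsG2 u v w x y) (hf : G.IsLinearDrawing f)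
    (hxy : x ≠ y) : (G.deleteIdentify {u} v w).IsOuterOnePlanar := by
  obtain ⟨hs, hh, hu, ⟨hv, hw⟩, uv, uw, vw, vx, wy⟩ := h
  simp only [List.nodup_cons, List.mem_cons, List.not_mem_nil, or_false, not_or] at hs hh
  obtain ⟨⟨n1, n2⟩, n3, -⟩ := hs
  obtain ⟨⟨x1, x2, x3⟩, y1, y2, y3⟩ := hh
  refine (hf.deleteIdentify (D := {u}) (p := v) (x := x) (y := y) (Ne.symm n1) n3 hxy wy y2 ?_ ?_).isOuterOnePlanar
  · rintro s r hs hr1 hr2 hr3 hsr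
    simp only [Set.mem_singleton_iff] at hr1
    rcases hs with rfl | rfl
    · rcases eq_or_eq_or_eq_of_degree_le_three hv.le uv.symm vw vx n2 (Ne.symm x1) (Ne.symm x3) hsr
        with rfl | rfl | rfl <;> simp_all
    · rcases eq_or_eq_or_eq_of_degree_le_three hw.le uw.symm vw.symm wy n1 (Ne.symm y1)
        (Ne.symm y2) hsr with rfl | rfl | rfl <;> simp_all
  · intro c d hcd c1 c2 c3 d1 d2 d3
    simp only [Set.mem_singleton_iff] at c1 d1
    have hU : u ≠ c ∧ u ≠ d := ⟨Ne.symm c1, Ne.symm d1⟩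
    have hV : v ≠ c ∧ v ≠ d := ⟨Ne.symm c2, Ne.symm d2⟩
    have hW : w ≠ c ∧ w ≠ d := ⟨Ne.symm c3, Ne.symm d3⟩
    have k1 := hf.btw_iff_or hcd vw uv hV hW hU hV (Or.inr ⟨Ne.symm n2, Ne.symm n3⟩)
    have k2 := hf.btw_iff_or hcd vw uw hV hW hU hW (Or.inl ⟨Ne.symm n1, n3⟩)
    rw [hf.cross_iff hV.1 hV.2 hW.1 hW.2]
    clear * - k1 k2
    grind

theorem IsG4.isOuterOnePlanar {u₀ u₁ v₀ v₁ w x y : V} (h : G.IsG4 u₀ u₁ v₀ v₁ w x y)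
    (hf : G.IsLinearDrawing f) (hxy : x ≠ y) :
    (G.deleteIdentify {u₀, v₀, w} u₁ v₁).IsOuterOnePlanar := by
  obtain ⟨hs, hh, -, ⟨du0, du1, dv0, dv1⟩, ⟨xu1, u1u0, -, -, v0v1, v1y⟩, u1v0, u0v1⟩ := h
  simp only [List.nodup_cons, List.mem_cons, List.not_mem_nil, or_false, not_or] at hs hh
  obtain ⟨⟨n1, n2, n3, n4⟩, ⟨n5, n6, n7⟩, ⟨n8, n9⟩, n10, -⟩ := hs
  obtain ⟨⟨x1, x2, x3, x4, x5⟩, y1, y2, y3, y4, y5⟩ := hh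
  refine (hf.deleteIdentify (x := x) (y := y) (by simp; tauto) n6 hxy v1y y2 ?_ ?_).isOuterOnePlanar
  · rintro s r hs hr1 hr2 hr3 hsr
    simp only [Set.mem_singleton_iff, Set.mem_insert_iff, not_or] at hr1
    rcases hs with rfl | rfl
    · rcases eq_or_eq_or_eq_of_degree_le_three du1.le u1u0 u1v0 xu1.symm n2 (Ne.symm x1)
        (Ne.symm x3) hsr with rfl | rfl | rfl <;> simp_all
    · rcases eq_or_eq_or_eq_of_degree_le_three dv1.le u0v1.symm v0v1.symm v1y n2 (Ne.symm y1)
        (Ne.symm y3) hsr with rfl | rfl | rfl <;> simp_all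
  · intro c d hcd c1 c2 c3 d1 d2 d3
    simp only [Set.mem_singleton_iff, Set.mem_insert_iff, not_or] at c1 d1
    have hU0 : u₀ ≠ c ∧ u₀ ≠ d := ⟨Ne.symm c1.1, Ne.symm d1.1⟩
    have hV0 : v₀ ≠ c ∧ v₀ ≠ d := ⟨Ne.symm c1.2.1, Ne.symm d1.2.1⟩
    have hU1 : u₁ ≠ c ∧ u₁ ≠ d := ⟨Ne.symm c2, Ne.symm d2⟩
    have hV1 : v₁ ≠ c ∧ v₁ ≠ d := ⟨Ne.symm c3, Ne.symm d3⟩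
    -- The two edge-disjoint paths are u₁u₀v₁ and u₁v₀v₁; the four facts pair each edge of one with
    -- each edge of the other.
    have k1 := hf.btw_iff_or hcd u1u0 u1v0 hU1 hU0 hU1 hV0 (Or.inr ⟨n1, n2⟩)
    have k2 := hf.btw_iff_or hcd u1u0 v0v1 hU1 hU0 hV0 hV1 (Or.inl ⟨n5, n6⟩)
    have k3 := hf.btw_iff_or hcd u0v1 u1v0 hU0 hV1 hU1 hV0 (Or.inl ⟨n1, n2⟩)
    have k4 := hf.btw_iff_or hcd u0v1 v0v1 hU0 hV1 hV0 hV1 (Or.inl ⟨n2, n3⟩)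
    rw [hf.cross_iff hU1.1 hU1.2 hV1.1 hV1.2]
    clear * - k1 k2 k3 k4
    grind

theorem IsG8.isOuterOnePlanar {u₀ u₁ u₂ v₀ v₁ x y : V} (h : G.IsG8 u₀ u₁ u₂ v₀ v₁ x y)
    (hf : G.IsLinearDrawing f) (hxy : x ≠ y) :
    (G.deleteIdentify {u₀, u₁, v₀} u₂ v₁).IsOuterOnePlanar := by
  obtain ⟨hs, hh, -, ⟨du0, du2, dv0, dv1⟩, ⟨xu2, u2u1, u1u0, u0v0, v0v1, v1y⟩, u2v0, u0v1⟩ := h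
  simp only [List.nodup_cons, List.mem_cons, List.not_mem_nil, or_false, not_or] at hs hh
  obtain ⟨⟨n1, n2, n3, n4⟩, ⟨n5, n6, n7⟩, ⟨n8, n9⟩, n10, -⟩ := hs
  obtain ⟨⟨x1, x2, x3, x4, x5⟩, y1, y2, y3, y4, y5⟩ := hh
  refine (hf.deleteIdentify (x := x) (y := y) (by simp; tauto) n9 hxy v1y y3 ?_ ?_).isOuterOnePlanar
  · rintro s r hs hr1 hr2 hr3 hsr
    simp only [Set.mem_singleton_iff, Set.mem_insert_iff, not_or] at hr1
    rcases hs with rfl | rfl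
    · rcases eq_or_eq_or_eq_of_degree_le_three du2.le u2u1 u2v0 xu2.symm n6 (Ne.symm x2)
        (Ne.symm x4) hsr with rfl | rfl | rfl <;> simp_all
    · rcases eq_or_eq_or_eq_of_degree_le_three dv1.le u0v1.symm v0v1.symm v1y n3 (Ne.symm y1)
        (Ne.symm y4) hsr with rfl | rfl | rfl <;> simp_all
  · intro c d hcd c1 c2 c3 d1 d2 d3
    simp only [Set.mem_singleton_iff, Set.mem_insert_iff, not_or] at c1 d1
    have hU0 : u₀ ≠ c ∧ u₀ ≠ d := ⟨Ne.symm c1.1, Ne.symm d1.1⟩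
    have hU1 : u₁ ≠ c ∧ u₁ ≠ d := ⟨Ne.symm c1.2.1, Ne.symm d1.2.1⟩
    have hV0 : v₀ ≠ c ∧ v₀ ≠ d := ⟨Ne.symm c1.2.2, Ne.symm d1.2.2⟩
    have hU2 : u₂ ≠ c ∧ u₂ ≠ d := ⟨Ne.symm c2, Ne.symm d2⟩
    have hV1 : v₁ ≠ c ∧ v₁ ≠ d := ⟨Ne.symm c3, Ne.symm d3⟩
    -- Here the two edge-disjoint paths are u₂u₁u₀v₁ and u₂v₀v₁.
    have k1 := hf.btw_iff_or hcd u2u1 u2v0 hU2 hU1 hU2 hV0 (Or.inr ⟨n5, n6⟩)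
    have k2 := hf.btw_iff_or hcd u2u1 v0v1 hU2 hU1 hV0 hV1 (Or.inl ⟨n8, n9⟩)
    have k3 := hf.btw_iff_or hcd u1u0 u2v0 hU1 hU0 hU2 hV0 (Or.inl ⟨n5, n6⟩)
    have k4 := hf.btw_iff_or hcd u1u0 v0v1 hU1 hU0 hV0 hV1 (Or.inl ⟨n6, n7⟩)
    have k5 := hf.btw_iff_or hcd u0v1 u2v0 hU0 hV1 hU2 hV0 (Or.inl ⟨n2, n3⟩)
    have k6 := hf.btw_iff_or hcd u0v1 v0v1 hU0 hV1 hV0 hV1 (Or.inl ⟨n3, n4⟩)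
    rw [hf.cross_iff hU2.1 hU2.2 hV1.1 hV1.2]
    clear * - k1 k2 k3 k4 k5 k6
    grind

end Reduce
end SimpleGraph

/-! ### Boundaries of vertex sets in 2-connected graphs, and pieces attached by two edges. -/

namespace SimpleGraph
variable {V : Type u} {G : SimpleGraph V} {f g : V → ℤ}

section TwoConnected
variable [Fintype V]

/-- A vertex set of a 2-connected graph keeps a neighbour outside when one vertex is deleted. -/
theorem IsTwoConnected.exists_adj_ne (h : G.IsTwoConnected) {A : Set V} {a c d : V} (ha : a ∈ A)
    (hc : c ∉ A) (hd : d ∉ A) (hdc : d ≠ c) : ∃ s ∈ A, ∃ r, r ∉ A ∧ r ≠ c ∧ G.Adj s r := by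
  have hac : a ≠ c := fun e => hc (e ▸ ha)
  obtain ⟨p⟩ := (h.connected_delete c).preconnected ⟨a, hac⟩ ⟨d, hdc⟩
  obtain ⟨e, -, h1, h2⟩ := p.exists_boundary_dart {z | (z : V) ∈ A} ha hd
  exact ⟨e.fst, h1, e.snd, h2, e.snd.2, e.adj⟩

theorem IsTwoConnected.exists_ne_ne (h : G.IsTwoConnected) (a b : V) : ∃ d, d ≠ a ∧ d ≠ b := by
  classical
  by_contra! hcon
  have : (Finset.univ : Finset V) ⊆ {a, b} := by
    intro d _
    by_cases hd : d = a
    · simp [hd]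
    · simp [hcon d hd]
  have := (Finset.card_le_card this).trans Finset.card_le_two
  rw [Finset.card_univ] at this
  have := h.three_le_card
  omega

theorem IsTwoConnected.exists_neighbor_ne (h : G.IsTwoConnected) (v c : V) :
    ∃ r, r ≠ c ∧ G.Adj v r := by
  by_cases hvc : v = c
  · subst hvc
    obtain ⟨c', h1, -⟩ := h.exists_ne_ne v v
    obtain ⟨d, h2, h3⟩ := h.exists_ne_ne v c'
    obtain ⟨s, hs, r, hr, -, hsr⟩ := h.exists_adj_ne (A := {v}) rfl (c := c') h1 (d := d) h2 h3
    rw [Set.mem_singleton_iff] at hs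
    subst hs
    exact ⟨r, hr, hsr⟩
  · obtain ⟨d, h2, h3⟩ := h.exists_ne_ne v c
    obtain ⟨s, hs, r, -, hr, hsr⟩ := h.exists_adj_ne (A := {v}) rfl (c := c) (Ne.symm hvc)
      (d := d) h2 h3
    rw [Set.mem_singleton_iff] at hs
    subst hs
    exact ⟨r, hr, hsr⟩

/-- No vertex set of a 2-connected graph has just one edge in its boundary. -/
theorem IsTwoConnected.exists_boundary_ne (h : G.IsTwoConnected) {A : Set V} {s r : V}
    (hs : s ∈ A) (hr : r ∉ A) :
    ∃ s' ∈ A, ∃ r', r' ∉ A ∧ G.Adj s' r' ∧ ¬ (s' = s ∧ r' = r) := by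
  by_cases hd : ∃ d, d ∉ A ∧ d ≠ r
  · obtain ⟨d, hd, hdr⟩ := hd
    obtain ⟨s', hs', r', hr', hne, hadj⟩ := h.exists_adj_ne hs hr hd hdr
    exact ⟨s', hs', r', hr', hadj, fun e => hne e.2⟩
  -- If r is the only vertex outside A, deleting it shows nothing; instead s is deleted and the
  -- complement of A is considered.
  · push Not at hd
    obtain ⟨a, has, har⟩ := h.exists_ne_ne s r
    have ha : a ∈ A := by by_contra ha; exact har (hd a ha)
    obtain ⟨r', hr', s', hs', hne, hadj⟩ := h.exists_adj_ne (A := Aᶜ) hr (c := s) (d := a)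
      (by simpa using hs) (by simpa using ha) has
    exact ⟨s', by simpa using hs', r', hr', hadj.symm, fun e => hne e.1⟩

end TwoConnected

theorem not_cross_of_interval {a b c d : ℤ} (lo hi : ℤ) (hc : lo ≤ c ∧ c ≤ hi)
    (hd : lo ≤ d ∧ d ≤ hi) (ha : a ≤ lo ∨ hi ≤ a) (hb : b ≤ lo ∨ hi ≤ b) : ¬ Cross a b c d := by
  rintro (h | h | h | h | h | h | h | h) <;> omega

theorem Cross.of_monoOn {S : Set V} (h : ∀ a ∈ S, ∀ b ∈ S, g a < g b → f a < f b) {a b c d : V}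
    (ha : a ∈ S) (hb : b ∈ S) (hc : c ∈ S) (hd : d ∈ S) (hx : Cross (g a) (g b) (g c) (g d)) :
    Cross (f a) (f b) (f c) (f d) := by
  rcases hx with ⟨h1, h2, h3⟩ | ⟨h1, h2, h3⟩ | ⟨h1, h2, h3⟩ | ⟨h1, h2, h3⟩ | ⟨h1, h2, h3⟩ |
    ⟨h1, h2, h3⟩ | ⟨h1, h2, h3⟩ | ⟨h1, h2, h3⟩ <;>
  simp only [Cross, h _ (by assumption) _ (by assumption) h1,
    h _ (by assumption) _ (by assumption) h2, h _ (by assumption) _ (by assumption) h3,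
    true_and, true_or, or_true]

theorem Cross.neg {a b c d : ℤ} (hx : Cross (-a) (-b) (-c) (-d)) : Cross a b c d := by
  rcases hx with h | h | h | h | h | h | h | h <;> simp only [neg_lt_neg_iff] at h <;>
    simp [Cross, h]

theorem Cross.of_antiOn {S : Set V} (h : ∀ a ∈ S, ∀ b ∈ S, g a < g b → f b < f a) {a b c d : V}
    (ha : a ∈ S) (hb : b ∈ S) (hc : c ∈ S) (hd : d ∈ S) (hx : Cross (g a) (g b) (g c) (g d)) :
    Cross (f a) (f b) (f c) (f d) := by
  have := Cross.of_monoOn (f := fun v => - f v) (g := g) (S := S)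
    (fun a ha b hb hab => by simpa using h a ha b hb hab) ha hb hc hd hx
  exact Cross.neg this

section Piece

/-- The edges of `G` that meet `W`. -/
def Touches (G : SimpleGraph V) (W : Finset V) (a b : V) : Prop := G.Adj a b ∧ (a ∈ W ∨ b ∈ W)

theorem Touches.symm {W : Finset V} {a b : V} (h : G.Touches W a b) : G.Touches W b a :=
  ⟨h.1.symm, h.2.symm⟩

/-- A vertex set `W` attached to the rest of `G` by the two edges `lx` and `yr` only. -/
structure IsPiece (G : SimpleGraph V) (W : Finset V) (l x y r : V) : Prop where
  l_notMem : l ∉ W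
  r_notMem : r ∉ W
  l_ne_r : l ≠ r
  x_mem : x ∈ W
  y_mem : y ∈ W
  adj_l : G.Adj l x
  adj_r : G.Adj y r
  boundary : ∀ a ∈ W, ∀ b, b ∉ W → G.Adj a b → (a = x ∧ b = l) ∨ (a = y ∧ b = r)

/-- A linear arrangement of a piece between its outer neighbours `l` and `r` in which each edge
meeting the piece is crossed by at most one other edge. -/
structure IsPieceDrawing (G : SimpleGraph V) (W : Finset V) (l r : V) (f : V → ℤ) : Prop where
  injOn : ∀ a ∈ W, ∀ b ∈ W, f a = f b → a = b
  left : ∀ w ∈ W, f l < f w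
  right : ∀ w ∈ W, f w < f r
  left_lt_right : f l < f r
  crossUnique : CrossUnique (G.Touches W) f

variable {W : Finset V} {l x y r p q : V}

theorem IsPiece.touches_cases (h : G.IsPiece W l x y r) {a b : V} (hab : G.Touches W a b) :
    (a ∈ W ∧ b ∈ W) ∨ s(a, b) = s(l, x) ∨ s(a, b) = s(y, r) := by
  obtain ⟨hab, hw⟩ := hab
  simp only [Sym2.eq_iff]
  by_cases ha : a ∈ W
  · by_cases hb : b ∈ W
    · exact Or.inl ⟨ha, hb⟩
    · rcases h.boundary a ha b hb hab with h | h <;> tauto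
  · have hb := hw.resolve_left ha
    rcases h.boundary b hb a ha hab.symm with h | h <;> tauto

/-- The possible positions of an edge if the edge `pq` of the piece crosses `lx`. -/
inductive EdgeKind (W : Finset V) (f : V → ℤ) (l x r p q a b : V) : Prop
  | outer (h : s(a, b) = s(l, x))
  | crossing (h : s(a, b) = s(p, q))
  | before (ha : a ∈ W) (hb : b ∈ W) (ha' : f a ≤ f x) (hb' : f b ≤ f x)
  | middle (ha : a ∈ W) (hb : b ∈ W) (ha' : f x ≤ f a ∧ f a ≤ f q) (hb' : f x ≤ f b ∧ f b ≤ f q)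
  | after (ha : a ∈ W ∨ a = r) (hb : b ∈ W ∨ b = r) (ha' : f q ≤ f a) (hb' : f q ≤ f b)

theorem EdgeKind.symm {a b : V} (h : EdgeKind W f l x r p q a b) :
    EdgeKind W f l x r p q b a := by
  cases h with
  | outer h => exact .outer (Sym2.eq_swap.trans h)
  | crossing h => exact .crossing (Sym2.eq_swap.trans h)
  | before ha hb ha' hb' => exact .before hb ha hb' ha'
  | middle ha hb ha' hb' => exact .middle hb ha hb' ha'
  | after ha hb ha' hb' => exact .after hb ha hb' ha'

theorem cross_of_lt {a b c d : ℤ} (h1 : a < c) (h2 : c < b) (h3 : b < d) : Cross a b c d :=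
  Or.inl ⟨h1, h2, h3⟩

theorem sym2_ne_of_mem {W : Finset V} {a b c d : V} (ha : a ∈ W) (hb : b ∈ W)
    (hcd : c ∉ W ∨ d ∉ W) : s(a, b) ≠ s(c, d) := by
  rw [ne_eq, Sym2.eq_iff]
  rintro (⟨rfl, rfl⟩ | ⟨rfl, rfl⟩) <;> tauto

/-- The edges lx and pq use up each other's only crossing. Hence no further edge passes over x (it
would cross lx) or leads from the part between x and q to beyond q (it would cross pq). -/
theorem IsPieceDrawing.edgeKind (hf : G.IsPieceDrawing W l r f) (h : G.IsPiece W l x y r)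
    (hp : p ∈ W) (hq : q ∈ W) (hpq : G.Adj p q) (hpx : f p < f x) (hxq : f x < f q) :
    f q ≤ f y ∧ ∀ a b, G.Touches W a b → EdgeKind W f l x r p q a b := by
  have Tpq : G.Touches W p q := ⟨hpq, Or.inl hp⟩
  have Tlx : G.Touches W l x := ⟨h.adj_l, Or.inr h.x_mem⟩
  have Tyr : G.Touches W y r := ⟨h.adj_r, Or.inl h.y_mem⟩
  have lp := hf.left p hp
  have qr := hf.right q hq
  have hX : Cross (f l) (f x) (f p) (f q) := cross_of_lt lp hpx hxq
  -- If y came before q, the edge yr would be a second crossing of lx (for y before x) or of pq (for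
  -- y between x and q).
  have hqy : f q ≤ f y := by
    by_contra hcon
    rcases lt_or_ge (f y) (f x) with hy | hy
    · exact sym2_ne_of_mem hp hq (Or.inr h.r_notMem) (hf.crossUnique Tlx Tpq Tyr hX
        (cross_of_lt (hf.left y h.y_mem) hy (hf.right x h.x_mem)))
    · have := hf.crossUnique Tpq Tlx Tyr hX.symm (cross_of_lt (by omega) (by omega) qr)
      rw [Sym2.eq_iff] at this
      rcases this with ⟨rfl, -⟩ | ⟨e, -⟩
      · exact h.l_notMem h.y_mem
      · exact h.l_ne_r e
  have key : ∀ a b, G.Touches W a b → f a < f b → a ∈ W → b ∈ W →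
      EdgeKind W f l x r p q a b := by
    intro a b hab hlt ha hb
    rcases le_or_gt (f b) (f x) with hbx | hbx
    · exact .before ha hb (by omega) hbx
    rcases lt_or_ge (f a) (f x) with hax | hax
    · exact .crossing (hf.crossUnique Tlx hab Tpq (cross_of_lt (hf.left a ha) hax hbx) hX)
    rcases le_or_gt (f b) (f q) with hbq | hbq
    · exact .middle ha hb ⟨hax, by omega⟩ ⟨by omega, hbq⟩
    rcases lt_or_ge (f a) (f q) with haq | haq
    · exact absurd (hf.crossUnique Tpq hab Tlx (cross_of_lt (by omega) haq hbq) hX.symm)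
        (sym2_ne_of_mem ha hb (Or.inl h.l_notMem))
    · exact .after (Or.inl ha) (Or.inl hb) haq (by omega)
  refine ⟨hqy, fun a b hab => ?_⟩
  rcases h.touches_cases hab with ⟨ha, hb⟩ | hab' | hab'
  · rcases lt_trichotomy (f a) (f b) with hlt | heq | hlt
    · exact key a b hab hlt ha hb
    · exact absurd (hf.injOn a ha b hb heq) hab.1.ne
    · exact (key b a hab.symm hlt hb ha).symm
  · exact .outer hab'
  · rw [Sym2.eq_iff] at hab'
    rcases hab' with ⟨rfl, rfl⟩ | ⟨rfl, rfl⟩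
    · exact .after (Or.inl h.y_mem) (Or.inr rfl) hqy (by omega)
    · exact .after (Or.inr rfl) (Or.inl h.y_mem) (by omega) hqy

end Piece
end SimpleGraph

/-! ### Uncrossing by reversal of two blocks. -/

namespace SimpleGraph
variable {V : Type u} {G : SimpleGraph V} {f g : V → ℤ}
variable {W : Finset V} {l x y r p q : V}

theorem exists_abs_le (W : Finset V) (f : V → ℤ) : ∃ K : ℤ, 0 ≤ K ∧ ∀ w ∈ W, -K ≤ f w ∧ f w ≤ K := by
  obtain ⟨M, hM⟩ := (W.image fun w => |f w|).exists_le
  refine ⟨max M 0, le_max_right _ _, fun w hw => ?_⟩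
  have := hM _ (Finset.mem_image_of_mem _ hw)
  have := abs_le.mp (this.trans (le_max_left M 0))
  exact this

/-- The pairs of edges that cross after the rearrangement of `IsPieceDrawing.reorder` although they
did not cross before. -/
def NewCrossing (G : SimpleGraph V) (W : Finset V) (f : V → ℤ) (x r q n t : V) : Prop :=
  n ∈ W ∧ f x < f n ∧ f n < f q ∧ G.Adj x n ∧ (t ∈ W ∨ t = r) ∧ f q < f t ∧ G.Adj q t

open Classical in
/-- If `pq` crosses `lx`, reversing the part up to `x` and the part from `x` to `q` uncrosses
`lx`. -/
theorem IsPieceDrawing.reorder (hf : G.IsPieceDrawing W l r f) (h : G.IsPiece W l x y r)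
    (hp : p ∈ W) (hq : q ∈ W) (hpq : G.Adj p q) (hpx : f p < f x) (hxq : f x < f q)
    (hU : ∀ n t, NewCrossing G W f x r q n t →
      (∀ a b, G.Touches W a b → ¬ Cross (f x) (f n) (f a) (f b)) ∧
      (∀ a b, G.Touches W a b → ¬ Cross (f q) (f t) (f a) (f b)) ∧
      ∀ n' t', NewCrossing G W f x r q n' t' → n' = n ∧ t' = t) :
    ∃ g, G.IsPieceDrawing W l r g ∧
      ∀ a b, G.Touches W a b → ¬ Cross (g l) (g x) (g a) (g b) := by
  obtain ⟨hqy, kind⟩ := hf.edgeKind h hp hq hpq hpx hxq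
  obtain ⟨K, hK, hKW⟩ := exists_abs_le W f
  have hx := h.x_mem
  -- The new order is l, then the reversed first block headed by x, then the reversed middle block
  -- headed by q, then the last block unchanged, then r. As |f| ≤ K on W, shifts by 2K+1 keep the
  -- blocks apart.
  obtain ⟨g, hgl, hgr, hgW⟩ : ∃ g : V → ℤ, g l = -3 * K - 2 ∧ g r = 3 * K + 2 ∧ ∀ w ∈ W,
      (f w ≤ f x ∧ g w = -f w - 2 * K - 1) ∨ (f x < f w ∧ f w ≤ f q ∧ g w = - f w) ∨
      (f q < f w ∧ g w = f w + 2 * K + 1) := by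
    refine ⟨fun v => if v = l then -3 * K - 2 else if v = r then 3 * K + 2 else
      if f v ≤ f x then -f v - 2 * K - 1 else if f v ≤ f q then - f v else f v + 2 * K + 1,
      by simp, by simp [h.l_ne_r.symm], fun w hw => ?_⟩
    have h1 : w ≠ l := fun e => h.l_notMem (e ▸ hw)
    have h2 : w ≠ r := fun e => h.r_notMem (e ▸ hw)
    simp only [h1, h2, if_false]
    split_ifs <;> omega
  have hgx : g x = - f x - 2 * K - 1 := by rcases hgW x hx with h | h | h <;> omega
  have hgq : g q = - f q := by rcases hgW q hq with h | h | h <;> omega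
  have hgp : g p = - f p - 2 * K - 1 := by rcases hgW p hp with h | h | h <;> omega
  have hKx := hKW x hx
  have hKq := hKW q hq
  have hKp := hKW p hp
  have B : ∀ a ∈ W, f a ≤ f x → g a = - f a - 2 * K - 1 ∧ -K ≤ f a := fun a ha ha' => by
    have := hKW a ha
    rcases hgW a ha with h | h | h <;> omega
  have M : ∀ a ∈ W, f x < f a → f a ≤ f q → g a = - f a ∧ f a ≤ K ∧ -K ≤ f a := fun a ha h1 h2 => by
    have := hKW a ha
    rcases hgW a ha with h | h | h <;> omega
  have N : ∀ a, (a ∈ W ∨ a = r) → f q ≤ f a → a = q ∨ (f q < f a ∧ K + 1 ≤ g a) := by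
    rintro a (ha | rfl) ha'
    · have := hKW a ha
      rcases hgW a ha with h | h | h
      · omega
      · exact Or.inl (hf.injOn a ha q hq (by omega))
      · omega
    · have := hf.right q hq
      omega
  have MX : ∀ a ∈ W, f x ≤ f a → f a ≤ f q → a = x ∨ (f x < f a ∧ g a = - f a ∧ -K ≤ f a ∧ f a ≤ K) :=
    fun a ha h1 h2 => by
      rcases h1.eq_or_lt with h1 | h1
      · exact Or.inl (hf.injOn a ha x hx h1.symm)
      · have := M a ha h1 h2
        exact Or.inr ⟨h1, this.1, this.2.2, this.2.1⟩
  -- Now x is the first vertex after l, so nothing can interleave with lx.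
  have lxFree : ∀ a b, G.Touches W a b → ¬ Cross (g l) (g x) (g a) (g b) := by
    have pos : ∀ a, (a ∈ W ∨ a = r) → g x ≤ g a := by
      rintro a (ha | rfl)
      · have := hKW a ha
        rcases hgW a ha with h | h | h <;> omega
      · omega
    intro a b hab hc
    refine not_cross_of_interval (g l) (g x) ⟨le_rfl, by omega⟩ ⟨by omega, le_rfl⟩ ?_ ?_ hc.symm
    all_goals
      rcases h.touches_cases hab with ⟨ha, hb⟩ | hab' | hab'
      · have := pos a (Or.inl ha)
        have := pos b (Or.inl hb)
        omega
      · rw [Sym2.eq_iff] at hab'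
        rcases hab' with ⟨rfl, rfl⟩ | ⟨rfl, rfl⟩ <;> omega
      · have := pos y (Or.inl h.y_mem)
        have := pos r (Or.inr rfl)
        rw [Sym2.eq_iff] at hab'
        rcases hab' with ⟨rfl, rfl⟩ | ⟨rfl, rfl⟩ <;> omega
  have outerKey : ∀ a b c d, G.Touches W c d → s(a, b) = s(l, x) →
      ¬ Cross (g a) (g b) (g c) (g d) := by
    intro a b c d hcd e hc
    rw [Sym2.eq_iff] at e
    rcases e with ⟨rfl, rfl⟩ | ⟨rfl, rfl⟩
    · exact lxFree _ _ hcd hc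
    · exact lxFree _ _ hcd hc.swap_left
  -- Since q heads its block, the span from p to q contains only vertices of the first block besides
  -- q, and reversal keeps alternation within that block.
  have pqKey : ∀ a b, G.Touches W a b → Cross (g p) (g q) (g a) (g b) →
      Cross (f p) (f q) (f a) (f b) := by
    intro a b hab hc
    cases kind a b hab with
    | outer e => exact absurd hc.symm (outerKey _ _ _ _ ⟨hpq, Or.inl hp⟩ e)
    | crossing e =>
      obtain ⟨n1, n2, n3, n4⟩ := hc.ne
      rw [Sym2.eq_iff] at e
      rcases e with ⟨rfl, rfl⟩ | ⟨rfl, rfl⟩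
      · exact absurd rfl n1
      · exact absurd rfl n2
    | before ha hb ha' hb' =>
      have := B a ha ha'
      have := B b hb hb'
      rcases hc with hc | hc | hc | hc | hc | hc | hc | hc <;> simp only [Cross] <;> omega
    | middle ha hb ha' hb' =>
      exfalso
      refine not_cross_of_interval (g p) (g q) ⟨le_rfl, by omega⟩ ⟨by omega, le_rfl⟩ ?_ ?_ hc.symm
      · rcases MX a ha ha'.1 ha'.2 with rfl | h1 <;> omega
      · rcases MX b hb hb'.1 hb'.2 with rfl | h1 <;> omega
    | after ha hb ha' hb' =>
      exfalso
      refine not_cross_of_interval (g p) (g q) ⟨le_rfl, by omega⟩ ⟨by omega, le_rfl⟩ ?_ ?_ hc.symm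
      · rcases N a ha ha' with rfl | h1 <;> omega
      · rcases N b hb hb' with rfl | h1 <;> omega
  have crossingKey : ∀ a b c d, G.Touches W c d → s(a, b) = s(p, q) →
      Cross (g a) (g b) (g c) (g d) → Cross (f a) (f b) (f c) (f d) := by
    intro a b c d hcd e hc
    rw [Sym2.eq_iff] at e
    rcases e with ⟨rfl, rfl⟩ | ⟨rfl, rfl⟩
    · exact pqKey _ _ hcd hc
    · exact (pqKey _ _ hcd hc.swap_left).swap_left
  have beforeKey : ∀ a b c d, G.Touches W a b → G.Touches W c d → a ∈ W → b ∈ W → f a ≤ f x →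
      f b ≤ f x → Cross (g a) (g b) (g c) (g d) → Cross (f a) (f b) (f c) (f d) := by
    intro a b c d hab hcd ha hb ha' hb' hc
    have a1 := B a ha ha'
    have b1 := B b hb hb'
    cases kind c d hcd with
    | outer e => exact absurd hc.symm (outerKey _ _ _ _ hab e)
    | crossing e => exact (crossingKey _ _ _ _ hab e hc.symm).symm
    | before hc1 hd1 hc' hd' =>
      refine hc.of_antiOn (S := {v | v ∈ W ∧ f v ≤ f x}) ?_ ⟨ha, ha'⟩ ⟨hb, hb'⟩ ⟨hc1, hc'⟩ ⟨hd1, hd'⟩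
      rintro s ⟨hs, hs'⟩ t ⟨ht, ht'⟩ hst
      have := B s hs hs'
      have := B t ht ht'
      omega
    | middle hc1 hd1 hc' hd' =>
      exfalso
      refine not_cross_of_interval (g x) (g q) ⟨by omega, by omega⟩ ⟨by omega, by omega⟩ ?_ ?_
        hc.symm
      · rcases MX c hc1 hc'.1 hc'.2 with rfl | h1 <;> omega
      · rcases MX d hd1 hd'.1 hd'.2 with rfl | h1 <;> omega
    | after hc1 hd1 hc' hd' =>
      exfalso
      refine not_cross_of_interval (g x) (g q) ⟨by omega, by omega⟩ ⟨by omega, by omega⟩ ?_ ?_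
        hc.symm
      · rcases N c hc1 hc' with rfl | h1 <;> omega
      · rcases N d hd1 hd' with rfl | h1 <;> omega
  -- The vertex x precedes the middle block in both orders. Alternation of xb with cd only asks
  -- whether b lies between c and d, which is invariant under reversal.
  have xKey : ∀ b c d, (f x < f b ∧ g b = - f b ∧ -K ≤ f b ∧ f b ≤ K) →
      (f x < f c ∧ g c = - f c ∧ -K ≤ f c ∧ f c ≤ K) →
      (f x < f d ∧ g d = - f d ∧ -K ≤ f d ∧ f d ≤ K) → Cross (g x) (g b) (g c) (g d) →
      Cross (f x) (f b) (f c) (f d) := by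
    intro b c d hb hc hd hc
    rcases hc with hc | hc | hc | hc | hc | hc | hc | hc <;> simp only [Cross] <;> omega
  have middleKey : ∀ a b c d, a ∈ W → b ∈ W → (f x ≤ f a ∧ f a ≤ f q) → (f x ≤ f b ∧ f b ≤ f q) →
      c ∈ W → d ∈ W → (f x ≤ f c ∧ f c ≤ f q) → (f x ≤ f d ∧ f d ≤ f q) →
      Cross (g a) (g b) (g c) (g d) → Cross (f a) (f b) (f c) (f d) := by
    intro a b c d ha hb ha' hb' hc hd hc' hd' hX
    obtain ⟨n1, n2, n3, n4⟩ := hX.ne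
    rcases MX a ha ha'.1 ha'.2 with rfl | ha1 <;> rcases MX b hb hb'.1 hb'.2 with rfl | hb1 <;>
    rcases MX c hc hc'.1 hc'.2 with rfl | hc1 <;> rcases MX d hd hd'.1 hd'.2 with rfl | hd1
    all_goals first
      | exact absurd rfl n1
      | exact absurd rfl n2
      | exact absurd rfl n3
      | exact absurd rfl n4
      | exact absurd hX not_cross_self_left
      | exact absurd hX not_cross_self_right
      | exact xKey _ _ _ hb1 hc1 hd1 hX
      | exact (xKey _ _ _ ha1 hc1 hd1 hX.swap_left).swap_left
      | exact (xKey _ _ _ hd1 ha1 hb1 hX.symm).symm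
      | exact (xKey _ _ _ hc1 ha1 hb1 hX.symm.swap_left).swap_left.symm
      | skip
    refine hX.of_antiOn (S := {v | g v = - f v}) ?_ ha1.2.1 hb1.2.1 hc1.2.1 hd1.2.1
    intro s hs t ht hst
    simp only [Set.mem_ofPred_eq] at hs ht
    omega
  -- An edge from x to n in the middle block passes over q, so the only edges from q onwards that it
  -- can meet are those qt leaving q: the new order is x, q, n, t.
  have xAfter : ∀ b c d, G.Adj x b → G.Adj c d → b ∈ W → (f x < f b ∧ f b ≤ f q) →
      (c ∈ W ∨ c = r) → (d ∈ W ∨ d = r) → f q ≤ f c → f q ≤ f d →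
      Cross (g x) (g b) (g c) (g d) →
      ∃ t, NewCrossing G W f x r q b t ∧ s(c, d) = s(q, t) := by
    intro b c d hxb hcd hb hb' hc hd hc' hd' hX
    obtain ⟨n1, n2, n3, n4⟩ := hX.ne
    have hbM := M b hb hb'.1 hb'.2
    have bq : b ≠ q → f b < f q := fun hne =>
      lt_of_le_of_ne hb'.2 fun e => hne (hf.injOn b hb q hq e)
    rcases N c hc hc' with rfl | hc1
    · rcases N d hd hd' with rfl | hd1
      · exact absurd hX not_cross_self_right
      · exact ⟨d, ⟨hb, hb'.1, bq (fun e => n3 (by rw [e])), hxb, hd, hd1.1, hcd⟩, rfl⟩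
    · rcases N d hd hd' with rfl | hd1
      · exact ⟨c, ⟨hb, hb'.1, bq (fun e => n4 (by rw [e])), hxb, hc, hc1.1, hcd.symm⟩, Sym2.eq_swap⟩
      · exact absurd hX.symm (not_cross_of_interval (g x) (K + 1) ⟨le_rfl, by omega⟩
          ⟨by omega, by omega⟩ (Or.inr (by omega)) (Or.inr (by omega)))
  have middleAfter : ∀ a b c d, G.Adj a b → G.Adj c d → a ∈ W → b ∈ W → (f x ≤ f a ∧ f a ≤ f q) →
      (f x ≤ f b ∧ f b ≤ f q) →
      (c ∈ W ∨ c = r) → (d ∈ W ∨ d = r) → f q ≤ f c → f q ≤ f d →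
      Cross (g a) (g b) (g c) (g d) →
      ∃ n t, NewCrossing G W f x r q n t ∧ s(a, b) = s(x, n) ∧ s(c, d) = s(q, t) := by
    intro a b c d hab hcd ha hb ha' hb' hc hd hc' hd' hX
    rcases MX a ha ha'.1 ha'.2 with rfl | ha1
    · rcases MX b hb hb'.1 hb'.2 with rfl | hb1
      · exact absurd hX not_cross_self_left
      · obtain ⟨t, h1, h2⟩ := xAfter b c d hab hcd hb ⟨hb1.1, hb'.2⟩ hc hd hc' hd' hX
        exact ⟨b, t, h1, rfl, h2⟩
    · rcases MX b hb hb'.1 hb'.2 with rfl | hb1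
      · obtain ⟨t, h1, h2⟩ := xAfter a c d hab.symm hcd ha ⟨ha1.1, ha'.2⟩ hc hd hc' hd' hX.swap_left
        exact ⟨a, t, h1, Sym2.eq_swap, h2⟩
      · exfalso
        refine not_cross_of_interval (g q) (K + 1) ⟨by omega, by omega⟩ ⟨by omega, by omega⟩ ?_ ?_
          hX.symm
        · rcases N c hc hc' with rfl | h1 <;> omega
        · rcases N d hd hd' with rfl | h1 <;> omega
  have afterKey : ∀ a b c d, (a ∈ W ∨ a = r) → (b ∈ W ∨ b = r) → (c ∈ W ∨ c = r) →
      (d ∈ W ∨ d = r) → f q ≤ f a → f q ≤ f b → f q ≤ f c → f q ≤ f d →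
      Cross (g a) (g b) (g c) (g d) → Cross (f a) (f b) (f c) (f d) := by
    intro a b c d ha hb hc hd ha' hb' hc' hd' hX
    refine hX.of_monoOn (S := {v | (v ∈ W ∨ v = r) ∧ f q ≤ f v}) ?_ ⟨ha, ha'⟩ ⟨hb, hb'⟩ ⟨hc, hc'⟩
      ⟨hd, hd'⟩
    rintro s ⟨hs, hs'⟩ t ⟨ht, ht'⟩ hst
    rcases hs with hs | rfl <;> rcases ht with ht | rfl
    · have := hKW s hs
      have := hKW t ht
      rcases hgW s hs with h1 | h1 | h1 <;> rcases hgW t ht with h2 | h2 | h2 <;> omega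
    · exact hf.right s hs
    · have := hKW t ht
      rcases hgW t ht with h2 | h2 | h2 <;> omega
    · omega
  let SP : V → V → V → V → Prop := fun a b c d => ∃ n t, NewCrossing G W f x r q n t ∧
    ((s(a, b) = s(x, n) ∧ s(c, d) = s(q, t)) ∨ (s(a, b) = s(q, t) ∧ s(c, d) = s(x, n)))
  have key : ∀ a b c d, G.Touches W a b → G.Touches W c d → Cross (g a) (g b) (g c) (g d) →
      Cross (f a) (f b) (f c) (f d) ∨ SP a b c d := by
    intro a b c d hab hcd hX
    cases kind a b hab with
    | outer e => exact absurd hX (outerKey _ _ _ _ hcd e)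
    | crossing e => exact Or.inl (crossingKey _ _ _ _ hcd e hX)
    | before ha hb ha' hb' => exact Or.inl (beforeKey _ _ _ _ hab hcd ha hb ha' hb' hX)
    | middle ha hb ha' hb' =>
      cases kind c d hcd with
      | outer e => exact absurd hX.symm (outerKey _ _ _ _ hab e)
      | crossing e => exact Or.inl (crossingKey _ _ _ _ hab e hX.symm).symm
      | before hc hd hc' hd' =>
        exact Or.inl (beforeKey _ _ _ _ hcd hab hc hd hc' hd' hX.symm).symm
      | middle hc hd hc' hd' => exact Or.inl (middleKey _ _ _ _ ha hb ha' hb' hc hd hc' hd' hX)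
      | after hc hd hc' hd' =>
        obtain ⟨n, t, h1, h2, h3⟩ := middleAfter _ _ _ _ hab.1 hcd.1 ha hb ha' hb' hc hd hc' hd' hX
        exact Or.inr ⟨n, t, h1, Or.inl ⟨h2, h3⟩⟩
    | after ha hb ha' hb' =>
      cases kind c d hcd with
      | outer e => exact absurd hX.symm (outerKey _ _ _ _ hab e)
      | crossing e => exact Or.inl (crossingKey _ _ _ _ hab e hX.symm).symm
      | before hc hd hc' hd' =>
        exact Or.inl (beforeKey _ _ _ _ hcd hab hc hd hc' hd' hX.symm).symm
      | middle hc hd hc' hd' =>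
        obtain ⟨n, t, h1, h2, h3⟩ :=
          middleAfter _ _ _ _ hcd.1 hab.1 hc hd hc' hd' ha hb ha' hb' hX.symm
        exact Or.inr ⟨n, t, h1, Or.inr ⟨h3, h2⟩⟩
      | after hc hd hc' hd' => exact Or.inl (afterKey _ _ _ _ ha hb hc hd ha' hb' hc' hd' hX)
  -- By `hU` both edges of a new crossing were uncrossed before, so neither acquires this crossing
  -- in addition to an old one.
  have spFree : ∀ a b c d a' b', SP a b c d → G.Touches W a' b' →
      ¬ Cross (f a) (f b) (f a') (f b') := by
    rintro a b c d a' b' ⟨n, t, h1, h2⟩ hab' hX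
    obtain ⟨u1, u2, -⟩ := hU n t h1
    rcases h2 with ⟨e, -⟩ | ⟨e, -⟩ <;> rw [Sym2.eq_iff] at e <;>
      rcases e with ⟨rfl, rfl⟩ | ⟨rfl, rfl⟩
    · exact u1 _ _ hab' hX
    · exact u1 _ _ hab' hX.swap_left
    · exact u2 _ _ hab' hX
    · exact u2 _ _ hab' hX.swap_left
  refine ⟨g, ⟨?_, ?_, ?_, by omega, ?_⟩, lxFree⟩
  · intro a ha b hb e
    have := hKW a ha
    have := hKW b hb
    apply hf.injOn a ha b hb
    rcases hgW a ha with h1 | h1 | h1 <;> rcases hgW b hb with h2 | h2 | h2 <;> omega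
  · intro w hw
    have := hKW w hw
    rcases hgW w hw with h1 | h1 | h1 <;> omega
  · intro w hw
    have := hKW w hw
    rcases hgW w hw with h1 | h1 | h1 <;> omega
  · intro a b c d c' d' hab hcd hcd' h1 h2
    rcases key _ _ _ _ hab hcd h1 with h1 | h1
    · rcases key _ _ _ _ hab hcd' h2 with h2 | h2
      · exact hf.crossUnique hab hcd hcd' h1 h2
      · exact absurd h1 (spFree _ _ _ _ _ _ h2 hcd)
    · rcases key _ _ _ _ hab hcd' h2 with h2 | h2
      · exact absurd h2 (spFree _ _ _ _ _ _ h1 hcd')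
      · obtain ⟨n, t, k1, k2⟩ := h1
        obtain ⟨n', t', k3, k4⟩ := h2
        obtain ⟨-, -, u⟩ := hU n t k1
        obtain ⟨rfl, rfl⟩ := u n' t' k3
        have xq : x ≠ q := fun e => by rw [e] at hxq; exact lt_irrefl _ hxq
        have xt : x ≠ t' := fun e => by have := k1.2.2.2.2.2.1; rw [← e] at this; omega
        have hne : s(x, n') ≠ s(q, t') := by
          rw [ne_eq, Sym2.eq_iff]; tauto
        rcases k2 with ⟨e1, e2⟩ | ⟨e1, e2⟩ <;> rcases k4 with ⟨e3, e4⟩ | ⟨e3, e4⟩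
        · rw [e2, e4]
        · exact absurd (e1.symm.trans e3) hne
        · exact absurd (e3.symm.trans e1) hne
        · rw [e2, e4]
end SimpleGraph

/-! ### Independent redrawing of the middle and the last block. -/

namespace SimpleGraph
variable {V : Type u} {G : SimpleGraph V} {f g f₂ f₃ : V → ℤ}
variable {W W₂ W₃ : Finset V} {l x y r p q : V}

open Classical in
/-- Redrawing the two parts of a piece that lie between `x` and `q` and behind `q`. -/
theorem IsPieceDrawing.substitute (hf : G.IsPieceDrawing W l r f) (h : G.IsPiece W l x y r)
    (hp : p ∈ W) (hq : q ∈ W) (hpq : G.Adj p q) (hpx : f p < f x) (hxq : f x < f q)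
    (hW₂ : ∀ w, w ∈ W₂ ↔ w ∈ W ∧ f x < f w ∧ f w < f q) (hW₃ : ∀ w, w ∈ W₃ ↔ w ∈ W ∧ f q < f w)
    (hf₂ : G.IsPieceDrawing W₂ x q f₂) (hf₃ : G.IsPieceDrawing W₃ q r f₃) :
    ∃ g, G.IsPieceDrawing W l r g ∧ g p < g x ∧ g x < g q ∧
      (∀ a ∈ W, g x < g a → g a < g q → a ∈ W₂) ∧
      (∀ a, (a ∈ W ∨ a = r) → g q < g a → f q < f a) ∧
      (∀ a b c d, G.Touches W₂ a b → G.Touches W c d → Cross (g a) (g b) (g c) (g d) →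
        G.Touches W₂ c d ∧ Cross (f₂ a) (f₂ b) (f₂ c) (f₂ d)) ∧
      (∀ a b c d, (G.Touches W₃ a b ∨ s(a, b) = s(q, r)) → G.Touches W c d →
        Cross (g a) (g b) (g c) (g d) →
        G.Touches W₃ c d ∧ Cross (f₃ a) (f₃ b) (f₃ c) (f₃ d)) := by
  obtain ⟨hqy, kind⟩ := hf.edgeKind h hp hq hpq hpx hxq
  obtain ⟨K, hK, hKW⟩ := exists_abs_le W f
  obtain ⟨K₂, hK₂, hKW₂⟩ := exists_abs_le W₂ f₂
  obtain ⟨K₃, hK₃, hKW₃⟩ := exists_abs_le W₃ f₃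
  obtain ⟨L, hL0, hL1, hL2⟩ : ∃ L, K ≤ L ∧ K₂ ≤ L ∧ K₃ ≤ L :=
    ⟨K + K₂ + K₃, by omega, by omega, by omega⟩
  have hx := h.x_mem
  have hlr := h.l_ne_r
  have inl : ∀ w ∈ W, w ≠ l := fun w hw e => h.l_notMem (e ▸ hw)
  have inr : ∀ w ∈ W, w ≠ r := fun w hw e => h.r_notMem (e ▸ hw)
  have hxq' : x ≠ q := fun e => by rw [e] at hxq; omega
  -- With L bounding all three arrangements, the first block ends at or below -L-1, the middle one
  -- occupies [-L, L], then comes q at L+1, and the last one occupies [L+2, 3L+2].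
  obtain ⟨g, hgl, hgr, hgq, hg₂, hg₃, hgW⟩ : ∃ g : V → ℤ, g l = -3 * L - 2 ∧ g r = 3 * L + 3 ∧
      g q = L + 1 ∧ (∀ w ∈ W₂, g w = f₂ w) ∧ (∀ w ∈ W₃, g w = f₃ w + 2 * L + 2) ∧
      (∀ w ∈ W, f w ≤ f x → g w = f w - 2 * L - 1) := by
    refine ⟨fun v => if v = l then -3 * L - 2 else if v = r then 3 * L + 3 else if v = q then L + 1
      else if f v ≤ f x then f v - 2 * L - 1 else if f v < f q then f₂ v else f₃ v + 2 * L + 2,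
      by simp, by simp [hlr.symm], by simp [inl q hq, inr q hq], fun w hw => ?_, fun w hw => ?_,
      fun w hw hwx => ?_⟩
    · obtain ⟨h1, h2, h3⟩ := (hW₂ w).mp hw
      have : w ≠ q := fun e => by rw [e] at h3; omega
      simp [inl w h1, inr w h1, this, not_le.mpr h2, h3]
    · obtain ⟨h1, h2⟩ := (hW₃ w).mp hw
      have : w ≠ q := fun e => by rw [e] at h2; omega
      simp [inl w h1, inr w h1, this, not_le.mpr (hxq.trans h2), not_lt.mpr h2.le]
    · have : w ≠ q := fun e => by rw [e] at hwx; omega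
      simp [inl w hw, inr w hw, this, hwx]
  have cls : ∀ w ∈ W, (f w ≤ f x ∧ g w = f w - 2 * L - 1 ∧ -L ≤ f w ∧ f w ≤ L) ∨
      (w ∈ W₂ ∧ g w = f₂ w ∧ -L ≤ f₂ w ∧ f₂ w ≤ L) ∨ w = q ∨
      (w ∈ W₃ ∧ f q < f w ∧ g w = f₃ w + 2 * L + 2 ∧ -L ≤ f₃ w ∧ f₃ w ≤ L) := by
    intro w hw
    rcases le_or_gt (f w) (f x) with h1 | h1
    · have := hKW w hw
      exact Or.inl ⟨h1, hgW w hw h1, by omega, by omega⟩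
    rcases lt_trichotomy (f w) (f q) with h2 | h2 | h2
    · have hw' := (hW₂ w).mpr ⟨hw, h1, h2⟩
      have := hKW₂ w hw'
      exact Or.inr (Or.inl ⟨hw', hg₂ w hw', by omega, by omega⟩)
    · exact Or.inr (Or.inr (Or.inl (hf.injOn w hw q hq h2)))
    · have hw' := (hW₃ w).mpr ⟨hw, h2⟩
      have := hKW₃ w hw'
      exact Or.inr (Or.inr (Or.inr ⟨hw', h2, hg₃ w hw', by omega, by omega⟩))
  have hgx := hgW x hx le_rfl
  have hgp := hgW p hp hpx.le
  have hKx := hKW x hx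
  have hKp := hKW p hp
  have edge₂ : ∀ a b, G.Touches W₂ a b → (a = x ∨ a = q ∨ a ∈ W₂) ∧ (b = x ∨ b = q ∨ b ∈ W₂) := by
    intro a b hab
    have mem : ∀ w ∈ W, f x ≤ f w → f w ≤ f q → w = x ∨ w = q ∨ w ∈ W₂ := by
      intro w hw h1 h2
      rcases h1.eq_or_lt with h1 | h1
      · exact Or.inl (hf.injOn w hw x hx h1.symm)
      rcases h2.eq_or_lt with h2 | h2
      · exact Or.inr (Or.inl (hf.injOn w hw q hq h2))
      exact Or.inr (Or.inr ((hW₂ w).mpr ⟨hw, h1, h2⟩))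
    have hw : (a ∈ W ∧ f x < f a ∧ f a < f q) ∨ (b ∈ W ∧ f x < f b ∧ f b < f q) := by
      rw [← hW₂, ← hW₂]; exact hab.2
    cases kind a b ⟨hab.1, by tauto⟩ with
    | outer e =>
      exfalso
      have := h.l_notMem
      rw [Sym2.eq_iff] at e
      rcases e with ⟨rfl, rfl⟩ | ⟨rfl, rfl⟩ <;> rcases hw with ⟨h1, h2, h3⟩ | ⟨h1, h2, h3⟩ <;>
        first | contradiction | omega
    | crossing e =>
      exfalso
      rw [Sym2.eq_iff] at e
      rcases e with ⟨rfl, rfl⟩ | ⟨rfl, rfl⟩ <;> omega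
    | before ha hb ha' hb' => omega
    | middle ha hb ha' hb' => exact ⟨mem a ha ha'.1 ha'.2, mem b hb hb'.1 hb'.2⟩
    | after ha hb ha' hb' => omega
  have edge₃ : ∀ a b, G.Touches W₃ a b → (a = q ∨ a = r ∨ a ∈ W₃) ∧ (b = q ∨ b = r ∨ b ∈ W₃) := by
    intro a b hab
    have mem : ∀ w, (w ∈ W ∨ w = r) → f q ≤ f w → w = q ∨ w = r ∨ w ∈ W₃ := by
      rintro w (hw | rfl) h1
      · rcases h1.eq_or_lt with h1 | h1
        · exact Or.inl (hf.injOn w hw q hq h1.symm)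
        · exact Or.inr (Or.inr ((hW₃ w).mpr ⟨hw, h1⟩))
      · simp
    have hw : (a ∈ W ∧ f q < f a) ∨ (b ∈ W ∧ f q < f b) := by
      rw [← hW₃, ← hW₃]; exact hab.2
    cases kind a b ⟨hab.1, by tauto⟩ with
    | outer e =>
      exfalso
      have := h.l_notMem
      rw [Sym2.eq_iff] at e
      rcases e with ⟨rfl, rfl⟩ | ⟨rfl, rfl⟩ <;> rcases hw with ⟨h1, h2⟩ | ⟨h1, h2⟩ <;>
        first | contradiction | omega
    | crossing e =>
      exfalso
      rw [Sym2.eq_iff] at e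
      rcases e with ⟨rfl, rfl⟩ | ⟨rfl, rfl⟩ <;> omega
    | before ha hb ha' hb' => omega
    | middle ha hb ha' hb' => omega
    | after ha hb ha' hb' => exact ⟨mem a ha ha', mem b hb hb'⟩
  -- The edges that touch neither redrawn block have their ends in R, on which the new order agrees
  -- with f.
  let R : Set V := {v | v = l ∨ v = r ∨ v = q ∨ (v ∈ W ∧ f v ≤ f x)}
  have edgeR : ∀ a b, G.Touches W a b → ¬ G.Touches W₂ a b → ¬ G.Touches W₃ a b →
      a ∈ R ∧ b ∈ R := by
    intro a b hab h1 h2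
    simp only [Touches, hab.1, true_and, not_or] at h1 h2
    have mem : ∀ w, (w ∈ W ∨ w = l ∨ w = r) → w ∉ W₂ → w ∉ W₃ → w ∈ R := by
      rintro w (hw | rfl | rfl) h1 h2
      · rcases cls w hw with h3 | h3 | h3 | h3
        · exact Or.inr (Or.inr (Or.inr ⟨hw, h3.1⟩))
        · exact absurd h3.1 h1
        · exact Or.inr (Or.inr (Or.inl h3))
        · exact absurd h3.1 h2
      · exact Or.inl rfl
      · exact Or.inr (Or.inl rfl)
    have hy := h.y_mem
    have mem' : ∀ w w', G.Touches W w w' → w ∈ W ∨ w = l ∨ w = r := by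
      intro w w' hw
      rcases h.touches_cases hw with h | h | h
      · exact Or.inl h.1
      · rw [Sym2.eq_iff] at h
        rcases h with ⟨rfl, rfl⟩ | ⟨rfl, rfl⟩ <;> simp [hx]
      · rw [Sym2.eq_iff] at h
        rcases h with ⟨rfl, rfl⟩ | ⟨rfl, rfl⟩ <;> simp [hy]
    exact ⟨mem a (mem' a b hab) h1.1 h2.1, mem b (mem' b a hab.symm) h1.2 h2.2⟩
  have pos₂ : ∀ a, (a = x ∨ a = q ∨ a ∈ W₂) → g x ≤ g a ∧ g a ≤ g q := by
    rintro a (rfl | rfl | ha)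
    · omega
    · omega
    · have := hKW₂ a ha
      have := hg₂ a ha
      omega
  have pos₃ : ∀ a, (a = q ∨ a = r ∨ a ∈ W₃) → g q ≤ g a ∧ g a ≤ g r := by
    rintro a (rfl | rfl | ha)
    · omega
    · omega
    · have := hKW₃ a ha
      have := hg₃ a ha
      omega
  have posR : ∀ a ∈ R, (g a ≤ g x ∨ g a = g q) ∨ g a = g r := by
    rintro a (rfl | rfl | rfl | ⟨ha, ha'⟩)
    · omega
    · omega
    · omega
    · have := hKW a ha
      have := hgW a ha ha'
      omega
  -- Edges touching the middle block stay between x and q, while all other edges have both ends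
  -- outside that open interval. So they cross only one another, exactly as in f₂.
  have X₂ : ∀ a b c d, G.Touches W₂ a b → G.Touches W c d → Cross (g a) (g b) (g c) (g d) →
      G.Touches W₂ c d ∧ Cross (f₂ a) (f₂ b) (f₂ c) (f₂ d) := by
    intro a b c d hab hcd hX
    obtain ⟨ha, hb⟩ := edge₂ a b hab
    by_cases h2 : G.Touches W₂ c d
    · obtain ⟨hc, hd⟩ := edge₂ c d h2
      refine ⟨h2, hX.of_monoOn (S := {v | v = x ∨ v = q ∨ v ∈ W₂}) ?_ ha hb hc hd⟩
      rintro s hs t ht hst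
      have := hf₂.left_lt_right
      rcases hs with rfl | rfl | hs <;> rcases ht with rfl | rfl | ht
      all_goals first
        | omega
        | exact hf₂.left _ ht
        | exact hf₂.right _ hs
        | (have := hg₂ _ ht; have := hg₂ _ hs; omega)
        | (have := hg₂ _ ht; have := hKW₂ _ ht; omega)
        | (have := hg₂ _ hs; have := hKW₂ _ hs; omega)
    · exfalso
      have out : ∀ c, (c = q ∨ c = r ∨ c ∈ W₃) ∨ c ∈ R → g c ≤ g x ∨ g q ≤ g c := by
        rintro c (hc | hc)
        · exact Or.inr (pos₃ c hc).1
        · rcases posR c hc with h | h <;> omega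
      by_cases h3 : G.Touches W₃ c d
      · obtain ⟨hc, hd⟩ := edge₃ c d h3
        exact not_cross_of_interval (g x) (g q) (pos₂ a ha) (pos₂ b hb) (out c (Or.inl hc))
          (out d (Or.inl hd)) hX.symm
      · obtain ⟨hc, hd⟩ := edgeR c d hcd h2 h3
        exact not_cross_of_interval (g x) (g q) (pos₂ a ha) (pos₂ b hb) (out c (Or.inr hc))
          (out d (Or.inr hd)) hX.symm
  have X₃ : ∀ a b c d, (G.Touches W₃ a b ∨ s(a, b) = s(q, r)) → G.Touches W c d →
      Cross (g a) (g b) (g c) (g d) →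
      G.Touches W₃ c d ∧ Cross (f₃ a) (f₃ b) (f₃ c) (f₃ d) := by
    intro a b c d hab hcd hX
    obtain ⟨ha, hb⟩ : (a = q ∨ a = r ∨ a ∈ W₃) ∧ (b = q ∨ b = r ∨ b ∈ W₃) := by
      rcases hab with hab | hab
      · exact edge₃ a b hab
      · rw [Sym2.eq_iff] at hab
        tauto
    by_cases h3 : G.Touches W₃ c d
    · obtain ⟨hc, hd⟩ := edge₃ c d h3
      refine ⟨h3, hX.of_monoOn (S := {v | v = q ∨ v = r ∨ v ∈ W₃}) ?_ ha hb hc hd⟩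
      rintro s hs t ht hst
      have := hf₃.left_lt_right
      rcases hs with rfl | rfl | hs <;> rcases ht with rfl | rfl | ht
      all_goals first
        | omega
        | exact hf₃.left _ ht
        | exact hf₃.right _ hs
        | (have := hg₃ _ ht; have := hg₃ _ hs; omega)
        | (have := hg₃ _ ht; have := hKW₃ _ ht; omega)
        | (have := hg₃ _ hs; have := hKW₃ _ hs; omega)
    · exfalso
      have out : ∀ c, (c = x ∨ c = q ∨ c ∈ W₂) ∨ c ∈ R → g c ≤ g q ∨ g r ≤ g c := by
        rintro c (hc | hc)
        · exact Or.inl (pos₂ c hc).2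
        · rcases posR c hc with h | h <;> omega
      by_cases h2 : G.Touches W₂ c d
      · obtain ⟨hc, hd⟩ := edge₂ c d h2
        exact not_cross_of_interval (g q) (g r) (pos₃ a ha) (pos₃ b hb) (out c (Or.inl hc))
          (out d (Or.inl hd)) hX.symm
      · obtain ⟨hc, hd⟩ := edgeR c d hcd h2 h3
        exact not_cross_of_interval (g q) (g r) (pos₃ a ha) (pos₃ b hb) (out c (Or.inr hc))
          (out d (Or.inr hd)) hX.symm
  have XR : ∀ a b c d, G.Touches W a b → ¬ G.Touches W₂ a b → ¬ G.Touches W₃ a b →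
      G.Touches W c d → Cross (g a) (g b) (g c) (g d) → Cross (f a) (f b) (f c) (f d) := by
    intro a b c d hab h2 h3 hcd hX
    have h2' : ¬ G.Touches W₂ c d := fun h' => h2 (X₂ _ _ _ _ h' hab hX.symm).1
    have h3' : ¬ G.Touches W₃ c d := fun h' => h3 (X₃ _ _ _ _ (Or.inl h') hab hX.symm).1
    obtain ⟨ha, hb⟩ := edgeR a b hab h2 h3
    obtain ⟨hc, hd⟩ := edgeR c d hcd h2' h3'
    refine hX.of_monoOn (S := R) ?_ ha hb hc hd
    have hlr := hf.left_lt_right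
    have hfq := hf.right q hq
    have hfq' := hf.left q hq
    rintro s hs t ht hst
    rcases hs with rfl | rfl | rfl | ⟨hs, hs'⟩ <;> rcases ht with rfl | rfl | rfl | ⟨ht, ht'⟩
    all_goals first
      | omega
      | exact hf.left _ ht
      | exact hf.right _ hs
      | (have := hgW _ ht ht'; have := hgW _ hs hs'; omega)
      | (have := hgW _ ht ht'; have := hKW _ ht; omega)
      | (have := hgW _ hs hs'; have := hKW _ hs; omega)
  refine ⟨g, ⟨?_, ?_, ?_, by omega, ?_⟩, by omega, by omega, ?_, ?_, X₂, X₃⟩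
  · intro a ha b hb e
    rcases cls a ha with h1 | h1 | rfl | h1 <;> rcases cls b hb with h2 | h2 | rfl | h2
    all_goals first
      | omega
      | rfl
      | exact hf.injOn a ha b hb (by omega)
      | exact hf₂.injOn a h1.1 b h2.1 (by omega)
      | exact hf₃.injOn a h1.1 b h2.1 (by omega)
  · intro w hw
    rcases cls w hw with h1 | h1 | rfl | h1 <;> omega
  · intro w hw
    rcases cls w hw with h1 | h1 | rfl | h1 <;> omega
  · intro a b c d c' d' hab hcd hcd' h1 h2
    by_cases h3 : G.Touches W₂ a b
    · obtain ⟨k1, k2⟩ := X₂ _ _ _ _ h3 hcd h1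
      obtain ⟨k3, k4⟩ := X₂ _ _ _ _ h3 hcd' h2
      exact hf₂.crossUnique h3 k1 k3 k2 k4
    by_cases h4 : G.Touches W₃ a b
    · obtain ⟨k1, k2⟩ := X₃ _ _ _ _ (Or.inl h4) hcd h1
      obtain ⟨k3, k4⟩ := X₃ _ _ _ _ (Or.inl h4) hcd' h2
      exact hf₃.crossUnique h4 k1 k3 k2 k4
    exact hf.crossUnique hab hcd hcd' (XR _ _ _ _ hab h3 h4 hcd h1) (XR _ _ _ _ hab h3 h4 hcd' h2)
  · intro a ha h1 h2
    rcases cls a ha with h3 | h3 | rfl | h3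
    · omega
    · exact h3.1
    · omega
    · omega
  · rintro a (ha | rfl) h1
    · rcases cls a ha with h3 | h3 | rfl | h3 <;> omega
    · exact hf.right q hq
end SimpleGraph

/-! ### Induction: every piece can be drawn with its left edge uncrossed. -/

namespace SimpleGraph
variable {V : Type u} {G : SimpleGraph V} {f g : V → ℤ}
variable {W W₂ : Finset V} {l x y r p q : V}

theorem IsPieceDrawing.mono (hf : G.IsPieceDrawing W l r f) {l' r' : V} (hW : W₂ ⊆ W)
    (hl : ∀ w ∈ W₂, f l' < f w) (hr : ∀ w ∈ W₂, f w < f r') (hlr : f l' < f r') :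
    G.IsPieceDrawing W₂ l' r' f := by
  refine ⟨fun a ha b hb => hf.injOn a (hW ha) b (hW hb), hl, hr, hlr, ?_⟩
  have T : ∀ {a b}, G.Touches W₂ a b → G.Touches W a b := fun h =>
    ⟨h.1, h.2.imp (fun h => hW h) (fun h => hW h)⟩
  exact fun a b c d c' d' h1 h2 h3 => hf.crossUnique (T h1) (T h2) (T h3)

-- With y before x, the edges lx and yr cross each other and hence nothing else. Reversing W
-- separates these two. An inner edge crossing one of them afterwards would pass over x or y and so
-- would have crossed it before, too.
open Classical in
theorem IsPieceDrawing.reflect (hf : G.IsPieceDrawing W l r f) (h : G.IsPiece W l x y r)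
    (hyx : f y < f x) : ∃ g, G.IsPieceDrawing W l r g ∧
      ∀ a b, G.Touches W a b → ¬ Cross (g l) (g x) (g a) (g b) := by
  have hlr := h.l_ne_r
  have inl : ∀ w ∈ W, w ≠ l := fun w hw e => h.l_notMem (e ▸ hw)
  have inr : ∀ w ∈ W, w ≠ r := fun w hw e => h.r_notMem (e ▸ hw)
  have Tlx : G.Touches W l x := ⟨h.adj_l, Or.inr h.x_mem⟩
  have Tyr : G.Touches W y r := ⟨h.adj_r, Or.inl h.y_mem⟩
  have hX : Cross (f l) (f x) (f y) (f r) :=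
    cross_of_lt (hf.left y h.y_mem) hyx (hf.right x h.x_mem)
  obtain ⟨g, hgl, hgr, hgW⟩ : ∃ g : V → ℤ, g l = - f r ∧ g r = - f l ∧ ∀ w ∈ W, g w = - f w := by
    refine ⟨fun v => if v = l then - f r else if v = r then - f l else - f v, by simp,
      by simp [hlr.symm], fun w hw => by simp [inl w hw, inr w hw]⟩
  have hlr' := hf.left_lt_right
  have hfx := hf.left x h.x_mem
  have hfx' := hf.right x h.x_mem
  have hfy := hf.left y h.y_mem
  have hfy' := hf.right y h.y_mem
  have hgx := hgW x h.x_mem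
  have hgy := hgW y h.y_mem
  have lxFree : ∀ a b, G.Touches W a b → ¬ Cross (g l) (g x) (g a) (g b) := by
    intro a b hab hc
    rcases h.touches_cases hab with ⟨ha, hb⟩ | hab' | hab'
    · have : Cross (f l) (f x) (f a) (f b) := by
        have := hgW a ha
        have := hgW b hb
        have := hf.left a ha
        have := hf.left b hb
        have := hf.right a ha
        have := hf.right b hb
        rcases hc with hc | hc | hc | hc | hc | hc | hc | hc <;> simp only [Cross] <;> omega
      exact sym2_ne_of_mem ha hb (Or.inr h.r_notMem) (hf.crossUnique Tlx hab Tyr this hX)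
    · obtain ⟨n1, n2, -, -⟩ := hc.ne
      rw [Sym2.eq_iff] at hab'
      rcases hab' with ⟨rfl, rfl⟩ | ⟨rfl, rfl⟩
      · exact n1 rfl
      · exact n2 rfl
    · refine not_cross_of_interval (g l) (g x) ⟨le_rfl, by omega⟩ ⟨by omega, le_rfl⟩ ?_ ?_ hc.symm
      all_goals
        rw [Sym2.eq_iff] at hab'
        rcases hab' with ⟨rfl, rfl⟩ | ⟨rfl, rfl⟩ <;> omega
  have yrFree : ∀ a b, G.Touches W a b → ¬ Cross (g y) (g r) (g a) (g b) := by
    intro a b hab hc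
    rcases h.touches_cases hab with ⟨ha, hb⟩ | hab' | hab'
    · have : Cross (f y) (f r) (f a) (f b) := by
        have := hgW a ha
        have := hgW b hb
        have := hf.left a ha
        have := hf.left b hb
        have := hf.right a ha
        have := hf.right b hb
        rcases hc with hc | hc | hc | hc | hc | hc | hc | hc <;> simp only [Cross] <;> omega
      exact sym2_ne_of_mem ha hb (Or.inl h.l_notMem) (hf.crossUnique Tyr hab Tlx this hX.symm)
    · refine lxFree y r Tyr ?_
      rw [Sym2.eq_iff] at hab'
      rcases hab' with ⟨rfl, rfl⟩ | ⟨rfl, rfl⟩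
      · exact hc.symm
      · exact hc.symm.swap_left
    · obtain ⟨n1, n2, -, -⟩ := hc.ne
      rw [Sym2.eq_iff] at hab'
      rcases hab' with ⟨rfl, rfl⟩ | ⟨rfl, rfl⟩
      · exact n1 rfl
      · exact n2 rfl
  have free : ∀ a b c d, G.Touches W c d → s(a, b) = s(l, x) ∨ s(a, b) = s(y, r) →
      ¬ Cross (g a) (g b) (g c) (g d) := by
    intro a b c d hcd hab hc
    simp only [Sym2.eq_iff] at hab
    rcases hab with (⟨rfl, rfl⟩ | ⟨rfl, rfl⟩) | ⟨rfl, rfl⟩ | ⟨rfl, rfl⟩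
    · exact lxFree _ _ hcd hc
    · exact lxFree _ _ hcd hc.swap_left
    · exact yrFree _ _ hcd hc
    · exact yrFree _ _ hcd hc.swap_left
  have key : ∀ a b c d, G.Touches W a b → G.Touches W c d → Cross (g a) (g b) (g c) (g d) →
      Cross (f a) (f b) (f c) (f d) := by
    intro a b c d hab hcd hc
    rcases h.touches_cases hab with ⟨h1, h2⟩ | h1
    · rcases h.touches_cases hcd with ⟨h3, h4⟩ | h3
      · rw [hgW a h1, hgW b h2, hgW c h3, hgW d h4] at hc
        exact hc.neg
      · exact absurd hc.symm (free _ _ _ _ hab h3)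
    · exact absurd hc (free _ _ _ _ hcd h1)
  refine ⟨g, ⟨?_, ?_, ?_, by omega, ?_⟩, lxFree⟩
  · intro a ha b hb e
    have := hgW a ha
    have := hgW b hb
    exact hf.injOn a ha b hb (by omega)
  · intro w hw
    have := hgW w hw
    have := hf.right w hw
    omega
  · intro w hw
    have := hgW w hw
    have := hf.left w hw
    omega
  · intro a b c d c' d' h1 h2 h3 h4 h5
    exact hf.crossUnique h1 h2 h3 (key _ _ _ _ h1 h2 h4) (key _ _ _ _ h1 h3 h5)

open Classical in
/-- A piece of a 2-connected graph of maximum degree three can be redrawn such that the edge to its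
left neighbour is not crossed. -/
theorem IsPieceDrawing.exists_uncrossed [Fintype V] [G.LocallyFinite] (hG : G.IsTwoConnected)
    (hd : ∀ v, G.degree v ≤ 3) (W : Finset V) : ∀ (l x y r : V) (f : V → ℤ),
    G.IsPiece W l x y r → G.IsPieceDrawing W l r f → ∃ g, G.IsPieceDrawing W l r g ∧
      ∀ a b, G.Touches W a b → ¬ Cross (g l) (g x) (g a) (g b) := by
  induction W using Finset.strongInduction with | H W ih =>
  intro l x y r f h hf
  by_cases hyx : f y < f x
  · exact hf.reflect h hyx
  by_cases hun : ∀ a b, G.Touches W a b → ¬ Cross (f l) (f x) (f a) (f b)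
  · exact ⟨f, hf, hun⟩
  push Not at hun
  obtain ⟨p, q, hp, hq, hpq, hpx, hxq⟩ : ∃ p q, p ∈ W ∧ q ∈ W ∧ G.Adj p q ∧ f p < f x ∧
      f x < f q := by
    obtain ⟨a, b, hab, hc⟩ := hun
    have h0 := hf.left x h.x_mem
    have h0' := hf.right x h.x_mem
    have h3 := hf.left y h.y_mem
    have h4 := hf.right y h.y_mem
    rcases h.touches_cases hab with ⟨ha, hb⟩ | hab' | hab'
    · have h1 := hf.left a ha
      have h2 := hf.left b hb
      rcases lt_trichotomy (f a) (f b) with hlt | heq | hlt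
      · refine ⟨a, b, ha, hb, hab.1, ?_⟩
        rw [cross_iff_of_lt h0 hlt] at hc
        omega
      · rw [heq] at hc
        exact absurd hc not_cross_self_right
      · refine ⟨b, a, hb, ha, hab.1.symm, ?_⟩
        rw [cross_comm_right, cross_iff_of_lt h0 hlt] at hc
        omega
    · exfalso
      obtain ⟨n1, n2, -, -⟩ := hc.ne
      rw [Sym2.eq_iff] at hab'
      rcases hab' with ⟨rfl, rfl⟩ | ⟨rfl, rfl⟩
      · exact n1 rfl
      · exact n2 rfl
    · exfalso
      refine not_cross_of_interval (f l) (f x) ⟨le_rfl, by omega⟩ ⟨by omega, le_rfl⟩ ?_ ?_ hc.symm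
      all_goals
        rw [Sym2.eq_iff] at hab'
        rcases hab' with ⟨rfl, rfl⟩ | ⟨rfl, rfl⟩ <;> omega
  obtain ⟨hqy, kind⟩ := hf.edgeKind h hp hq hpq hpx hxq
  -- Without an edge from x into the middle block, the reversal creates no crossing at all.
  by_cases hn : ∃ n ∈ W, f x < f n ∧ f n < f q ∧ G.Adj x n
  swap
  · refine hf.reorder h hp hq hpq hpx hxq fun n t hnt => ?_
    exact absurd ⟨n, hnt.1, hnt.2.1, hnt.2.2.1, hnt.2.2.2.1⟩ hn
  obtain ⟨n, hnW, hxn, hnq, adj_xn⟩ := hn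
  have inl : ∀ w ∈ W, w ≠ l := fun w hw e => h.l_notMem (e ▸ hw)
  have inr : ∀ w ∈ W, w ≠ r := fun w hw e => h.r_notMem (e ▸ hw)
  have fne : ∀ {a b}, f a < f b → a ≠ b := fun h e => by rw [e] at h; exact lt_irrefl _ h
  -- The vertices before x cannot be attached to the rest by pq alone, and the only other exit is x.
  -- So l, n, b exhaust the neighbours of x, and n is unique.
  obtain ⟨b, hbW, hbx, adj_xb⟩ : ∃ b ∈ W, f b < f x ∧ G.Adj x b := by
    obtain ⟨s, ⟨hs, hs'⟩, t, ht, hst, hne⟩ := hG.exists_boundary_ne (A := {w | w ∈ W ∧ f w < f x})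
      (s := p) (r := q) ⟨hp, hpx⟩ (fun e => by have := e.2; omega)
    cases kind s t ⟨hst, Or.inl hs⟩ with
    | outer e =>
      rw [Sym2.eq_iff] at e
      rcases e with ⟨rfl, -⟩ | ⟨rfl, -⟩
      · exact absurd hs h.l_notMem
      · omega
    | crossing e =>
      rw [Sym2.eq_iff] at e
      rcases e with e | ⟨rfl, -⟩
      · exact absurd e hne
      · omega
    | before ha hb ha' hb' =>
      have : f t = f x := by
        by_contra hh
        exact ht ⟨hb, by omega⟩
      rw [hf.injOn t hb x h.x_mem this] at hst
      exact ⟨s, hs, hs', hst.symm⟩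
    | middle ha hb ha' hb' => omega
    | after ha hb ha' hb' => omega
  have nbr_x : ∀ z, G.Adj x z → z = l ∨ z = n ∨ z = b := fun z hz =>
    eq_or_eq_or_eq_of_degree_le_three (hd x) h.adj_l.symm adj_xn adj_xb (inl n hnW).symm
      (inl b hbW).symm (fne (hbx.trans hxn)).symm hz
  -- The vertices up to q have a second exit besides xl, and it can only start at q.
  obtain ⟨t, htW, hqt, adj_qt⟩ : ∃ t, (t ∈ W ∨ t = r) ∧ f q < f t ∧ G.Adj q t := by
    obtain ⟨s, ⟨hs, hs'⟩, t, ht, hst, hne⟩ := hG.exists_boundary_ne (A := {w | w ∈ W ∧ f w ≤ f q})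
      (s := x) (r := l) ⟨h.x_mem, by omega⟩ (fun e => h.l_notMem e.1)
    cases kind s t ⟨hst, Or.inl hs⟩ with
    | outer e =>
      rw [Sym2.eq_iff] at e
      rcases e with ⟨rfl, -⟩ | e
      · exact absurd hs h.l_notMem
      · exact absurd e hne
    | crossing e =>
      rw [Sym2.eq_iff] at e
      rcases e with ⟨-, rfl⟩ | ⟨-, rfl⟩
      · exact absurd ⟨hq, le_rfl⟩ ht
      · exact absurd ⟨hp, by omega⟩ ht
    | before ha hb ha' hb' => exact absurd ⟨hb, by omega⟩ ht
    | middle ha hb ha' hb' => exact absurd ⟨hb, by omega⟩ ht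
    | after ha hb ha' hb' =>
      have : s = q := hf.injOn s hs q hq (by omega)
      subst this
      refine ⟨t, hb, ?_, hst⟩
      rcases hb with hb | rfl
      · by_contra hcon
        exact ht ⟨hb, by omega⟩
      · exact hf.right s hs
  let W₂ := W.filter fun w => f x < f w ∧ f w < f q
  let W₃ := W.filter fun w => f q < f w
  have hW₂ : ∀ w, w ∈ W₂ ↔ w ∈ W ∧ f x < f w ∧ f w < f q := fun w => Finset.mem_filter
  have hW₃ : ∀ w, w ∈ W₃ ↔ w ∈ W ∧ f q < f w := fun w => Finset.mem_filter
  have bd₂ : ∀ s ∈ W₂, ∀ t, t ∉ W₂ → G.Adj s t → (s = n ∧ t = x) ∨ t = q := by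
    intro s hs t ht hst
    rw [hW₂] at hs ht
    obtain ⟨hs, hs1, hs2⟩ := hs
    cases kind s t ⟨hst, Or.inl hs⟩ with
    | outer e =>
      rw [Sym2.eq_iff] at e
      rcases e with ⟨rfl, -⟩ | ⟨rfl, -⟩
      · exact absurd hs h.l_notMem
      · omega
    | crossing e =>
      rw [Sym2.eq_iff] at e
      rcases e with ⟨rfl, -⟩ | ⟨rfl, -⟩ <;> omega
    | before ha hb ha' hb' => omega
    | middle ha hb ha' hb' =>
      rcases hb'.1.eq_or_lt with e | e
      · have e := hf.injOn t hb x h.x_mem e.symm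
        subst e
        left
        rcases nbr_x s hst.symm with rfl | rfl | rfl
        · exact absurd hs h.l_notMem
        · exact ⟨rfl, rfl⟩
        · omega
      · right
        exact hf.injOn t hb q hq (le_antisymm hb'.2 (by
          by_contra hcon
          exact ht ⟨hb, e, by omega⟩))
    | after ha hb ha' hb' => omega
  -- The middle block is not attached by nx alone, so it has an edge to q. Now p, m, t exhaust the
  -- neighbours of q, and t is unique.
  obtain ⟨m, hmW₂, adj_mq⟩ : ∃ m ∈ W₂, G.Adj m q := by
    obtain ⟨s, hs, t, ht, hst, hne⟩ := hG.exists_boundary_ne (A := {w | w ∈ W₂})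
      (s := n) (r := x) ((hW₂ n).mpr ⟨hnW, hxn, hnq⟩) (fun e => by
        have := ((hW₂ x).mp e).2.1; omega)
    rcases bd₂ s hs t ht hst with e | rfl
    · exact absurd e hne
    · exact ⟨s, hs, hst⟩
  obtain ⟨hmW, hxm, hmq⟩ := (hW₂ m).mp hmW₂
  have nbr_q : ∀ z, G.Adj q z → z = p ∨ z = m ∨ z = t := fun z hz =>
    eq_or_eq_or_eq_of_degree_le_three (hd q) hpq.symm adj_mq.symm adj_qt (fne (hpx.trans hxm))
      (fne (hpx.trans (hxq.trans hqt))) (fne (hmq.trans hqt)) hz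
  have piece₂ : G.IsPiece W₂ x n m q := by
    refine ⟨fun e => ?_, fun e => ?_, fne hxq, (hW₂ n).mpr ⟨hnW, hxn, hnq⟩, hmW₂, adj_xn, adj_mq, ?_⟩
    · have := ((hW₂ x).mp e).2.1; omega
    · have := ((hW₂ q).mp e).2.2; omega
    · intro s hs t' ht' hst
      rcases bd₂ s hs t' ht' hst with e | rfl
      · exact Or.inl e
      · right
        refine ⟨?_, rfl⟩
        have hs' := (hW₂ s).mp hs
        rcases nbr_q s hst.symm with rfl | rfl | rfl
        · omega
        · rfl
        · omega
  have drawing₂ : G.IsPieceDrawing W₂ x q f := hf.mono (Finset.filter_subset _ _)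
    (fun w hw => ((hW₂ w).mp hw).2.1) (fun w hw => ((hW₂ w).mp hw).2.2) hxq
  have drawing₃ : G.IsPieceDrawing W₃ q r f := hf.mono (Finset.filter_subset _ _)
    (fun w hw => ((hW₃ w).mp hw).2) (fun w hw => hf.right w ((hW₃ w).mp hw).1) (hf.right q hq)
  have ssub : ∀ (P : V → Prop) [DecidablePred P], ¬ P x → W.filter P ⊂ W := fun P _ hP =>
    Finset.filter_ssubset.mpr ⟨x, h.x_mem, hP⟩
  obtain ⟨f₂, hf₂, free₂⟩ := ih W₂ (ssub _ (by omega)) x n m q f piece₂ drawing₂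
  obtain ⟨f₃, hf₃, free₃⟩ : ∃ f₃, G.IsPieceDrawing W₃ q r f₃ ∧
      ∀ a b, G.Touches W₃ a b → ¬ Cross (f₃ q) (f₃ t) (f₃ a) (f₃ b) := by
    -- If q itself is joined to r, this edge spans the last block up to the right end, and no edge
    -- kind can interleave with it; no induction is needed.
    by_cases htr : t = r
    · subst htr
      refine ⟨f, drawing₃, fun a b hab hc => ?_⟩
      have hab' : G.Touches W a b := ⟨hab.1, by
        have := hab.2; rw [hW₃, hW₃] at this; tauto⟩
      have up : ∀ a, (a ∈ W ∨ a = t) → f a ≤ f t := by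
        rintro a (ha | rfl)
        · exact (hf.right a ha).le
        · exact le_rfl
      have hlq := hf.left q hq
      have hlx := hf.left x h.x_mem
      cases kind a b hab' with
      | outer e =>
        rw [Sym2.eq_iff] at e
        refine not_cross_of_interval (f q) (f t) ⟨le_rfl, hqt.le⟩ ⟨hqt.le, le_rfl⟩ ?_ ?_ hc.symm
        all_goals rcases e with ⟨rfl, rfl⟩ | ⟨rfl, rfl⟩ <;> omega
      | crossing e =>
        rw [Sym2.eq_iff] at e
        refine not_cross_of_interval (f q) (f t) ⟨le_rfl, hqt.le⟩ ⟨hqt.le, le_rfl⟩ ?_ ?_ hc.symm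
        all_goals rcases e with ⟨rfl, rfl⟩ | ⟨rfl, rfl⟩ <;> omega
      | before ha hb ha' hb' =>
        exact not_cross_of_interval (f q) (f t) ⟨le_rfl, hqt.le⟩ ⟨hqt.le, le_rfl⟩ (by omega)
          (by omega) hc.symm
      | middle ha hb ha' hb' =>
        exact not_cross_of_interval (f q) (f t) ⟨le_rfl, hqt.le⟩ ⟨hqt.le, le_rfl⟩ (by omega)
          (by omega) hc.symm
      | after ha hb ha' hb' =>
        exact not_cross_of_interval (f q) (f t) ⟨ha', up a ha⟩ ⟨hb', up b hb⟩ (Or.inl le_rfl)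
          (Or.inr le_rfl) hc
    · have htW := htW.resolve_right htr
      have hyq : y ≠ q := by
        rintro rfl
        rcases nbr_q r h.adj_r with e | e | e
        · exact inr p hp e.symm
        · exact inr m hmW e.symm
        · exact htr e.symm
      have piece₃ : G.IsPiece W₃ q t y r := by
        refine ⟨fun e => ?_, fun e => ?_, inr q hq, (hW₃ t).mpr ⟨htW, hqt⟩, (hW₃ y).mpr
          ⟨h.y_mem, ?_⟩, adj_qt, h.adj_r, ?_⟩
        · have := ((hW₃ q).mp e).2; omega
        · exact h.r_notMem ((hW₃ r).mp e).1
        · exact lt_of_le_of_ne hqy fun e => hyq (hf.injOn y h.y_mem q hq e.symm)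
        · intro s hs t' ht' hst
          rw [hW₃] at hs ht'
          obtain ⟨hs, hs'⟩ := hs
          by_cases ht'W : t' ∈ W
          · left
            have : t' = q := by
              cases kind s t' ⟨hst, Or.inl hs⟩ with
              | outer e =>
                rw [Sym2.eq_iff] at e
                rcases e with ⟨rfl, -⟩ | ⟨-, rfl⟩
                · exact absurd hs h.l_notMem
                · exact absurd ht'W h.l_notMem
              | crossing e =>
                rw [Sym2.eq_iff] at e
                rcases e with ⟨rfl, -⟩ | ⟨rfl, -⟩ <;> omega
              | before ha hb ha' hb' => omega
              | middle ha hb ha' hb' => omega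
              | after ha hb ha' hb' =>
                exact hf.injOn t' ht'W q hq (le_antisymm (by
                  by_contra hcon
                  exact ht' ⟨ht'W, by omega⟩) hb')
            subst this
            refine ⟨?_, rfl⟩
            rcases nbr_q s hst.symm with rfl | rfl | rfl
            · omega
            · omega
            · rfl
          · rcases h.boundary s hs t' ht'W hst with ⟨rfl, -⟩ | e
            · omega
            · exact Or.inr e
      exact ih W₃ (ssub _ (by omega)) q t y r f piece₃ drawing₃
  -- After substituting the redrawn blocks, xn and qt are uncrossed, so the reversal may let them
  -- cross each other.
  obtain ⟨g, hg, hpx', hxq', hmid, haft, X₂, X₃⟩ :=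
    hf.substitute h hp hq hpq hpx hxq hW₂ hW₃ hf₂ hf₃
  refine hg.reorder h hp hq hpq hpx' hxq' fun n' t' hnt => ?_
  have uniq : ∀ n' t', NewCrossing G W g x r q n' t' → n' = n ∧ t' = t := by
    rintro n' t' ⟨h1, h2, h3, h4, h5, h6, h7⟩
    have h8 := (hW₂ n').mp (hmid n' h1 h2 h3)
    have h9 := haft t' h5 h6
    constructor
    · rcases nbr_x n' h4 with rfl | e | rfl
      · exact absurd h1 h.l_notMem
      · exact e
      · omega
    · rcases nbr_q t' h7 with rfl | rfl | e
      · omega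
      · omega
      · exact e
  obtain ⟨rfl, rfl⟩ := uniq n' t' hnt
  refine ⟨fun a b hab hc => ?_, fun a b hab hc => ?_, uniq⟩
  · obtain ⟨h1, h2⟩ := X₂ x n' a b ⟨adj_xn, Or.inr ((hW₂ n').mpr ⟨hnW, hxn, hnq⟩)⟩ hab hc
    exact free₂ a b h1 h2
  · have : G.Touches W₃ q t' ∨ s(q, t') = s(q, r) := by
      rcases htW with h | rfl
      · exact Or.inl ⟨adj_qt, Or.inr ((hW₃ t').mpr ⟨h, hqt⟩)⟩
      · exact Or.inr rfl
    obtain ⟨h1, h2⟩ := X₃ q t' a b this hab hc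
    exact free₃ a b h1 h2
end SimpleGraph

/-! ### Adding the edge xy, and the reduction of `H_t`. -/

namespace SimpleGraph
variable {V : Type u} {G : SimpleGraph V} {f g : V → ℤ}
variable {l x y r p q : V}

section AddEdge

open Classical in
/-- If the part of `G` outside `D` is attached to `D` by the edges `lx` and `yr` only, and has an
arrangement in which `lx` is not crossed, then it may be completed by the edge `xy`. -/
theorem IsPieceDrawing.deleteAddEdge {D : Set V} {W : Finset V} (hW : ∀ w, w ∈ W ↔ w ∉ D)
    (h : G.IsPiece W l x y r) (hf : G.IsPieceDrawing W l r f)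
    (hun : ∀ a b, G.Touches W a b → ¬ Cross (f l) (f x) (f a) (f b)) (hxy : x ≠ y) :
    (G.deleteAddEdge D x y).IsLinearDrawing (fun z => f z) := by
  have hyx := hxy.symm
  have hx := h.x_mem
  have hy := h.y_mem
  have mem : ∀ z : (Dᶜ : Set V), (z : V) ∈ W := fun z => (hW z).mpr z.2
  have ner : ∀ z : (Dᶜ : Set V), (z : V) ≠ r := fun z e => h.r_notMem (e ▸ mem z)
  have xr : x ≠ r := fun e => h.r_notMem (e ▸ hx)
  suffices H : CrossUnique (G.deleteAddEdge D x y).Adj (fun z => f z) from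
    ⟨fun a b e => Subtype.ext (hf.injOn a (mem a) b (mem b) e), fun h1 h2 h3 => H h1 h2 h3⟩
  have adj : ∀ a b : (Dᶜ : Set V), (G.deleteAddEdge D x y).Adj a b →
      (¬ ((a : V) = x ∧ (b : V) = y) ∧ ¬ ((b : V) = x ∧ (a : V) = y) ∧ G.Touches W a b) ∨
      ((a : V) = x ∧ (b : V) = y) ∨ ((b : V) = x ∧ (a : V) = y) := by
    intro a b hab
    by_cases h1 : (a : V) = x ∧ (b : V) = y
    · exact Or.inr (Or.inl h1)
    by_cases h2 : (b : V) = x ∧ (a : V) = y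
    · exact Or.inr (Or.inr h2)
    refine Or.inl ⟨h1, h2, ?_, Or.inl (mem a)⟩
    simp only [SimpleGraph.deleteAddEdge, comap_adj, sup_adj, edge_adj,
      Function.Embedding.subtype_apply] at hab
    tauto
  -- The edge cd separates x neither from l, as lx is uncrossed, nor l from r, as both lie outside
  -- the piece. Hence if it crosses xy it crosses ry.
  have key : ∀ c d : (Dᶜ : Set V), G.Touches W c d → Cross (f x) (f y) (f c) (f d) →
      Cross (f r) (f y) (f c) (f d) := by
    intro c d hcd hX
    have h1 := hun c d hcd
    have c1 := hf.left c (mem c)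
    have c2 := hf.right c (mem c)
    have d1 := hf.left d (mem d)
    have d2 := hf.right d (mem d)
    obtain ⟨n1, n2, n3, n4⟩ := hX.ne
    rw [cross_iff_btw n1 n2 n3 n4] at hX
    rw [cross_iff_btw (by omega) (by omega) n1 n2] at h1
    rw [cross_iff_btw (by omega) (by omega) n3 n4]
    have e1 : ¬ Btw (f c) (f d) (f l) := by unfold Btw; omega
    have e2 : ¬ Btw (f c) (f d) (f r) := by unfold Btw; omega
    tauto
  -- The edge yr is absent from the new graph, so it can stand for the new edge xy.
  refine CrossUnique.transfer hf.crossUnique (fun a b =>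
    (if (a : V) = x ∧ (b : V) = y then r else a, if (b : V) = x ∧ (a : V) = y then r else b)) ?_ ?_ ?_
  · intro a b hab
    have Tyr : G.Touches W y r := ⟨h.adj_r, Or.inl hy⟩
    rcases adj a b hab with ⟨h1, h2, h3⟩ | ⟨h1, h2⟩ | ⟨h1, h2⟩
    · simpa only [h1, h2, if_false] using h3
    · simpa [h1, h2, hxy, hyx] using Tyr.symm
    · simpa [h1, h2, hxy, hyx] using Tyr
  · intro a b c d hab hcd hX
    obtain ⟨n1, n2, n3, n4⟩ := hX.ne
    rcases adj a b hab with ⟨h1, h2, h3⟩ | ⟨h1, h2⟩ | ⟨h1, h2⟩ <;>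
      rcases adj c d hcd with ⟨k1, k2, k3⟩ | ⟨k1, k2⟩ | ⟨k1, k2⟩
    · simpa only [h1, h2, k1, k2, if_false] using hX
    · rw [k1, k2] at hX
      simpa [h1, h2, k1, k2, hxy, hyx] using (key a b h3 hX.symm).symm
    · rw [k1, k2] at hX
      simpa [h1, h2, k1, k2, hxy, hyx] using (key a b h3 hX.symm.swap_left).symm.swap_right
    · rw [h1, h2] at hX
      simpa [h1, h2, k1, k2, hxy, hyx] using key c d k3 hX
    · exact absurd (by rw [h1, k1]) n1
    · exact absurd (by rw [h1, k1]) n2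
    · rw [h1, h2] at hX
      simpa [h1, h2, k1, k2, hxy, hyx] using (key c d k3 hX.swap_left).swap_left
    · exact absurd (by rw [h1, k1]) n3
    · exact absurd (by rw [h1, k1]) n4
  · intro a b c d hab hcd he
    have hψ : ∀ (a : (Dᶜ : Set V)) (P : Prop),
        (if (if (a : V) = x ∧ P then r else (a : V)) = r then x else
          (if (a : V) = x ∧ P then r else (a : V))) = (a : V) := by
      intro a P
      by_cases hP : (a : V) = x ∧ P
      · simp [hP]
      · simp [hP, ner a]
    have e := congrArg (Sym2.map fun z => if z = r then x else z) he
    simp only [Sym2.map_mk] at e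
    rw [hψ, hψ, hψ, hψ] at e
    simpa only [Sym2.eq_iff, Subtype.ext_iff] using e

open Classical in
/-- A drawing of `G` yields a linear arrangement of a piece whose outer neighbours are not separated
by an edge of the piece. -/
theorem IsLinearDrawing.exists_pieceDrawing [Fintype V] (hf : G.IsLinearDrawing f) {W : Finset V}
    (h : G.IsPiece W l x y r) (hxy : x ≠ y)
    (hsep : ∀ c d, G.Adj c d → c ∈ W → d ∈ W → ¬ Cross (f l) (f r) (f c) (f d)) :
    ∃ g, G.IsPieceDrawing W l r g := by
  obtain ⟨K, hK, hKf⟩ := exists_abs_le Finset.univ f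
  replace hKf : ∀ v, -K ≤ f v ∧ f v ≤ K := fun v => hKf v (Finset.mem_univ v)
  have hx := h.x_mem
  have hy := h.y_mem
  have hlr := h.l_ne_r
  have inl : ∀ w ∈ W, w ≠ l := fun w hw e => h.l_notMem (e ▸ hw)
  have inr : ∀ w ∈ W, w ≠ r := fun w hw e => h.r_notMem (e ▸ hw)
  -- The circle is cut open at l instead, by shifting the labels below that of l past all others,
  -- and reversed if necessary to put x before y.
  obtain ⟨k, hkK, kinj, kX, kB, kxy⟩ : ∃ k : V → ℤ, (∀ v, -(3 * K + 1) ≤ k v ∧ k v ≤ 3 * K + 1) ∧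
      (∀ a ∈ W, ∀ b ∈ W, k a = k b → a = b) ∧
      (∀ a b c d, Cross (k a) (k b) (k c) (k d) → Cross (f a) (f b) (f c) (f d)) ∧
      (∀ a ∈ W, ∀ b ∈ W, ∀ z ∈ W, Btw (k a) (k b) (k z) → Cross (f l) (f z) (f a) (f b)) ∧
      k x < k y := by
    let h : V → ℤ := fun w => if f w < f l then f w + 2 * K + 1 else f w
    have hh : ∀ w, (f w < f l ∧ h w = f w + 2 * K + 1) ∨ (f l ≤ f w ∧ h w = f w) := by
      intro w
      by_cases hw : f w < f l
      · exact Or.inl ⟨hw, by simp [h, hw]⟩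
      · exact Or.inr ⟨by omega, by simp [h, hw]⟩
    have h1 : ∀ v, -(3 * K + 1) ≤ h v ∧ h v ≤ 3 * K + 1 := fun v => by
      have := hh v; have := hKf v; omega
    have h2 : ∀ a b, h a = h b → a = b := by
      intro a b e
      have := hh a; have := hh b; have := hKf a; have := hKf b
      exact hf.injective (by omega)
    have h3 : ∀ a b c d, Cross (h a) (h b) (h c) (h d) → Cross (f a) (f b) (f c) (f d) := by
      intro a b c d hX
      have ha := hKf a; have hb := hKf b; have hc := hKf c; have hd := hKf d
      rcases hh a with ea | ea <;> rcases hh b with eb | eb <;> rcases hh c with ec | ec <;>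
        rcases hh d with ed | ed <;> rw [ea.2, eb.2, ec.2, ed.2] at hX <;>
        rcases hX with hX | hX | hX | hX | hX | hX | hX | hX <;> first
          | (exfalso; omega)
          | (simp only [Cross]; omega)
    have h4 : ∀ a ∈ W, ∀ b ∈ W, ∀ z ∈ W, Btw (h a) (h b) (h z) →
        Cross (f l) (f z) (f a) (f b) := by
      intro a ha b hb z hz hB
      have ha' := hf.injective.ne (inl a ha)
      have hb' := hf.injective.ne (inl b hb)
      have hz' := hf.injective.ne (inl z hz)
      have ha := hKf a; have hb := hKf b; have hz := hKf z
      rcases hh a with ea | ea <;> rcases hh b with eb | eb <;> rcases hh z with ez | ez <;>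
        rw [ea.2, eb.2, ez.2] at hB <;> rcases hB with hB | hB <;> first
          | (exfalso; omega)
          | (simp only [Cross]; omega)
    rcases lt_trichotomy (h x) (h y) with h5 | h5 | h5
    · exact ⟨h, h1, fun a _ b _ => h2 a b, h3, h4, h5⟩
    · exact absurd (h2 x y h5) hxy
    · refine ⟨fun v => - h v, fun v => ?_, fun a _ b _ e => h2 a b (neg_injective e),
        fun a b c d hX => h3 a b c d hX.neg, fun a ha b hb z hz hB => h4 a ha b hb z hz ?_,
        neg_lt_neg h5⟩
      · have := h1 v
        dsimp only
        omega
      · simp only [Btw] at hB ⊢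
        omega
  obtain ⟨g, hgl, hgr, hgW⟩ : ∃ g : V → ℤ, g l = -(3 * K + 2) ∧ g r = 3 * K + 2 ∧
      ∀ w ∈ W, g w = k w := by
    refine ⟨fun v => if v = l then -(3 * K + 2) else if v = r then 3 * K + 2 else k v, by simp,
      by simp [hlr.symm], fun w hw => by simp [inl w hw, inr w hw]⟩
  have hgx := hgW x hx
  have hgy := hgW y hy
  have hkx := hkK x
  have hky := hkK y
  have lxKey : ∀ a ∈ W, ∀ b ∈ W, Cross (g l) (g x) (g a) (g b) →
      Cross (f l) (f x) (f a) (f b) := by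
    intro a ha b hb hX
    apply kB a ha b hb x hx
    rw [hgW a ha, hgW b hb, hgl, hgx] at hX
    have := hkK a
    have := hkK b
    unfold Btw
    rcases hX with hX | hX | hX | hX | hX | hX | hX | hX <;> omega
  have yrKey : ∀ a ∈ W, ∀ b ∈ W, G.Adj a b → Cross (g y) (g r) (g a) (g b) →
      Cross (f y) (f r) (f a) (f b) := by
    intro a ha b hb hab hX
    -- Moving r to the far right end, next to l on the circle, is harmless: ab separates y from l
    -- but not l from r, so it separates y from r.
    refine (Cross.of_not_cross (kB a ha b hb y hy ?_) (hsep a b hab ha hb)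
      (hf.injective.ne (inr a ha).symm) (hf.injective.ne (inr b hb).symm)).swap_left
    rw [hgW a ha, hgW b hb, hgr, hgy] at hX
    have := hkK a
    have := hkK b
    unfold Btw
    rcases hX with hX | hX | hX | hX | hX | hX | hX | hX <;> omega
  have links : ¬ Cross (g l) (g x) (g y) (g r) := by
    rw [hgl, hgr, hgx, hgy]
    rintro (hX | hX | hX | hX | hX | hX | hX | hX) <;> omega
  have lxKey' : ∀ a b c d, s(a, b) = s(l, x) → G.Touches W c d →
      Cross (g a) (g b) (g c) (g d) → Cross (f a) (f b) (f c) (f d) := by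
    have : ∀ c d, G.Touches W c d → Cross (g l) (g x) (g c) (g d) →
        Cross (f l) (f x) (f c) (f d) := by
      intro c d hcd hX
      rcases h.touches_cases hcd with ⟨h1, h2⟩ | h1 | h1
      · exact lxKey c h1 d h2 hX
      · obtain ⟨n1, n2, -, -⟩ := hX.ne
        rw [Sym2.eq_iff] at h1
        rcases h1 with ⟨rfl, rfl⟩ | ⟨rfl, rfl⟩
        · exact absurd rfl n1
        · exact absurd rfl n2
      · rw [Sym2.eq_iff] at h1
        rcases h1 with ⟨rfl, rfl⟩ | ⟨rfl, rfl⟩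
        · exact absurd hX links
        · exact absurd hX.swap_right links
    intro a b c d e hcd hX
    rw [Sym2.eq_iff] at e
    rcases e with ⟨rfl, rfl⟩ | ⟨rfl, rfl⟩
    · exact this c d hcd hX
    · exact (this c d hcd hX.swap_left).swap_left
  have yrKey' : ∀ a b c d, s(a, b) = s(y, r) → G.Touches W c d →
      Cross (g a) (g b) (g c) (g d) → Cross (f a) (f b) (f c) (f d) := by
    have : ∀ c d, G.Touches W c d → Cross (g y) (g r) (g c) (g d) →
        Cross (f y) (f r) (f c) (f d) := by
      intro c d hcd hX
      rcases h.touches_cases hcd with ⟨h1, h2⟩ | h1 | h1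
      · exact yrKey c h1 d h2 hcd.1 hX
      · rw [Sym2.eq_iff] at h1
        rcases h1 with ⟨rfl, rfl⟩ | ⟨rfl, rfl⟩
        · exact absurd hX.symm links
        · exact absurd hX.symm.swap_left links
      · obtain ⟨n1, n2, -, -⟩ := hX.ne
        rw [Sym2.eq_iff] at h1
        rcases h1 with ⟨rfl, rfl⟩ | ⟨rfl, rfl⟩
        · exact absurd rfl n1
        · exact absurd rfl n2
    intro a b c d e hcd hX
    rw [Sym2.eq_iff] at e
    rcases e with ⟨rfl, rfl⟩ | ⟨rfl, rfl⟩
    · exact this c d hcd hX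
    · exact (this c d hcd hX.swap_left).swap_left
  have key : ∀ a b c d, G.Touches W a b → G.Touches W c d → Cross (g a) (g b) (g c) (g d) →
      Cross (f a) (f b) (f c) (f d) := by
    intro a b c d hab hcd hX
    rcases h.touches_cases hab with ⟨h1, h2⟩ | h1 | h1
    · rcases h.touches_cases hcd with ⟨h3, h4⟩ | h3 | h3
      · rw [hgW a h1, hgW b h2, hgW c h3, hgW d h4] at hX
        exact kX _ _ _ _ hX
      · exact (lxKey' _ _ _ _ h3 hab hX.symm).symm
      · exact (yrKey' _ _ _ _ h3 hab hX.symm).symm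
    · exact lxKey' _ _ _ _ h1 hcd hX
    · exact yrKey' _ _ _ _ h1 hcd hX
  refine ⟨g, ?_, ?_, ?_, by omega, ?_⟩
  · intro a ha b hb e
    rw [hgW a ha, hgW b hb] at e
    exact kinj a ha b hb e
  · intro w hw
    have := hgW w hw
    have := hkK w
    omega
  · intro w hw
    have := hgW w hw
    have := hkK w
    omega
  · intro a b c d c' d' h1 h2 h3 h4 h5
    exact hf.cross_unique h1.1 h2.1 h3.1 (key _ _ _ _ h1 h2 h4) (key _ _ _ _ h1 h3 h5)

end AddEdge

section Ladder
variable [G.LocallyFinite] {t : ℕ} {u v : ℕ → V}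

theorem IsH.swap (h : G.IsH t u v x y) : G.IsH t v u y x := by
  have hs : solidH t v u = solidH t u v := by
    ext z; simp only [solidH, Set.mem_ofPred_eq, or_comm]
  refine ⟨h.one_le, fun i hi j hj => ⟨(h.solid j hj i hi).1.symm, fun hij =>
    ((h.solid i hi j hj).2 hij).symm⟩, ⟨hs ▸ h.hollow.2, hs ▸ h.hollow.1⟩,
    fun i hi => (h.degree_three i hi).symm, ⟨h.path.1.symm, fun i hi => (h.path.2.1 i hi).symm,
    h.path.2.2.symm⟩, ⟨h.chords.2.symm, h.chords.1.symm⟩, fun i h1 h2 => (h.rungs i h1 h2).symm⟩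

/-- The drawn edges exhaust the three neighbours of each solid vertex. The cases i = 0 and i = 1
stand apart because the crossing chords replace the rungs there. -/
theorem IsH.eq_of_adj (h : G.IsH t u v x y) {i : ℕ} (hi : i ≤ t) {z : V} (hz : G.Adj (u i) z)
    (hzs : z ∉ solidH t u v) : i = t ∧ z = x := by
  have ht := h.one_le
  have mu : ∀ j ≤ t, z ≠ u j := fun j hj e => hzs ⟨j, hj, Or.inl e⟩
  have mv : ∀ j ≤ t, z ≠ v j := fun j hj e => hzs ⟨j, hj, Or.inr e⟩
  have xu : ∀ j ≤ t, u j ≠ x := fun j hj e => h.hollow.1 ⟨j, hj, Or.inl e.symm⟩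
  have xv : ∀ j ≤ t, v j ≠ x := fun j hj e => h.hollow.1 ⟨j, hj, Or.inr e.symm⟩
  have uv : ∀ i ≤ t, ∀ j ≤ t, u i ≠ v j := fun i hi j hj => (h.solid i hi j hj).1
  have uu : ∀ i ≤ t, ∀ j ≤ t, i ≠ j → u i ≠ u j := fun i hi j hj e => ((h.solid i hi j hj).2 e).1
  have vv : ∀ i ≤ t, ∀ j ≤ t, i ≠ j → v i ≠ v j := fun i hi j hj e => ((h.solid i hi j hj).2 e).2
  have d := (h.degree_three i hi).1.le
  obtain ⟨p1, p2, p3, p4⟩ := h.path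
  obtain ⟨c1, c2⟩ := h.chords
  rcases Nat.lt_or_ge i 2 with hi2 | hi2
  · obtain rfl | rfl : i = 0 ∨ i = 1 := by omega
    · rcases eq_or_eq_or_eq_of_degree_le_three d p1 (p2 0 ht).1 c2 (uv 1 ht 0 (by omega)).symm
        (vv 0 (by omega) 1 ht (by omega)) (uv _ ht _ ht) hz with e | e | e
      · exact absurd e (mv 0 (by omega))
      · exact absurd e (mu _ ht)
      · exact absurd e (mv 1 ht)
    · rcases ht.eq_or_lt with rfl | ht'
      · rcases eq_or_eq_or_eq_of_degree_le_three d (p2 0 ht).1.symm c1 p3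
          (uv 0 (by omega) 0 (by omega)) (xu 0 (by omega)) (xv 0 (by omega)) hz with e | e | e
        · exact absurd e (mu 0 (by omega))
        · exact absurd e (mv 0 (by omega))
        · exact ⟨rfl, e⟩
      · rcases eq_or_eq_or_eq_of_degree_le_three d (p2 0 ht).1.symm c1 (p2 1 ht').1
          (uv 0 (by omega) 0 (by omega)) (uu 0 (by omega) 2 ht' (by omega))
          (uv 2 ht' 0 (by omega)).symm hz with e | e | e
        · exact absurd e (mu 0 (by omega))
        · exact absurd e (mv 0 (by omega))
        · exact absurd e (mu 2 ht')
  · obtain ⟨j, rfl⟩ : ∃ j, i = j + 1 := ⟨i - 1, by omega⟩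
    have r1 := h.rungs (j + 1) hi2 hi
    rcases hi.eq_or_lt with rfl | hi'
    · rcases eq_or_eq_or_eq_of_degree_le_three d (p2 j (by omega)).1.symm r1 p3
        (uv j (by omega) _ le_rfl) (xu j (by omega)) (xv _ le_rfl) hz with e | e | e
      · exact absurd e (mu j (by omega))
      · exact absurd e (mv _ le_rfl)
      · exact ⟨rfl, e⟩
    · rcases eq_or_eq_or_eq_of_degree_le_three d (p2 j (by omega)).1.symm r1 (p2 (j + 1) hi').1
        (uv j (by omega) _ hi) (uu j (by omega) _ hi' (by omega)) (uv _ hi' _ hi).symm hz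
        with e | e | e
      · exact absurd e (mu j (by omega))
      · exact absurd e (mv _ hi)
      · exact absurd e (mu _ hi')

/-- By induction on i, an outside edge cannot separate u_i from v_i. For i = 1 there are the
disjoint paths u₁u₀v₁ and u₁v₀v₁. For the step there are the rung and the detour down to u_i and
v_i, which lie on the same side. -/
theorem IsH.not_cross (h : G.IsH t u v x y) (hf : G.IsLinearDrawing f) {c d : V}
    (hcd : G.Adj c d) (hc : c ∉ solidH t u v) (hd : d ∉ solidH t u v) :
    ¬ Cross (f (u t)) (f (v t)) (f c) (f d) := by
  have ht := h.one_le
  have mu : ∀ j ≤ t, u j ≠ c ∧ u j ≠ d := fun j hj =>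
    ⟨fun e => hc ⟨j, hj, Or.inl e.symm⟩, fun e => hd ⟨j, hj, Or.inl e.symm⟩⟩
  have mv : ∀ j ≤ t, v j ≠ c ∧ v j ≠ d := fun j hj =>
    ⟨fun e => hc ⟨j, hj, Or.inr e.symm⟩, fun e => hd ⟨j, hj, Or.inr e.symm⟩⟩
  have uv : ∀ i ≤ t, ∀ j ≤ t, u i ≠ v j := fun i hi j hj => (h.solid i hi j hj).1
  have uu : ∀ i ≤ t, ∀ j ≤ t, i ≠ j → u i ≠ u j := fun i hi j hj e => ((h.solid i hi j hj).2 e).1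
  have vv : ∀ i ≤ t, ∀ j ≤ t, i ≠ j → v i ≠ v j := fun i hi j hj e => ((h.solid i hi j hj).2 e).2
  obtain ⟨p1, p2, p3, p4⟩ := h.path
  obtain ⟨c1, c2⟩ := h.chords
  have key : ∀ i, 1 ≤ i → i ≤ t →
      (Btw (f c) (f d) (f (u i)) ↔ Btw (f c) (f d) (f (v i))) := by
    intro i hi
    induction i, hi using Nat.le_induction with
    | base =>
      intro _
      have z : 0 ≤ t := by omega
      have u01 := (p2 0 ht).1
      have v01 := (p2 0 ht).2
      have k1 := hf.btw_iff_or hcd u01 c1 (mu 0 z) (mu 1 ht) (mu 1 ht) (mv 0 z)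
        (Or.inl ⟨uu 0 z 1 ht (by omega), uv 0 z 0 z⟩)
      have k2 := hf.btw_iff_or hcd u01 v01 (mu 0 z) (mu 1 ht) (mv 0 z) (mv 1 ht)
        (Or.inl ⟨uv 0 z 0 z, uv 0 z 1 ht⟩)
      have k3 := hf.btw_iff_or hcd c2 c1 (mu 0 z) (mv 1 ht) (mu 1 ht) (mv 0 z)
        (Or.inl ⟨uu 0 z 1 ht (by omega), uv 0 z 0 z⟩)
      have k4 := hf.btw_iff_or hcd c2 v01 (mu 0 z) (mv 1 ht) (mv 0 z) (mv 1 ht)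
        (Or.inl ⟨uv 0 z 0 z, uv 0 z 1 ht⟩)
      clear * - k1 k2 k3 k4
      grind
    | succ i hi ih =>
      intro hit
      have hit' : i ≤ t := by omega
      have ih := ih hit'
      have r1 := h.rungs (i + 1) (by omega) hit
      obtain ⟨u1, v1⟩ := p2 i hit
      have k1 := hf.btw_iff_or hcd r1 u1 (mu _ hit) (mv _ hit) (mu _ hit') (mu _ hit)
        (Or.inr ⟨(uv _ hit' _ hit).symm, (uv _ hit _ hit).symm⟩)
      have k2 := hf.btw_iff_or hcd r1 v1 (mu _ hit) (mv _ hit) (mv _ hit') (mv _ hit)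
        (Or.inl ⟨uv _ hit _ hit', uv _ hit _ hit⟩)
      clear * - k1 k2 ih
      grind
  rw [hf.cross_iff (mu t le_rfl).1 (mu t le_rfl).2 (mv t le_rfl).1 (mv t le_rfl).2]
  exact not_not.mpr (key t ht le_rfl)

open Classical in
theorem IsH.isOuterOnePlanar [Fintype V] (h : G.IsH t u v x y) (hf : G.IsLinearDrawing f)
    (hG : G.IsTwoConnected) (hd : ∀ v, G.degree v ≤ 3) (hxy : x ≠ y) :
    (G.deleteAddEdge (solidH t u v) x y).IsOuterOnePlanar := by
  let W : Finset V := Finset.univ.filter (· ∉ solidH t u v)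
  have hW : ∀ w, w ∈ W ↔ w ∉ solidH t u v := fun w => by simp [W]
  have hs : solidH t v u = solidH t u v := by
    ext z; simp only [solidH, Set.mem_ofPred_eq, or_comm]
  have piece : G.IsPiece W (u t) x y (v t) := by
    refine ⟨fun e => (hW _).mp e ⟨t, le_rfl, Or.inl rfl⟩,
      fun e => (hW _).mp e ⟨t, le_rfl, Or.inr rfl⟩, (h.solid t le_rfl t le_rfl).1,
      (hW _).mpr h.hollow.1, (hW _).mpr h.hollow.2, h.path.2.2.1, h.path.2.2.2.symm, ?_⟩
    intro a ha b hb hab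
    rw [hW] at ha hb
    obtain ⟨i, hi, rfl | rfl⟩ := not_not.mp hb
    · obtain ⟨rfl, e⟩ := h.eq_of_adj hi hab.symm ha
      exact Or.inl ⟨e, rfl⟩
    · obtain ⟨rfl, e⟩ := h.swap.eq_of_adj hi hab.symm (hs ▸ ha)
      exact Or.inr ⟨e, rfl⟩
  obtain ⟨f₁, hf₁⟩ := hf.exists_pieceDrawing piece hxy fun c d hcd hc hd =>
    h.not_cross hf hcd ((hW c).mp hc) ((hW d).mp hd)
  obtain ⟨g, hg, hun⟩ := IsPieceDrawing.exists_uncrossed hG hd W _ _ _ _ _ piece hf₁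
  exact (hg.deleteAddEdge hW piece hun hxy).isOuterOnePlanar

end Ladder
end SimpleGraph

/-! ### Recognising configurations from local data. -/

namespace SimpleGraph
variable {V : Type u} {G : SimpleGraph V} {f : V → ℤ}

section Configurations
variable [G.LocallyFinite]

/-- `G` contains one of the configurations `G₁`, …, `G₈` or some `H_t`. -/
def HasConfiguration (G : SimpleGraph V) [G.LocallyFinite] : Prop :=
  (∃ u v x y, G.IsG1 u v x y) ∨
  (∃ u v w x y, G.IsG2 u v w x y) ∨
  (∃ u v x y, G.IsG3 u v x y) ∨
  (∃ u₀ u₁ v₀ v₁ w x y, G.IsG4 u₀ u₁ v₀ v₁ w x y) ∨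
  (∃ u₀ u₁ u₂ v₀ v₁ v₂ x y, G.IsG5 u₀ u₁ u₂ v₀ v₁ v₂ x y) ∨
  (∃ u₀ u₁ u₂ v₀ v₁ w x y, G.IsG6 u₀ u₁ u₂ v₀ v₁ w x y) ∨
  (∃ u₀ u₁ u₂ v₀ v₁ v₂ w x y, G.IsG7 u₀ u₁ u₂ v₀ v₁ v₂ w x y) ∨
  (∃ u₀ u₁ u₂ v₀ v₁ x y, G.IsG8 u₀ u₁ u₂ v₀ v₁ x y) ∨
  (∃ t u v x y, G.IsH t u v x y)

theorem IsG1.hasConfiguration {u v x y : V} (h : G.IsG1 u v x y) : G.HasConfiguration :=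
  Or.inl ⟨_, _, _, _, h⟩

theorem IsG2.hasConfiguration {u v w x y : V} (h : G.IsG2 u v w x y) : G.HasConfiguration :=
  Or.inr (Or.inl ⟨_, _, _, _, _, h⟩)

theorem IsG3.hasConfiguration {u v x y : V} (h : G.IsG3 u v x y) : G.HasConfiguration :=
  Or.inr (Or.inr (Or.inl ⟨_, _, _, _, h⟩))

theorem IsG4.hasConfiguration {u₀ u₁ v₀ v₁ w x y : V} (h : G.IsG4 u₀ u₁ v₀ v₁ w x y) :
    G.HasConfiguration :=
  Or.inr (Or.inr (Or.inr (Or.inl ⟨_, _, _, _, _, _, _, h⟩)))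

theorem IsG5.hasConfiguration {u₀ u₁ u₂ v₀ v₁ v₂ x y : V} (h : G.IsG5 u₀ u₁ u₂ v₀ v₁ v₂ x y) :
    G.HasConfiguration :=
  Or.inr (Or.inr (Or.inr (Or.inr (Or.inl ⟨_, _, _, _, _, _, _, _, h⟩))))

theorem IsG6.hasConfiguration {u₀ u₁ u₂ v₀ v₁ w x y : V} (h : G.IsG6 u₀ u₁ u₂ v₀ v₁ w x y) :
    G.HasConfiguration :=
  Or.inr (Or.inr (Or.inr (Or.inr (Or.inr (Or.inl ⟨_, _, _, _, _, _, _, _, h⟩)))))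

theorem IsG7.hasConfiguration {u₀ u₁ u₂ v₀ v₁ v₂ w x y : V}
    (h : G.IsG7 u₀ u₁ u₂ v₀ v₁ v₂ w x y) : G.HasConfiguration :=
  Or.inr (Or.inr (Or.inr (Or.inr (Or.inr (Or.inr (Or.inl ⟨_, _, _, _, _, _, _, _, _, h⟩))))))

theorem IsG8.hasConfiguration {u₀ u₁ u₂ v₀ v₁ x y : V} (h : G.IsG8 u₀ u₁ u₂ v₀ v₁ x y) :
    G.HasConfiguration :=
  Or.inr (Or.inr (Or.inr (Or.inr (Or.inr (Or.inr (Or.inr (Or.inl ⟨_, _, _, _, _, _, _, h⟩)))))))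

theorem IsH.hasConfiguration {t : ℕ} {u v : ℕ → V} {x y : V} (h : G.IsH t u v x y) :
    G.HasConfiguration :=
  Or.inr (Or.inr (Or.inr (Or.inr (Or.inr (Or.inr (Or.inr (Or.inr ⟨_, _, _, _, _, h⟩)))))))

theorem HasConfiguration.of_adj_degree_two [Fintype V] (hG : G.IsTwoConnected) {u v : V}
    (huv : G.Adj u v) (hu : G.degree u = 2) (hv : G.degree v = 2) : G.HasConfiguration := by
  obtain ⟨x, hx, hux⟩ := hG.exists_neighbor_ne u v
  obtain ⟨y, hy, hvy⟩ := hG.exists_neighbor_ne v u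
  exact IsG1.hasConfiguration (u := u) (v := v) (x := x) (y := y) ⟨by simp [huv.ne],
    by simp [hx, hy, hux.ne', hvy.ne'], ⟨hu, hv⟩, huv, hux, hvy⟩

/-- If v and w both have a third neighbour this is `G₂`; otherwise one of them has degree two, like
u, and `G₁` arises. -/
theorem HasConfiguration.of_triangle [Fintype V] (hG : G.IsTwoConnected)
    (hd : ∀ v, G.degree v ≤ 3) {u v w : V} (huv : G.Adj u v) (huw : G.Adj u w) (hvw : G.Adj v w)
    (hu : G.degree u = 2) : G.HasConfiguration := by
  by_cases hx : ∃ x, G.Adj v x ∧ x ≠ u ∧ x ≠ w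
  swap
  · push Not at hx
    exact .of_adj_degree_two hG huv hu (degree_eq_two huv.symm hvw huw.ne fun z hz => by
      by_cases h : z = u
      · exact Or.inl h
      · exact Or.inr (hx z hz h))
  by_cases hy : ∃ y, G.Adj w y ∧ y ≠ u ∧ y ≠ v
  swap
  · push Not at hy
    exact .of_adj_degree_two hG huw hu (degree_eq_two huw.symm hvw.symm huv.ne fun z hz => by
      by_cases h : z = u
      · exact Or.inl h
      · exact Or.inr (hy z hz h))
  obtain ⟨x, hvx, hxu, hxw⟩ := hx
  obtain ⟨y, hwy, hyu, hyv⟩ := hy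
  exact IsG2.hasConfiguration (u := u) (v := v) (w := w) (x := x) (y := y)
    ⟨by simp [huv.ne, huw.ne, hvw.ne],
    by simp [hxu, hxw, hvx.ne', hyu, hyv, hwy.ne'], hu,
    ⟨degree_eq_three (hd v) huv.symm hvw hvx huw.ne hxu.symm hxw.symm,
    degree_eq_three (hd w) huw.symm hvw.symm hwy huv.ne hyu.symm hyv.symm⟩, huv, huw, hvw, hvx, hwy⟩

theorem HasConfiguration.of_square {u v x y : V} (huv : u ≠ v) (hxy : x ≠ y) (hux : G.Adj u x)
    (huy : G.Adj u y) (hvx : G.Adj v x) (hvy : G.Adj v y) (hu : G.degree u = 2)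
    (hv : G.degree v = 2) : G.HasConfiguration :=
  IsG3.hasConfiguration (u := u) (v := v) (x := x) (y := y) ⟨by simp [huv],
    by simp [hux.ne', huy.ne', hvx.ne', hvy.ne', hxy], ⟨hu, hv⟩, hux, huy, hvx, hvy⟩

/-- `w` has degree two with neighbours `a`, `b`, and differs from `c`, `d`, `x`, `y`. -/
structure IsMid (G : SimpleGraph V) [G.LocallyFinite] (a b c d x y w : V) : Prop where
  degree : G.degree w = 2
  adj_left : G.Adj a w
  adj_right : G.Adj w b
  ne_c : w ≠ c
  ne_d : w ≠ d
  ne_x : w ≠ x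
  ne_y : w ≠ y

theorem IsMid.symm {a b c d x y w : V} (h : G.IsMid a b c d x y w) : G.IsMid b a d c y x w :=
  ⟨h.degree, h.adj_right.symm, h.adj_left.symm, h.ne_d, h.ne_c, h.ne_y, h.ne_x⟩

/-- Both neighbours of w are a and b, whereas w' has the further neighbour a'. -/
theorem IsMid.ne {a b c d x y x' y' w a' b' c' d' w' : V} (h : G.IsMid a b c d x y w)
    (h' : G.IsMid a' b' c' d' x' y' w') (hab : a ≠ b) (ha : a' ≠ a) (hb : a' ≠ b) : w ≠ w' := by
  rintro rfl
  rcases eq_or_eq_of_degree_eq_two h.degree h.adj_left.symm h.adj_right hab h'.adj_left.symm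
    with e | e
  · exact ha e
  · exact hb e

/-- Two crossing edges `ac`, `bd` together with three sides `ab`, `bc`, `cd` of the quadrangle, each
an edge or a path through a vertex of degree two, form one of the configurations. -/
theorem HasConfiguration.of_kite (hd : ∀ v, G.degree v ≤ 3) {a b c d x y : V} (hac : G.Adj a c)
    (hbd : G.Adj b d) (hab : a ≠ b) (had : a ≠ d) (hbc : b ≠ c) (hcd : c ≠ d)
    (hax : G.Adj a x) (hdy : G.Adj d y) (hxb : x ≠ b) (hxc : x ≠ c) (hxd : x ≠ d)
    (hya : y ≠ a) (hyb : y ≠ b) (hyc : y ≠ c)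
    (s₁ : G.Adj a b ∨ ∃ w, G.IsMid a b c d x y w) (s₂ : G.Adj b c ∨ ∃ w, G.IsMid b c a d x y w)
    (s₃ : G.Adj c d ∨ ∃ w, G.IsMid c d a b x y w) : G.HasConfiguration := by
  have xa := hax.ne'
  have yd := hdy.ne'
  have nac := hac.ne
  have nbd := hbd.ne
  have da : G.degree a = 3 := by
    rcases s₁ with h | ⟨w, h⟩
    · exact degree_eq_three (hd a) hac hax h hxc.symm hbc.symm hxb
    · exact degree_eq_three (hd a) hac hax h.adj_left hxc.symm h.ne_c.symm h.ne_x.symm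
  have dd : G.degree d = 3 := by
    rcases s₃ with h | ⟨w, h⟩
    · exact degree_eq_three (hd d) hbd.symm hdy h.symm hyb.symm hbc hyc
    · exact degree_eq_three (hd d) hbd.symm hdy h.adj_right.symm hyb.symm h.ne_d.symm h.ne_y.symm
  have db : G.degree b = 3 := by
    rcases s₁ with h | ⟨w, h⟩ <;> rcases s₂ with k | ⟨w', k⟩
    · exact degree_eq_three (hd b) hbd h.symm k had.symm hcd.symm nac
    · exact degree_eq_three (hd b) hbd h.symm k.adj_left had.symm k.ne_d.symm k.ne_c.symm
    · exact degree_eq_three (hd b) hbd h.adj_right.symm k h.ne_d.symm hcd.symm h.ne_c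
    · exact degree_eq_three (hd b) hbd h.adj_right.symm k.adj_left h.ne_d.symm k.ne_d.symm
        (h.symm.ne k.symm hab.symm hbc.symm nac.symm)
  have dc : G.degree c = 3 := by
    rcases s₂ with h | ⟨w, h⟩ <;> rcases s₃ with k | ⟨w', k⟩
    · exact degree_eq_three (hd c) hac.symm h.symm k hab had nbd
    · exact degree_eq_three (hd c) hac.symm h.symm k.adj_left hab k.ne_c.symm k.ne_d.symm
    · exact degree_eq_three (hd c) hac.symm h.adj_right.symm k h.ne_c.symm had h.ne_d
    · exact degree_eq_three (hd c) hac.symm h.adj_right.symm k.adj_left h.ne_c.symm k.ne_c.symm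
        (h.ne k.symm hbc nbd.symm hcd.symm)
  -- The eight patterns yield, in this order, `H_1`, `G₈` (mirrored), `G₄`, `G₆` (mirrored), `G₈`,
  -- `G₅`, `G₆`, `G₇`.
  rcases s₁ with h₁ | ⟨w₁, h₁⟩ <;> rcases s₂ with h₂ | ⟨w₂, h₂⟩ <;> rcases s₃ with h₃ | ⟨w₃, h₃⟩
  · refine IsH.hasConfiguration (t := 1) (u := fun n => if n = 0 then b else a)
      (v := fun n => if n = 0 then c else d) (x := x) (y := y) ⟨le_rfl, ?_, ?_, ?_, ?_, ?_, ?_⟩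
    · intro i hi j hj
      interval_cases i <;> interval_cases j <;>
        simp [hab, hab.symm, had, hbc, nac, nbd, hcd, hcd.symm]
    · constructor
      · rintro ⟨i, hi, h⟩
        interval_cases i <;> simp_all
      · rintro ⟨i, hi, h⟩
        interval_cases i <;> simp_all
    · intro i hi
      interval_cases i <;> simp [da, db, dc, dd]
    · refine ⟨h₂, fun i hi => ?_, hax, hdy⟩
      interval_cases i
      simp [h₁.symm, h₃]
    · exact ⟨hac, hbd⟩
    · intro i h1 h2
      omega
  · have n1 := h₃.adj_left.ne
    have n2 := h₃.adj_right.ne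
    have n3 := h₃.ne_c
    have n4 := h₃.ne_d
    have n5 := h₃.ne_x
    have n6 := h₃.ne_y
    refine IsG8.hasConfiguration (u₀ := c) (u₁ := w₃) (u₂ := d) (v₀ := b) (v₁ := a) (x := y)
      (y := x) ⟨?_, ?_, h₃.degree, ⟨dc, dd, db, da⟩, ⟨hdy.symm, h₃.adj_right.symm,
      h₃.adj_left.symm, h₂.symm, h₁.symm, hax⟩, hbd.symm, hac.symm⟩ <;> simp <;> grind
  · have n1 := h₂.adj_left.ne
    have n2 := h₂.adj_right.ne
    have n3 := h₂.ne_c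
    have n4 := h₂.ne_d
    have n5 := h₂.ne_x
    have n6 := h₂.ne_y
    refine IsG4.hasConfiguration (u₀ := b) (u₁ := a) (v₀ := c) (v₁ := d) (w := w₂) (x := x)
      (y := y) ⟨?_, ?_, h₂.degree, ⟨db, da, dc, dd⟩, ⟨hax.symm, h₁, h₂.adj_left,
      h₂.adj_right, h₃, hdy⟩, hac, hbd⟩ <;> simp <;> grind
  · have n1 := h₂.adj_left.ne
    have n2 := h₂.adj_right.ne
    have n3 := h₂.ne_c
    have n4 := h₂.ne_d
    have n5 := h₂.ne_x
    have n6 := h₂.ne_y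
    have m1 := h₃.adj_left.ne
    have m2 := h₃.adj_right.ne
    have m3 := h₃.ne_c
    have m4 := h₃.ne_d
    have m5 := h₃.ne_x
    have m6 := h₃.ne_y
    have e := h₂.ne h₃.symm hbc nbd.symm hcd.symm
    refine IsG6.hasConfiguration (u₀ := c) (u₁ := w₃) (u₂ := d) (v₀ := b) (v₁ := a) (w := w₂)
      (x := y) (y := x) ⟨?_, ?_, ⟨h₃.degree, h₂.degree⟩, ⟨dc, dd, db, da⟩, ⟨hdy.symm,
      h₃.adj_right.symm, h₃.adj_left.symm, h₂.adj_right.symm, h₂.adj_left.symm, h₁.symm, hax⟩,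
      hbd.symm, hac.symm⟩ <;> simp <;> grind
  · have n1 := h₁.adj_left.ne
    have n2 := h₁.adj_right.ne
    have n3 := h₁.ne_c
    have n4 := h₁.ne_d
    have n5 := h₁.ne_x
    have n6 := h₁.ne_y
    refine IsG8.hasConfiguration (u₀ := b) (u₁ := w₁) (u₂ := a) (v₀ := c) (v₁ := d) (x := x)
      (y := y) ⟨?_, ?_, h₁.degree, ⟨db, da, dc, dd⟩, ⟨hax.symm, h₁.adj_left,
      h₁.adj_right, h₂, h₃, hdy⟩, hac, hbd⟩ <;> simp <;> grind
  · have n1 := h₁.adj_left.ne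
    have n2 := h₁.adj_right.ne
    have n3 := h₁.ne_c
    have n4 := h₁.ne_d
    have n5 := h₁.ne_x
    have n6 := h₁.ne_y
    have m1 := h₃.adj_left.ne
    have m2 := h₃.adj_right.ne
    have m3 := h₃.ne_c
    have m4 := h₃.ne_d
    have m5 := h₃.ne_x
    have m6 := h₃.ne_y
    have e := h₁.ne h₃ hab nac.symm hbc.symm
    refine IsG5.hasConfiguration (u₀ := b) (u₁ := w₁) (u₂ := a) (v₀ := c) (v₁ := w₃) (v₂ := d)
      (x := x) (y := y) ⟨?_, ?_, ⟨h₁.degree, h₃.degree⟩, ⟨db, da, dc, dd⟩, ⟨hax.symm,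
      h₁.adj_left, h₁.adj_right, h₂, h₃.adj_left, h₃.adj_right, hdy⟩, hac, hbd⟩ <;> simp <;> grind
  · have n1 := h₁.adj_left.ne
    have n2 := h₁.adj_right.ne
    have n3 := h₁.ne_c
    have n4 := h₁.ne_d
    have n5 := h₁.ne_x
    have n6 := h₁.ne_y
    have m1 := h₂.adj_left.ne
    have m2 := h₂.adj_right.ne
    have m3 := h₂.ne_c
    have m4 := h₂.ne_d
    have m5 := h₂.ne_x
    have m6 := h₂.ne_y
    have e := h₁.symm.ne h₂.symm hab.symm hbc.symm nac.symm
    refine IsG6.hasConfiguration (u₀ := b) (u₁ := w₁) (u₂ := a) (v₀ := c) (v₁ := d) (w := w₂)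
      (x := x) (y := y) ⟨?_, ?_, ⟨h₁.degree, h₂.degree⟩, ⟨db, da, dc, dd⟩, ⟨hax.symm,
      h₁.adj_left, h₁.adj_right, h₂.adj_left, h₂.adj_right, h₃, hdy⟩, hac, hbd⟩ <;> simp <;> grind
  · have n1 := h₁.adj_left.ne
    have n2 := h₁.adj_right.ne
    have n3 := h₁.ne_c
    have n4 := h₁.ne_d
    have n5 := h₁.ne_x
    have n6 := h₁.ne_y
    have m1 := h₂.adj_left.ne
    have m2 := h₂.adj_right.ne
    have m3 := h₂.ne_c
    have m4 := h₂.ne_d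
    have m5 := h₂.ne_x
    have m6 := h₂.ne_y
    have l1 := h₃.adj_left.ne
    have l2 := h₃.adj_right.ne
    have l3 := h₃.ne_c
    have l4 := h₃.ne_d
    have l5 := h₃.ne_x
    have l6 := h₃.ne_y
    have e1 := h₁.symm.ne h₂.symm hab.symm hbc.symm nac.symm
    have e2 := h₂.ne h₃.symm hbc nbd.symm hcd.symm
    have e3 := h₁.ne h₃ hab nac.symm hbc.symm
    refine IsG7.hasConfiguration (u₀ := b) (u₁ := w₁) (u₂ := a) (v₀ := c) (v₁ := w₃) (v₂ := d)
      (w := w₂) (x := x) (y := y) ⟨?_, ?_, ⟨h₁.degree, h₃.degree, h₂.degree⟩, ⟨db, da, dc, dd⟩,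
      ⟨hax.symm, h₁.adj_left, h₁.adj_right, h₂.adj_left, h₂.adj_right, h₃.adj_left, h₃.adj_right,
      hdy⟩, hac, hbd⟩ <;> simp <;> grind

end Configurations
end SimpleGraph

/-! ### Existence of a configuration by way of a minimal span. -/

namespace SimpleGraph
variable {V : Type u} {G : SimpleGraph V} {f : V → ℤ}

section Existence

/-- No edge leaves the open interval between `a` and `b` except towards `a` or `b`. -/
def IsSpan (G : SimpleGraph V) (f : V → ℤ) (a b : V) : Prop :=
  ∀ ⦃u v⦄, G.Adj u v → f a < f u → f u < f b → f a ≤ f v ∧ f v ≤ f b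

/-- The possible shapes of a span with at most one vertex inside. -/
inductive Side (G : SimpleGraph V) [G.LocallyFinite] (f : V → ℤ) (a b : V) : Prop
  | empty (inside : ∀ z, f a < f z → f z < f b → False)
      (left : ∀ z, G.Adj a z → f a < f z → f z ≤ f b → False)
      (right : ∀ z, G.Adj b z → f a ≤ f z → f z < f b → False)
  | edge (adj : G.Adj a b) (inside : ∀ z, f a < f z → f z < f b → False)
      (left : ∀ z, G.Adj a z → f a < f z → f z ≤ f b → z = b)
      (right : ∀ z, G.Adj b z → f a ≤ f z → f z < f b → z = a)
  | mid (w : V) (degree : G.degree w = 2) (adj_left : G.Adj a w) (adj_right : G.Adj w b)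
      (lt_left : f a < f w) (lt_right : f w < f b)
      (left : ∀ z, G.Adj a z → f a < f z → f z ≤ f b → z = w)
      (right : ∀ z, G.Adj b z → f a ≤ f z → f z < f b → z = w)


/-- The vertices strictly between `a` and `b`. -/
def verticesBetween [Fintype V] (f : V → ℤ) (a b : V) : Finset V :=
  Finset.univ.filter fun z => f a < f z ∧ f z < f b

theorem mem_verticesBetween [Fintype V] {a b z : V} : z ∈ verticesBetween f a b ↔ f a < f z ∧ f z < f b := by
  simp [verticesBetween]

/-- A single inner vertex w can only be adjacent to a and b, and by 2-connectedness it is adjacent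
to both. Then ab is not an edge, since a triangle with a vertex of degree two yields a
configuration. -/
theorem IsSpan.side [Fintype V] [G.LocallyFinite] (hG : G.IsTwoConnected) (hd : ∀ v, G.degree v ≤ 3)
    (hf : Function.Injective f) {a b : V} (h : G.IsSpan f a b) (hab : f a < f b)
    (hcard : (verticesBetween f a b).card ≤ 1) (hn : ¬ G.HasConfiguration) : G.Side f a b := by
  have nab : a ≠ b := by rintro rfl; omega
  rcases (verticesBetween f a b).eq_empty_or_nonempty with he | ⟨w, hw⟩
  · have h0 : ∀ z, f a < f z → f z < f b → False := fun z h1 h2 => by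
      have := mem_verticesBetween.2 ⟨h1, h2⟩
      simp [he] at this
    have h1 : ∀ z, f a < f z → f z ≤ f b → z = b := fun z h1 h2 =>
      hf (le_antisymm h2 (not_lt.1 (h0 z h1)))
    have h2 : ∀ z, f a ≤ f z → f z < f b → z = a := fun z h1 h2 =>
      hf (le_antisymm (not_lt.1 fun h => h0 z h h2) h1)
    by_cases e : G.Adj a b
    · exact .edge e h0 (fun z _ => h1 z) (fun z _ => h2 z)
    · exact .empty h0 (fun z hz h3 h4 => e (h1 z h3 h4 ▸ hz))
        (fun z hz h3 h4 => e (h2 z h3 h4 ▸ hz).symm)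
  · obtain ⟨w1, w2⟩ := mem_verticesBetween.1 hw
    have hu : ∀ z, f a < f z → f z < f b → z = w := fun z h1 h2 =>
      Finset.card_le_one.1 hcard z (mem_verticesBetween.2 ⟨h1, h2⟩) w hw
    have hz : ∀ z, G.Adj w z → z = a ∨ z = b := fun z hz => by
      obtain ⟨h1, h2⟩ := h hz w1 w2
      rcases h1.lt_or_eq with h1 | h1
      · rcases h2.lt_or_eq with h2 | h2
        · exact absurd (hu z h1 h2) hz.ne'
        · exact Or.inr (hf h2)
      · exact Or.inl (hf h1.symm)
    have hwb : G.Adj w b := by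
      obtain ⟨r, hr, hwr⟩ := hG.exists_neighbor_ne w a
      exact (hz r hwr).resolve_left hr ▸ hwr
    have hwa : G.Adj w a := by
      obtain ⟨r, hr, hwr⟩ := hG.exists_neighbor_ne w b
      exact (hz r hwr).resolve_right hr ▸ hwr
    have dw := degree_eq_two hwa hwb nab hz
    have nadj : ¬ G.Adj a b := fun e => hn (.of_triangle hG hd hwa hwb e dw)
    refine .mid w dw hwa.symm hwb w1 w2 (fun z hz h1 h2 => ?_) fun z hz h1 h2 => ?_
    · rcases h2.lt_or_eq with h2 | h2
      · exact hu z h1 h2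
      · exact absurd (hf h2 ▸ hz) nadj
    · rcases h1.lt_or_eq with h1 | h1
      · exact hu z h1 h2
      · exact absurd (hf h1 ▸ hz).symm nadj

theorem Side.adj_or_isMid [G.LocallyFinite] {a b c d x y : V} (h : G.Side f a b)
    (hab : f a < f b) (hne : G.Adj a b ∨ ∃ w, f a < f w ∧ f w < f b)
    (hc : f c ≤ f a ∨ f b ≤ f c) (hd : f d ≤ f a ∨ f b ≤ f d) (hx : f x ≤ f a ∨ f b ≤ f x)
    (hy : f y ≤ f a ∨ f b ≤ f y) : G.Adj a b ∨ ∃ w, G.IsMid a b c d x y w := by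
  cases h with
  | empty h0 hl hr =>
    obtain h | ⟨w, h1, h2⟩ := hne
    · exact (hl b h hab le_rfl).elim
    · exact (h0 w h1 h2).elim
  | edge h => exact Or.inl h
  | mid w dw ha hb h1 h2 =>
    refine Or.inr ⟨w, dw, ha, hb, ?_, ?_, ?_, ?_⟩ <;> rintro rfl <;> omega

theorem Side.adj_or_exists [G.LocallyFinite] {a b : V} (h : G.Side f a b) (hab : f a < f b)
    (hne : G.Adj a b ∨ ∃ w, f a < f w ∧ f w < f b) :
    G.Adj a b ∨ ∃ w, G.degree w = 2 ∧ G.Adj a w ∧ G.Adj w b ∧ f a < f w ∧ f w < f b ∧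
      (∀ z, G.Adj a z → f a < f z → f z ≤ f b → z = w) ∧
      (∀ z, G.Adj b z → f a ≤ f z → f z < f b → z = w) := by
  cases h with
  | empty h0 hl hr =>
    obtain h | ⟨w, h1, h2⟩ := hne
    · exact (hl b h hab le_rfl).elim
    · exact (h0 w h1 h2).elim
  | edge h => exact Or.inl h
  | mid w dw ha hb h1 h2 h3 h4 => exact Or.inr ⟨w, dw, ha, hb, h1, h2, h3, h4⟩

theorem Side.inside_of_adj [G.LocallyFinite] {a b : V} (h : G.Side f a b) (hab : f a < f b)
    (e : G.Adj a b) (z : V) (h1 : f a < f z) (h2 : f z < f b) : False := by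
  cases h with
  | empty h0 => exact h0 z h1 h2
  | edge _ h0 => exact h0 z h1 h2
  | mid w _ _ _ w1 w2 l => exact w2.ne' (congrArg f (l b e hab le_rfl))

/-- Two crossing edges `ik`, `bj` whose end vertices cut a span from `i` to `j` into three spans with
at most one vertex inside each. -/
structure IsKite (G : SimpleGraph V) [G.LocallyFinite] (f : V → ℤ) (i b k j : V) : Prop where
  lt₁ : f i < f b
  lt₂ : f b < f k
  lt₃ : f k < f j
  adj_ik : G.Adj i k
  adj_bj : G.Adj b j
  span : G.IsSpan f i j
  left : ∀ z, G.Adj i z → f i < f z → f z < f j → z = k ∨ f z ≤ f b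
  right : ∀ z, G.Adj j z → f i < f z → f z < f j → z = b ∨ f k ≤ f z
  midLeft : ∀ z, G.Adj b z → z = j ∨ (f i ≤ f z ∧ f z ≤ f k)
  midRight : ∀ z, G.Adj k z → z = i ∨ (f b ≤ f z ∧ f z ≤ f j)
  side₁ : G.Side f i b
  side₂ : G.Side f b k
  side₃ : G.Side f k j

variable [Fintype V] [G.LocallyFinite] {i b k j : V}

/-- The three sides of the kite are edges or paths through a vertex of degree two. -/
def IsKite.Full (G : SimpleGraph V) (f : V → ℤ) (i b k j : V) : Prop :=
  (G.Adj i b ∨ ∃ w, f i < f w ∧ f w < f b) ∧ (G.Adj b k ∨ ∃ w, f b < f w ∧ f w < f k) ∧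
    (G.Adj k j ∨ ∃ w, f k < f w ∧ f w < f j)

omit [Fintype V] in
theorem IsKite.adj_b (h : G.IsKite f i b k j) (hf : Function.Injective f) {z : V}
    (hz : G.Adj b z) : z = j ∨ (f i ≤ f z ∧ f z < f b) ∨ (f b < f z ∧ f z ≤ f k) := by
  have := h.midLeft z hz
  have := hf.ne hz.ne
  grind

omit [Fintype V] in
theorem IsKite.adj_k (h : G.IsKite f i b k j) (hf : Function.Injective f) {z : V}
    (hz : G.Adj k z) : z = i ∨ (f b ≤ f z ∧ f z < f k) ∨ (f k < f z ∧ f z ≤ f j) := by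
  have := h.midRight z hz
  have := hf.ne hz.ne
  grind

/-- An empty side deprives its inner ends b or k of a neighbour, so one of them has degree at most
two. Together with the shape of the other sides this gives `G₁`, a triangle with a vertex of degree
two, or `G₃`. -/
theorem IsKite.full (h : G.IsKite f i b k j) (hG : G.IsTwoConnected)
    (hd : ∀ v, G.degree v ≤ 3) (hf : Function.Injective f) (hn : ¬ G.HasConfiguration) :
    IsKite.Full G f i b k j := by
  have l1 := h.lt₁
  have l2 := h.lt₂
  have l3 := h.lt₃
  have nij : i ≠ j := by rintro rfl; omega
  have nbk : b ≠ k := by rintro rfl; omega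
  have nib : i ≠ b := by rintro rfl; omega
  have nkj : k ≠ j := by rintro rfl; omega
  have Nb := fun z hz => h.adj_b hf (z := z) hz
  have Nk := fun z hz => h.adj_k hf (z := z) hz
  refine ⟨?_, ?_, ?_⟩
  · cases h.side₁ with
    | edge e => exact Or.inl e
    | mid w _ _ _ w1 w2 => exact Or.inr ⟨w, w1, w2⟩
    | empty _ _ r1 =>
      refine absurd ?_ hn
      cases h.side₂ with
      | empty _ q2 _ =>
        obtain ⟨z, hz, hbz⟩ := hG.exists_neighbor_ne b j
        rcases Nb z hbz with e | ⟨z1, z2⟩ | ⟨z1, z2⟩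
        · exact (hz e).elim
        · exact (r1 z hbz z1 z2).elim
        · exact (q2 z hbz z1 z2).elim
      | mid w dw bw wk _ _ q2 _ =>
        refine .of_adj_degree_two hG bw (degree_eq_two h.adj_bj bw ?_ fun z hz => ?_) dw
        · rintro rfl; omega
        · rcases Nb z hz with e | ⟨z1, z2⟩ | ⟨z1, z2⟩
          · exact Or.inl e
          · exact (r1 z hz z1 z2).elim
          · exact Or.inr (q2 z hz z1 z2)
      | edge e _ q2 r2 =>
        have db : G.degree b = 2 := degree_eq_two h.adj_bj e nkj.symm fun z hz => by
          rcases Nb z hz with e | ⟨z1, z2⟩ | ⟨z1, z2⟩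
          · exact Or.inl e
          · exact (r1 z hz z1 z2).elim
          · exact Or.inr (q2 z hz z1 z2)
        cases h.side₃ with
        | empty _ q3 _ =>
          refine .of_adj_degree_two hG e db (degree_eq_two h.adj_ik.symm e.symm nib fun z hz => ?_)
          rcases Nk z hz with e | ⟨z1, z2⟩ | ⟨z1, z2⟩
          · exact Or.inl e
          · exact Or.inr (r2 z hz z1 z2)
          · exact (q3 z hz z1 z2).elim
        | edge e3 => exact .of_triangle hG hd e h.adj_bj e3 db
        | mid w dw kw wj w1 w2 =>
          exact .of_square (u := b) (v := w) (x := k) (y := j) (by rintro rfl; omega) nkj e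
            h.adj_bj kw.symm wj db dw
  · cases h.side₂ with
    | edge e => exact Or.inl e
    | mid w _ _ _ w1 w2 => exact Or.inr ⟨w, w1, w2⟩
    | empty _ q2 r2 =>
      refine absurd ?_ hn
      cases h.side₁ with
      | empty _ _ r1 =>
        obtain ⟨z, hz, hbz⟩ := hG.exists_neighbor_ne b j
        rcases Nb z hbz with e | ⟨z1, z2⟩ | ⟨z1, z2⟩
        · exact (hz e).elim
        · exact (r1 z hbz z1 z2).elim
        · exact (q2 z hbz z1 z2).elim
      | mid w dw iw wb _ _ _ r1 =>
        refine .of_adj_degree_two hG wb.symm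
          (degree_eq_two h.adj_bj wb.symm ?_ fun z hz => ?_) dw
        · rintro rfl; omega
        · rcases Nb z hz with e | ⟨z1, z2⟩ | ⟨z1, z2⟩
          · exact Or.inl e
          · exact Or.inr (r1 z hz z1 z2)
          · exact (q2 z hz z1 z2).elim
      | edge e _ _ r1 =>
        have db : G.degree b = 2 := degree_eq_two h.adj_bj e.symm nij.symm fun z hz => by
          rcases Nb z hz with e | ⟨z1, z2⟩ | ⟨z1, z2⟩
          · exact Or.inl e
          · exact Or.inr (r1 z hz z1 z2)
          · exact (q2 z hz z1 z2).elim
        cases h.side₃ with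
        | empty _ q3 _ =>
          obtain ⟨z, hz, hkz⟩ := hG.exists_neighbor_ne k i
          rcases Nk z hkz with e | ⟨z1, z2⟩ | ⟨z1, z2⟩
          · exact (hz e).elim
          · exact (r2 z hkz z1 z2).elim
          · exact (q3 z hkz z1 z2).elim
        | edge e3 _ q3 _ =>
          refine .of_square (u := b) (v := k) nbk nij e.symm h.adj_bj h.adj_ik.symm e3 db
            (degree_eq_two h.adj_ik.symm e3 nij fun z hz => ?_)
          rcases Nk z hz with e | ⟨z1, z2⟩ | ⟨z1, z2⟩
          · exact Or.inl e
          · exact (r2 z hz z1 z2).elim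
          · exact Or.inr (q3 z hz z1 z2)
        | mid w dw kw wj w1 w2 q3 _ =>
          refine .of_adj_degree_two hG kw (degree_eq_two h.adj_ik.symm kw ?_ fun z hz => ?_) dw
          · rintro rfl; omega
          · rcases Nk z hz with e | ⟨z1, z2⟩ | ⟨z1, z2⟩
            · exact Or.inl e
            · exact (r2 z hz z1 z2).elim
            · exact Or.inr (q3 z hz z1 z2)
  · cases h.side₃ with
    | edge e => exact Or.inl e
    | mid w _ _ _ w1 w2 => exact Or.inr ⟨w, w1, w2⟩
    | empty _ q3 _ =>
      refine absurd ?_ hn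
      cases h.side₂ with
      | empty _ _ r2 =>
        obtain ⟨z, hz, hkz⟩ := hG.exists_neighbor_ne k i
        rcases Nk z hkz with e | ⟨z1, z2⟩ | ⟨z1, z2⟩
        · exact (hz e).elim
        · exact (r2 z hkz z1 z2).elim
        · exact (q3 z hkz z1 z2).elim
      | mid w dw bw wk _ _ _ r2 =>
        refine .of_adj_degree_two hG wk.symm
          (degree_eq_two h.adj_ik.symm wk.symm ?_ fun z hz => ?_) dw
        · rintro rfl; omega
        · rcases Nk z hz with e | ⟨z1, z2⟩ | ⟨z1, z2⟩
          · exact Or.inl e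
          · exact Or.inr (r2 z hz z1 z2)
          · exact (q3 z hz z1 z2).elim
      | edge e _ q2 r2 =>
        have dk : G.degree k = 2 := degree_eq_two h.adj_ik.symm e.symm nib fun z hz => by
          rcases Nk z hz with e | ⟨z1, z2⟩ | ⟨z1, z2⟩
          · exact Or.inl e
          · exact Or.inr (r2 z hz z1 z2)
          · exact (q3 z hz z1 z2).elim
        cases h.side₁ with
        | empty _ _ r1 =>
          refine .of_adj_degree_two hG e (degree_eq_two h.adj_bj e nkj.symm fun z hz => ?_) dk
          rcases Nb z hz with e | ⟨z1, z2⟩ | ⟨z1, z2⟩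
          · exact Or.inl e
          · exact (r1 z hz z1 z2).elim
          · exact Or.inr (q2 z hz z1 z2)
        | edge e1 => exact .of_triangle hG hd e.symm h.adj_ik.symm e1.symm dk
        | mid w dw iw wb w1 w2 =>
          exact .of_square (u := k) (v := w) (x := i) (y := b) (by rintro rfl; omega) nib
            h.adj_ik.symm e.symm iw.symm wb dk dw

omit [G.LocallyFinite] in
theorem nonempty_iso_top_of_forall_mem {i b k j : V} (hib : G.Adj i b) (hik : G.Adj i k)
    (hij : G.Adj i j) (hbk : G.Adj b k) (hbj : G.Adj b j) (hkj : G.Adj k j)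
    (h : ∀ z, z = i ∨ z = b ∨ z = k ∨ z = j) : Nonempty (G ≃g (⊤ : SimpleGraph (Fin 4))) := by
  classical
  have hu : (Finset.univ : Finset V) = {i, b, k, j} := by
    ext z
    simpa using h z
  have hc : Fintype.card V = 4 := by
    rw [← Finset.card_univ, hu]
    simp [hib.ne, hik.ne, hij.ne, hbk.ne, hbj.ne, hkj.ne]
  refine ⟨⟨Fintype.equivFinOfCardEq hc, fun {x y} => ?_⟩⟩
  rw [top_adj, (Fintype.equivFinOfCardEq hc).injective.ne_iff]
  refine ⟨fun hxy => ?_, fun hxy => hxy.ne⟩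
  rcases h x with rfl | rfl | rfl | rfl <;> rcases h y with rfl | rfl | rfl | rfl <;>
    first | exact (hxy rfl).elim | assumption | (apply Adj.symm; assumption)

theorem IsKite.hasConfiguration_or (h : G.IsKite f i b k j) (hG : G.IsTwoConnected)
    (hd : ∀ v, G.degree v ≤ 3) (hf : Function.Injective f) :
    G.HasConfiguration ∨ Nonempty (G ≃g (⊤ : SimpleGraph (Fin 4))) := by
  by_contra! hcon
  obtain ⟨hn, hK⟩ := hcon
  have l1 := h.lt₁
  have l2 := h.lt₂
  have l3 := h.lt₃
  have nij : i ≠ j := by rintro rfl; omega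
  have nbk : b ≠ k := by rintro rfl; omega
  have nib : i ≠ b := by rintro rfl; omega
  have nkj : k ≠ j := by rintro rfl; omega
  have njb := h.adj_bj.ne'
  have nki := h.adj_ik.ne'
  obtain ⟨f1, f2, f3⟩ := h.full hG hd hf hn
  let O : Set V := {z | f z < f i ∨ f j < f z}
  have hiO : i ∉ O := by simp only [O, Set.mem_ofPred_eq]; omega
  have hjO : j ∉ O := by simp only [O, Set.mem_ofPred_eq]; omega
  have hkO : k ∉ O := by simp only [O, Set.mem_ofPred_eq]; omega
  have hO : ∀ s r, s ∈ O → r ∉ O → G.Adj s r → r = i ∨ r = j := fun s r hs hr hsr => by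
    by_contra! hc
    have h1 := hf.ne hc.1
    have h2 := hf.ne hc.2
    simp only [O, Set.mem_ofPred_eq] at hs hr
    have := h.span hsr.symm (by omega) (by omega)
    omega
  have S₁ : ∀ x y, (f x ≤ f i ∨ f b ≤ f x) → (f y ≤ f i ∨ f b ≤ f y) → ∀ c d,
      f b ≤ f c → f b ≤ f d → (G.Adj i b ∨ ∃ w, G.IsMid i b c d x y w) :=
    fun x y hx hy c d hc hd' => h.side₁.adj_or_isMid l1 f1 (Or.inr hc) (Or.inr hd') hx hy
  have S₂ : ∀ x y, (f x ≤ f b ∨ f k ≤ f x) → (f y ≤ f b ∨ f k ≤ f y) → ∀ c d,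
      (f c ≤ f b ∨ f k ≤ f c) → (f d ≤ f b ∨ f k ≤ f d) →
      (G.Adj b k ∨ ∃ w, G.IsMid b k c d x y w) :=
    fun x y hx hy c d hc hd' => h.side₂.adj_or_isMid l2 f2 hc hd' hx hy
  have S₃ : ∀ x y, (f x ≤ f k ∨ f j ≤ f x) → (f y ≤ f k ∨ f j ≤ f y) → ∀ c d,
      f c ≤ f k → f d ≤ f k → (G.Adj k j ∨ ∃ w, G.IsMid k j c d x y w) :=
    fun x y hx hy c d hc hd' => h.side₃.adj_or_isMid l3 f3 (Or.inl hc) (Or.inl hd') hx hy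
  -- If ij is an edge, all four sides of the quadrangle are present. Should one of the other three
  -- be subdivided by a vertex w, the quadrangle is turned so that this side becomes the open one,
  -- with w in the role of both x and y.
  by_cases hij : G.Adj i j
  · rcases h.side₁.adj_or_exists l1 f1 with e₁ | ⟨w, dw, iw, wb, w1, w2, -, -⟩
    swap
    · exact hn (.of_kite hd (a := b) (b := k) (c := j) (d := i) (x := w) (y := w) h.adj_bj
        h.adj_ik.symm nbk nib.symm nkj nij.symm wb.symm iw (by rintro rfl; omega)
        (by rintro rfl; omega) (by rintro rfl; omega) (by rintro rfl; omega) (by rintro rfl; omega)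
        (by rintro rfl; omega) (S₂ w w (by omega) (by omega) j i (by omega) (by omega))
        (S₃ w w (by omega) (by omega) b i (by omega) (by omega)) (Or.inl hij.symm))
    rcases h.side₃.adj_or_exists l3 f3 with e₃ | ⟨w, dw, kw, wj, w1, w2, -, -⟩
    swap
    · exact hn (.of_kite hd (a := j) (b := i) (c := b) (d := k) (x := w) (y := w) h.adj_bj.symm
        h.adj_ik nij.symm nkj.symm nib nbk wj.symm kw (by rintro rfl; omega)
        (by rintro rfl; omega) (by rintro rfl; omega) (by rintro rfl; omega) (by rintro rfl; omega)
        (by rintro rfl; omega) (Or.inl hij.symm)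
        (S₁ w w (by omega) (by omega) j k (by omega) (by omega))
        (S₂ w w (by omega) (by omega) j i (by omega) (by omega)))
    rcases h.side₂.adj_or_exists l2 f2 with e₂ | ⟨w, dw, bw, wk, w1, w2, -, -⟩
    swap
    · exact hn (.of_kite hd (a := k) (b := j) (c := i) (d := b) (x := w) (y := w) h.adj_ik.symm
        h.adj_bj.symm nkj nbk.symm nij.symm nib wk.symm bw (by rintro rfl; omega)
        (by rintro rfl; omega) (by rintro rfl; omega) (by rintro rfl; omega) (by rintro rfl; omega)
        (by rintro rfl; omega) (S₃ w w (by omega) (by omega) i b (by omega) (by omega))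
        (Or.inl hij.symm) (S₁ w w (by omega) (by omega) k j (by omega) (by omega)))
    have Nj := fun z hz => eq_or_eq_or_eq_of_degree_le_three (z := z) (hd j) hij.symm
      h.adj_bj.symm e₃.symm nib nki.symm nbk hz
    refine hK.false (nonempty_iso_top_of_forall_mem e₁ h.adj_ik hij e₂ h.adj_bj e₃ fun z => ?_).some
    -- A fifth vertex would lie outside the interval. After deletion of i the outside is still
    -- attached, necessarily at j, which already has the three neighbours i, b, k.
    by_contra! hz
    have i1 := hf.ne hz.1
    have i2 := hf.ne hz.2.1
    have i3 := hf.ne hz.2.2.1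
    have i4 := hf.ne hz.2.2.2
    have z1 := h.side₁.inside_of_adj l1 e₁ z
    have z2 := h.side₂.inside_of_adj l2 e₂ z
    have z3 := h.side₃.inside_of_adj l3 e₃ z
    have zO : f z < f i ∨ f j < f z := by
      by_contra! hc
      rcases lt_or_gt_of_ne i2 with h2 | h2
      · exact z1 (by omega) h2
      · rcases lt_or_gt_of_ne i3 with h3 | h3
        · exact z2 h2 h3
        · exact z3 h3 (by omega)
    obtain ⟨s, hs, r, hr, hri, hsr⟩ := hG.exists_adj_ne (A := O) zO hiO hjO nij.symm
    obtain rfl := (hO s r hs hr hsr).resolve_left hri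
    simp only [O, Set.mem_ofPred_eq] at hs
    rcases Nj s hsr.symm with rfl | rfl | rfl <;> omega
  -- If i has an outside neighbour then so has j, because i alone cannot separate the outside; these
  -- are the vertices x and y of the configuration.
  · by_cases hx : ∃ x, G.Adj i x ∧ x ∈ O
    · obtain ⟨x, hix, hx⟩ := hx
      obtain ⟨y, hy, r, hr, hri, hyr⟩ := hG.exists_adj_ne hx hiO hkO nki
      obtain rfl := (hO y r hy hr hyr).resolve_left hri
      simp only [O, Set.mem_ofPred_eq] at hx hy
      exact hn (.of_kite hd (a := i) (b := b) (c := k) (d := r) (x := x) (y := y) h.adj_ik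
        h.adj_bj nib nij nbk nkj hix hyr.symm (by rintro rfl; omega)
        (by rintro rfl; omega) (by rintro rfl; omega) (by rintro rfl; omega) (by rintro rfl; omega)
        (by rintro rfl; omega) (S₁ x y (by omega) (by omega) k r (by omega) (by omega))
        (S₂ x y (by omega) (by omega) i r (by omega) (by omega))
        (S₃ x y (by omega) (by omega) i b (by omega) (by omega)))
    have Ni : ∀ z, G.Adj i z → z = k ∨ (f i < f z ∧ f z ≤ f b) := fun z hz => by
      have h1 : ¬ (f z < f i ∨ f j < f z) := fun h => hx ⟨z, hz, h⟩
      have h2 := hf.ne hz.ne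
      have h3 : f z ≠ f j := fun h => hij (hf h ▸ hz)
      rcases h.left z hz (by omega) (by omega) with e | e
      · exact Or.inl e
      · exact Or.inr ⟨by omega, e⟩
    have Nj : ∀ z, G.Adj j z → z = b ∨ (f k ≤ f z ∧ f z < f j) := fun z hz => by
      have h1 : ¬ (f z < f i ∨ f j < f z) := fun h => by
        obtain ⟨s, hs, r, hr, hrj, hsr⟩ := hG.exists_adj_ne (A := O) h hjO hkO nkj
        exact hx ⟨s, (hO s r hs hr hsr).resolve_right hrj ▸ hsr.symm, hs⟩
      have h2 := hf.ne hz.ne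
      have h3 : f z ≠ f i := fun h => hij (hf h ▸ hz.symm)
      rcases h.right z hz (by omega) (by omega) with e | e
      · exact Or.inl e
      · exact Or.inr ⟨e, by omega⟩
    cases h.side₁ with
    | empty h0 q1 _ =>
      obtain e | ⟨w, w1, w2⟩ := f1
      · exact q1 b e l1 le_rfl
      · exact h0 w w1 w2
    | mid w dw iw wb w1 w2 q1 _ =>
      refine hn (.of_adj_degree_two hG iw (degree_eq_two h.adj_ik iw (by rintro rfl; omega)
        fun z hz => ?_) dw)
      rcases Ni z hz with e | ⟨z1, z2⟩
      · exact Or.inl e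
      · exact Or.inr (q1 z hz z1 z2)
    | edge e₁ _ q1 _ =>
      cases h.side₃ with
      | empty h0 q3 _ =>
        obtain e | ⟨w, w1, w2⟩ := f3
        · exact q3 j e l3 le_rfl
        · exact h0 w w1 w2
      | mid w dw kw wj w1 w2 _ q3 =>
        refine hn (.of_adj_degree_two hG wj.symm (degree_eq_two h.adj_bj.symm wj.symm
          (by rintro rfl; omega) fun z hz => ?_) dw)
        rcases Nj z hz with e | ⟨z1, z2⟩
        · exact Or.inl e
        · exact Or.inr (q3 z hz z1 z2)
      -- With neither i nor j leading outside, both have degree two with common neighbours b and k,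
      -- which is `G₃`.
      | edge e₃ _ _ q3 =>
        refine hn (.of_square nij nbk e₁ h.adj_ik h.adj_bj.symm e₃.symm
          (degree_eq_two e₁ h.adj_ik nbk fun z hz => ?_)
          (degree_eq_two h.adj_bj.symm e₃.symm nbk fun z hz => ?_))
        · rcases Ni z hz with e | ⟨z1, z2⟩
          · exact Or.inr e
          · exact Or.inl (q1 z hz z1 z2)
        · rcases Nj z hz with e | ⟨z1, z2⟩
          · exact Or.inl e
          · exact Or.inr (q3 z hz z1 z2)

/-- Induction on the number of inner vertices: any smaller span with two inner vertices would finish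
the proof, so all proper sub-spans have at most one and `IsSpan.side` describes them. -/
theorem IsSpan.hasConfiguration_or (hG : G.IsTwoConnected) (hd : ∀ v, G.degree v ≤ 3)
    (hf : G.IsLinearDrawing f) (hij : f i < f j) (h : G.IsSpan f i j)
    (hcard : 2 ≤ (verticesBetween f i j).card) :
    G.HasConfiguration ∨ Nonempty (G ≃g (⊤ : SimpleGraph (Fin 4))) := by
  classical
  induction hm : (verticesBetween f i j).card using Nat.strong_induction_on generalizing i j with
  | _ m ih =>
  subst hm
  by_contra hcon
  have hn : ¬ G.HasConfiguration := fun h => hcon (Or.inl h)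
  have hi := hf.injective
  have sub : ∀ a b z, f a < f b → G.IsSpan f a b → f i ≤ f a → f b ≤ f j → f i < f z → f z < f j →
      (f z ≤ f a ∨ f b ≤ f z) → (verticesBetween f a b).card ≤ 1 := by
    intro a b z hab hs ha hb z1 z2 hz
    by_contra! hc
    refine hcon (ih _ (Finset.card_lt_card ?_) hab hs hc rfl)
    refine Finset.ssubset_iff_subset_ne.2 ⟨fun y hy => ?_, fun e => ?_⟩
    · rw [mem_verticesBetween] at hy ⊢
      omega
    · have := e ▸ mem_verticesBetween.2 ⟨z1, z2⟩
      rw [mem_verticesBetween] at this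
      omega
  have side : ∀ a b z, f a < f b → G.IsSpan f a b → f i ≤ f a → f b ≤ f j → f i < f z →
      f z < f j → (f z ≤ f a ∨ f b ≤ f z) → G.Side f a b := fun a b z hab hs ha hb z1 z2 hz =>
    hs.side hG hd hi hab (sub a b z hab hs ha hb z1 z2 hz) hn
  obtain ⟨w₀, hw₀⟩ : (verticesBetween f i j).Nonempty := Finset.card_pos.1 (by omega)
  obtain ⟨s, hs, his⟩ : ∃ s ∈ verticesBetween f i j, G.Adj i s := by
    obtain ⟨s, hs, r, hr, hrj, hsr⟩ := hG.exists_adj_ne (A := {z | z ∈ verticesBetween f i j})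
      (c := j) (d := i) hw₀ (by simp [mem_verticesBetween]) (by simp [mem_verticesBetween])
      (by rintro rfl; omega)
    simp only [Set.mem_ofPred_eq, mem_verticesBetween] at hs hr
    have h1 := h hsr hs.1 hs.2
    have h2 := hi.ne hrj
    obtain rfl : r = i := hi (by omega)
    exact ⟨s, mem_verticesBetween.2 hs, hsr.symm⟩
  -- The farthest inner neighbour of i, so that no edge from i ends in the interior beyond k.
  obtain ⟨k, hk, hmax⟩ := ((verticesBetween f i j).filter (G.Adj i)).exists_max_image f
    ⟨s, Finset.mem_filter.2 ⟨hs, his⟩⟩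
  simp only [Finset.mem_filter, mem_verticesBetween] at hk hmax
  obtain ⟨⟨k1, k2⟩, hik⟩ := hk
  by_cases hX : ∃ b d, G.Adj b d ∧ f i < f b ∧ f b < f k ∧ (f d < f i ∨ f k < f d)
  swap
  · push Not at hX
    have sik : G.IsSpan f i k := fun u v huv h1 h2 => hX u v huv h1 h2
    have skj : G.IsSpan f k j := fun u v huv h1 h2 => by
      have h3 := h huv (by omega) h2
      refine ⟨?_, h3.2⟩
      by_contra! h4
      rcases h3.1.lt_or_eq with h5 | h5
      · have := hX v u huv.symm h5 h4
        omega
      · have := hmax u ⟨⟨by omega, h2⟩, hi h5 ▸ huv.symm⟩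
        omega
    have e₁ := (side i k k k1 sik le_rfl k2.le k1 k2 (Or.inr le_rfl)).inside_of_adj k1 hik
    -- Nothing lies between i and k, so at least two inner vertices force one between k and j. It
    -- has degree two, and then so does k.
    have single : (∀ z, f k < f z → f z < f j → False) → False := fun hz => by
      have : verticesBetween f i j ⊆ {k} := fun z hz' => by
        rw [mem_verticesBetween] at hz'
        rw [Finset.mem_singleton]
        by_contra hne
        rcases lt_or_gt_of_ne (hi.ne hne) with h1 | h1
        · exact e₁ z hz'.1 h1
        · exact hz z h1 hz'.2
      have := Finset.card_le_card this
      simp at this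
      omega
    cases side k j k k2 skj k1.le le_rfl k1 k2 (Or.inl le_rfl) with
    | empty h0 => exact single h0
    | edge _ h0 => exact single h0
    | mid w dw kw wj w1 w2 l =>
      refine hn (.of_adj_degree_two hG kw (degree_eq_two hik.symm kw (by rintro rfl; omega)
        fun z hz => ?_) dw)
      have h1 := h hz k1 k2
      have h2 := hi.ne hz.ne
      by_cases h3 : f k < f z
      · exact Or.inr (l z hz h3 h1.2)
      · refine Or.inl (hi (le_antisymm ?_ h1.1))
        exact not_lt.1 fun h4 => e₁ z h4 (by omega)
  · obtain ⟨b, d, hbd, b1, b2, hd'⟩ := hX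
    have d0 := h hbd b1 (by omega)
    have d1 : f k < f d := by omega
    have hXc : Cross (f i) (f k) (f b) (f d) := cross_of_lt b1 b2 d1
    have U₁ : ∀ u v, G.Adj u v → f i < f u → f u < f k → f k < f v → u = b ∧ v = d := by
      intro u v huv h1 h2 h3
      have := hf.cross_unique hik hbd huv hXc (cross_of_lt h1 h2 h3)
      rw [Sym2.eq_iff] at this
      rcases this with ⟨rfl, rfl⟩ | ⟨rfl, rfl⟩
      · exact ⟨rfl, rfl⟩
      · omega
    have U₂ : ∀ u v, G.Adj u v → f u < f b → f b < f v → f v < f d → u = i ∧ v = k := by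
      intro u v huv h1 h2 h3
      have := hf.cross_unique hbd hik huv hXc.symm (cross_of_lt h1 h2 h3).symm
      rw [Sym2.eq_iff] at this
      rcases this with ⟨rfl, rfl⟩ | ⟨rfl, rfl⟩
      · exact ⟨rfl, rfl⟩
      · omega
    have U₃ : ∀ u v, G.Adj u v → f b < f u → f u < f d → f d < f v → False := by
      intro u v huv h1 h2 h3
      have := hf.cross_unique hbd hik huv hXc.symm (cross_of_lt h1 h2 h3)
      rw [Sym2.eq_iff] at this
      rcases this with ⟨rfl, rfl⟩ | ⟨rfl, rfl⟩ <;> omega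
    have sib : G.IsSpan f i b := fun u v huv h1 h2 => by
      refine ⟨(h huv h1 (by omega)).1, not_lt.1 fun h3 => ?_⟩
      by_cases h4 : f k < f v
      · obtain ⟨rfl, -⟩ := U₁ u v huv h1 (by omega) h4
        omega
      · obtain ⟨rfl, -⟩ := U₂ u v huv h2 h3 (by omega)
        omega
    have sbk : G.IsSpan f b k := fun u v huv h1 h2 => by
      refine ⟨not_lt.1 fun h3 => ?_, not_lt.1 fun h3 => ?_⟩
      · obtain ⟨-, rfl⟩ := U₂ v u huv.symm h3 h1 (by omega)
        omega
      · obtain ⟨rfl, -⟩ := U₁ u v huv (by omega) h2 h3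
        omega
    have skd : G.IsSpan f k d := fun u v huv h1 h2 => by
      refine ⟨not_lt.1 fun h3 => ?_, not_lt.1 fun h3 => ?_⟩
      · by_cases h4 : f v < f b
        · obtain ⟨-, rfl⟩ := U₂ v u huv.symm h4 (by omega) h2
          omega
        · obtain ⟨-, rfl⟩ := U₁ v u huv.symm (by omega) h3 h1
          omega
      · exact U₃ u v huv (by omega) h2 h3
    have sid : G.IsSpan f i d := fun u v huv h1 h2 => by
      refine ⟨(h huv h1 (by omega)).1, not_lt.1 fun h3 => ?_⟩
      by_cases h4 : f u ≤ f b
      · obtain ⟨-, rfl⟩ := U₁ u v huv h1 (by omega) (by omega)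
        omega
      · exact U₃ u v huv (by omega) h2 h3
    -- The span from i to d has both b and k inside, so by minimality it is the whole span.
    obtain rfl : d = j := by
      by_contra hne
      have := hi.ne hne
      have h1 := sub i d d (by omega) sid le_rfl d0.2 (by omega) (by omega) (Or.inr le_rfl)
      have := Finset.card_le_one.1 h1 b (mem_verticesBetween.2 ⟨b1, by omega⟩) k
        (mem_verticesBetween.2 ⟨k1, by omega⟩)
      subst this
      omega
    refine hcon (IsKite.hasConfiguration_or (i := i) (b := b) (k := k) (j := d)
      ⟨b1, b2, k2, hik, hbd, h, fun z hz z1 z2 => ?_, fun z hz z1 z2 => ?_, fun z hz => ?_,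
      fun z hz => ?_, side i b b b1 sib le_rfl (by omega) b1 (by omega) (Or.inr le_rfl),
      side b k b b2 sbk b1.le k2.le b1 (by omega) (Or.inl le_rfl),
      side k d k k2 skd k1.le le_rfl k1 k2 (Or.inl le_rfl)⟩ hG hd hi)
    · by_cases h1 : f z ≤ f b
      · exact Or.inr h1
      · exact Or.inl (U₂ i z hz b1 (by omega) z2).2
    · by_cases h1 : f k ≤ f z
      · exact Or.inr h1
      · exact Or.inl (U₁ z d hz.symm z1 (by omega) k2).1
    · have h1 := h hz b1 (by omega)
      by_cases h2 : f z ≤ f k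
      · exact Or.inr ⟨h1.1, h2⟩
      · exact Or.inl (U₁ b z hz b1 b2 (by omega)).2
    · have h1 := h hz k1 k2
      by_cases h2 : f b ≤ f z
      · exact Or.inr ⟨h2, h1.2⟩
      · exact Or.inl (U₂ z k hz.symm (by omega) b2 k2).1

/-- A 2-connected graph of maximum degree at most three with a linear drawing is `K₄` or contains
one of the configurations. -/
theorem IsLinearDrawing.hasConfiguration_or (hf : G.IsLinearDrawing f) (hG : G.IsTwoConnected)
    (hd : ∀ v, G.degree v ≤ 3) :
    G.HasConfiguration ∨ Nonempty (G ≃g (⊤ : SimpleGraph (Fin 4))) := by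
  have hi := hf.injective
  have h3 := hG.three_le_card
  have hne : (Finset.univ : Finset V).Nonempty := Finset.card_pos.1 (by rw [Finset.card_univ]; omega)
  obtain ⟨i, -, hmin⟩ := Finset.univ.exists_min_image f hne
  obtain ⟨j, -, hmax⟩ := Finset.univ.exists_max_image f hne
  simp only [Finset.mem_univ, true_implies] at hmin hmax
  obtain ⟨w, hwi, hwj⟩ := hG.exists_ne_ne i j
  have w1 := lt_of_le_of_ne (hmin w) (hi.ne hwi.symm)
  have w2 := lt_of_le_of_ne (hmax w) (hi.ne hwj)
  -- The whole graph lies between its first and its last vertex, which provides a span to start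
  -- from.
  have hs : G.IsSpan f i j := fun u v _ _ _ => ⟨hmin v, hmax v⟩
  by_cases hc : 2 ≤ (verticesBetween f i j).card
  · exact hs.hasConfiguration_or hG hd hf (w1.trans w2) hc
  refine Or.inl (by_contra fun hn => ?_)
  have hside := hs.side hG hd hi (w1.trans w2) (by omega) hn
  cases hside with
  | empty h0 => exact h0 w w1 w2
  | edge _ h0 => exact h0 w w1 w2
  | mid u du iu uj _ _ l =>
    obtain ⟨r, hr, hir⟩ := hG.exists_neighbor_ne i u
    exact hr (l r hir (lt_of_le_of_ne (hmin r) (hi.ne hir.ne)) (hmax r))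

end Existence
end SimpleGraph

theorem mainTheorem3 {V : Type u} [Fintype V] (G : SimpleGraph V) [DecidableRel G.Adj]
    (hconn : G.IsTwoConnected) (hplanar : G.IsOuterOnePlanar) (hdeg : G.maxDegree ≤ 3) :
    (¬ Nonempty (G ≃g (⊤ : SimpleGraph (Fin 4))) →
      (∃ u v x y, G.IsG1 u v x y) ∨
      (∃ u v w x y, G.IsG2 u v w x y) ∨
      (∃ u v x y, G.IsG3 u v x y) ∨
      (∃ u₀ u₁ v₀ v₁ w x y, G.IsG4 u₀ u₁ v₀ v₁ w x y) ∨
      (∃ u₀ u₁ u₂ v₀ v₁ v₂ x y, G.IsG5 u₀ u₁ u₂ v₀ v₁ v₂ x y) ∨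
      (∃ u₀ u₁ u₂ v₀ v₁ w x y, G.IsG6 u₀ u₁ u₂ v₀ v₁ w x y) ∨
      (∃ u₀ u₁ u₂ v₀ v₁ v₂ w x y, G.IsG7 u₀ u₁ u₂ v₀ v₁ v₂ w x y) ∨
      (∃ u₀ u₁ u₂ v₀ v₁ x y, G.IsG8 u₀ u₁ u₂ v₀ v₁ x y) ∨
      (∃ t u v x y, G.IsH t u v x y)) ∧
    (∀ u v w x y, G.IsG2 u v w x y → x ≠ y →
      (G.deleteIdentify {u} v w).IsOuterOnePlanar) ∧
    (∀ u₀ u₁ v₀ v₁ w x y, G.IsG4 u₀ u₁ v₀ v₁ w x y → x ≠ y →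
      (G.deleteIdentify {u₀, v₀, w} u₁ v₁).IsOuterOnePlanar) ∧
    (∀ u₀ u₁ u₂ v₀ v₁ x y, G.IsG8 u₀ u₁ u₂ v₀ v₁ x y → x ≠ y →
      (G.deleteIdentify {u₀, u₁, v₀} u₂ v₁).IsOuterOnePlanar) ∧
    (∀ t u v x y, G.IsH t u v x y → x ≠ y →
      (G.deleteAddEdge (SimpleGraph.solidH t u v) x y).IsOuterOnePlanar) := by
  obtain ⟨f, hf⟩ := hplanar.exists_linearDrawing
  have hd : ∀ v, G.degree v ≤ 3 := fun v => (G.degree_le_maxDegree v).trans hdeg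
  exact ⟨fun hK => (hf.hasConfiguration_or hconn hd).resolve_right hK,
    fun u v w x y h hxy => h.isOuterOnePlanar hf hxy,
    fun u₀ u₁ v₀ v₁ w x y h hxy => h.isOuterOnePlanar hf hxy,
    fun u₀ u₁ u₂ v₀ v₁ x y h hxy => h.isOuterOnePlanar hf hxy,
    fun t u v x y h hxy => h.isOuterOnePlanar hf hconn hd hxy⟩
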